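/- Let $K$ be a complete discretely valued field with valuation ring $\mathcal{O}_K$, uniformizer $\pi_K$ and algebraically closed residue field $k$. An \emph{arithmetic surface} is a normal, integral, projective, flat $\mathcal{O}_K$-scheme of relative dimension $1$; a \emph{local arithmetic surface} is $\operatorname{Spec} A$ with $A$ isomorphic, as an $\mathcal{O}_K$-algebra, to the completed local ring of an arithmetic surface at a closed point. A local arithmetic surface $\mathcal{X}$ has \emph{normal crossings} if it has a finite \'etale covering $\mathcal{X}' \to \mathcal{X}$ such that the completed local ring at every closed point of $\mathcal{X}'$ is isomorphic to $\mathcal{O}_K[[t_1,t_2]]/(t_1^a t_2^b - u\pi_K)$ for some unit $u$ and integers $a,b \ge 0$ with $a+b>0$. Its closed point is \emph{non-nodal} if it is a smooth point of the reduced special fiber. An irreducible Weil divisor is \emph{vertical} if it lies in the special fiber, and \emph{horizontal} otherwise. Let $\phi \colon \mathcal{W} \to \mathcal{Z}$ be a finite morphism of local arithmetic surfaces over $\mathcal{O}_K$ that is cyclic of degree $\delta$, i.e. $\mathcal{W}$ is the normalization of $\mathcal{Z}$ in a cyclic Galois extension of degree $\delta$ of its function field, where $\operatorname{char} k \nmid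 \delta$. Let $B$ be the (reduced) branch divisor of $\phi$, let $w$ and $z$ be the closed points of $\mathcal{W}$ and $\mathcal{Z}$, and let $\phi_K \colon W \to Z$ be the generic fiber of $\phi$. Assume that $\mathcal{Z}$ is regular with normal crossings. (i) If $B$ is empty, or $B$ is irreducible and vertical, then $\mathcal{W}$ is regular with normal crossings. Furthermore, in this case, if $z$ is non-nodal, then $w$ is non-nodal. (ii) Assume further that $\mathcal{Z}$ is smooth over $\operatorname{Spec} \mathcal{O}_K$, and that $q \in Z$ is a (closed) branch point of $\phi_K$ (that is, $B$ has a horizontal component). Let $s$ be the degree of $q$ over $K$. Then $\mathcal{W}$ is regular with normal crossings if and only if one of the following two cases holds: (a) $B$ is irreducible and regular, and either $s = 1$ or $\delta = s = 2$; (b) $B$ consists of exactly one horizontal irreducible component $B_1$ and exactly one vertical irreducible component $B_2$, the ramification indices of $\phi$ over $B_1$ and $B_2$ are relatively prime, and $s = 1$. -/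

import Mathlib

open AlgebraicGeometry CategoryTheory IsLocalRing
open scoped TensorProduct

universe u v

noncomputable section

attribute [local instance] MvPolynomial.gradedAlgebra

/-- Projective space `ℙⁿ` over `Spec R`, as `Proj R[t₀, …, tₙ]`. -/
def projSpace (n : ℕ) (R : Type u) [CommRing R] : Scheme.{u} :=
  Proj (MvPolynomial.homogeneousSubmodule (Fin (n + 1)) R)

/-- The structure morphism `ℙⁿ ⟶ Spec R`. -/
def projSpaceStr (n : ℕ) (R : Type u) [CommRing R] :
    projSpace n R ⟶ Spec (CommRingCat.of R) :=
  Proj.toSpecZero (MvPolynomial.homogeneousSubmodule (Fin (n + 1)) R) ≫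
    Spec.map (CommRingCat.ofHom
      (algebraMap R (MvPolynomial.homogeneousSubmodule (Fin (n + 1)) R 0)))

/-- An arithmetic surface over `R` (a discrete valuation ring in the application): a normal,
integral, projective, flat `R`-scheme of relative dimension `1`. -/
structure IsArithmeticSurface {R : Type u} [CommRing R] {X : Scheme.{u}}
    (f : X ⟶ Spec (CommRingCat.of R)) : Prop where
  integral : IsIntegral X
  normal : ∀ x : X, IsIntegrallyClosed (X.presheaf.stalk x)
  projective : ∃ (n : ℕ) (i : X ⟶ projSpace n R), IsClosedImmersion i ∧ i ≫ projSpaceStr n R = f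
  flat : Flat f
  relDim : ∀ y : Spec (CommRingCat.of R), ∀ Z ∈ irreducibleComponents (f.fiber y),
    topologicalKrullDim Z = 1

/-- The ring homomorphism `R → 𝒪_{X,x}` coming from the structure morphism `X ⟶ Spec R`. -/
def toStalk {R : Type u} [CommRing R] {X : Scheme.{u}}
    (f : X ⟶ Spec (CommRingCat.of R)) (x : X) : R →+* X.presheaf.stalk x :=
  ((Scheme.ΓSpecIso (CommRingCat.of R)).inv ≫ f.appTop ≫
    X.presheaf.germ ⊤ x trivial).hom

/-- `Spec A` is a local arithmetic surface over `R`: the `R`-algebra `A` is isomorphic to the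
completed local ring of an arithmetic surface over `R` at a closed point. -/
def IsLocalArithmeticSurface (R : Type u) [CommRing R] (A : Type v) [CommRing A] [Algebra R A] :
    Prop :=
  ∃ (X : Scheme.{u}) (f : X ⟶ Spec (CommRingCat.of R)) (x : X),
    IsArithmeticSurface f ∧ IsClosed ({x} : Set X) ∧
    ∃ e : AdicCompletion (maximalIdeal (X.presheaf.stalk x)) (X.presheaf.stalk x) ≃+* A,
      ∀ r : R, e (algebraMap (X.presheaf.stalk x)
        (AdicCompletion (maximalIdeal (X.presheaf.stalk x)) (X.presheaf.stalk x))
        (toStalk f x r)) = algebraMap R A r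

/-- `Spec A`, for a local `R`-algebra `A`, has normal crossings over `R`: there is a finite étale
covering `Spec A' → Spec A` such that the completed local ring of `A'` at every closed point is
isomorphic over `R` to `R⟦t₁, t₂⟧ / (t₁ ^ a * t₂ ^ b - u * π)` with `a + b > 0` and `u` a unit. -/
def HasNormalCrossings (R : Type u) [CommRing R] (π : R) (A : Type v) [CommRing A] [Algebra R A] :
    Prop :=
  ∃ (A' : Type v) (_ : CommRing A') (_ : Algebra A A') (_ : Algebra R A')
    (_ : IsScalarTower R A A'),
    Algebra.Etale A A' ∧ Module.Finite A A' ∧ Nontrivial A' ∧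
    ∀ (M : Ideal A') [M.IsMaximal], ∃ (a b : ℕ) (u : MvPowerSeries (Fin 2) R),
      0 < a + b ∧ IsUnit u ∧
      Nonempty (AdicCompletion (maximalIdeal (Localization.AtPrime M)) (Localization.AtPrime M)
        ≃ₐ[R] (MvPowerSeries (Fin 2) R ⧸ Ideal.span
          {MvPowerSeries.X 0 ^ a * MvPowerSeries.X 1 ^ b - u * MvPowerSeries.C π}))

/-- The ideal of the special fibre of `Spec A → Spec R`. -/
def specialFiberIdeal (R : Type u) [CommRing R] [IsLocalRing R]
    (A : Type v) [CommRing A] [Algebra R A] : Ideal A :=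
  (maximalIdeal R).map (algebraMap R A)

/-- The closed point of `Spec A` is non-nodal: it is a smooth point of the reduced special fibre.
(The residue field is algebraically closed in the application, so smooth means regular.) -/
def IsNonNodal (R : Type u) [CommRing R] [IsLocalRing R]
    (A : Type v) [CommRing A] [Algebra R A] : Prop :=
  IsRegularLocalRing (A ⧸ (specialFiberIdeal R A).radical)

/-- `Spec A` is smooth over `Spec R` at its closed point: it is flat, and its special fibre is
smooth, i.e. regular, at the closed point. (The residue field of `R` is algebraically closed in the
application, so regular and geometrically regular agree.) -/
def IsSmoothAtClosedPoint (R : Type u) [CommRing R] [IsLocalRing R]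
    (A : Type v) [CommRing A] [Algebra R A] : Prop :=
  Module.Flat R A ∧ IsRegularLocalRing (A ⧸ specialFiberIdeal R A)

/-- The set of irreducible components (given by their generic points) of the branch divisor of
`Spec B → Spec A`: the primes of height one of `A` above which `B` is ramified somewhere. -/
def branchDivisor (A B : Type*) [CommRing A] [CommRing B] [Algebra A B] :
    Set (PrimeSpectrum A) :=
  {p | p.asIdeal.height = 1 ∧
    ∃ Q : PrimeSpectrum B, Q.asIdeal.under A = p.asIdeal ∧ ¬ Algebra.IsUnramifiedAt A Q.asIdeal}

/-- An irreducible divisor is vertical if it lies in the special fibre, and horizontal otherwise. -/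
def IsVertical (R : Type u) [CommRing R] [IsLocalRing R]
    {A : Type v} [CommRing A] [Algebra R A] (p : PrimeSpectrum A) : Prop :=
  specialFiberIdeal R A ≤ p.asIdeal

/-- The degree over `K = Frac R` of the generic fibre of the irreducible divisor `V(p)`.
For a horizontal `p` in a local arithmetic surface this generic fibre is a closed point `q` and
`K ⊗ A/p` is its residue field. -/
def horizontalDegree (R K : Type*) [CommRing R] [Field K] [Algebra R K]
    {A : Type*} [CommRing A] [Algebra R A] (p : PrimeSpectrum A) : ℕ :=
  Module.finrank K (K ⊗[R] (A ⧸ p.asIdeal))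

/-- The ramification indices of `Spec B → Spec A` above the two irreducible divisors
`V(p₁)` and `V(p₂)` are relatively prime. -/
def CoprimeRamification {A : Type*} (B : Type*) [CommRing A] [CommRing B] [Algebra A B]
    (p₁ p₂ : PrimeSpectrum A) : Prop :=
  ∀ Q₁ Q₂ : PrimeSpectrum B, Q₁.asIdeal.under A = p₁.asIdeal → Q₂.asIdeal.under A = p₂.asIdeal →
    (Q₁.asIdeal.ramificationIdx A).Coprime (Q₂.asIdeal.ramificationIdx A)

end

set_option linter.unusedSectionVars false

/-- `x, y` is a regular system of parameters of a two-dimensional regular local ring. -/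
structure IsParamPair {S : Type*} [CommRing S] [IsLocalRing S] (x y : S) : Prop where
  span_eq : maximalIdeal S = Ideal.span {x, y}
  prime_left : Prime x
  prime_right : Prime y
  not_dvd : ¬ x ∣ y
  not_dvd' : ¬ y ∣ x

theorem exists_eq_unit_mul_pow_of_maximalIdeal_eq_span {D : Type*} [CommRing D] [IsLocalRing D]
    [IsNoetherianRing D] {y : D} (hy : maximalIdeal D = Ideal.span {y}) {d : D} (hd : d ≠ 0) :
    ∃ (n : ℕ) (u : D), IsUnit u ∧ d = u * y ^ n := by
  have h1 : ∃ n, d ∉ maximalIdeal D ^ n := by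
    by_contra! h
    have := Ideal.iInf_pow_eq_bot_of_isLocalRing (maximalIdeal D) (Ideal.IsPrime.ne_top inferInstance)
    exact hd (by rw [← Ideal.mem_bot, ← this]; simpa using h)
  classical
  have h2 := Nat.find_spec h1
  obtain ⟨n, hn⟩ : ∃ n, Nat.find h1 = n + 1 := Nat.exists_eq_succ_of_ne_zero (by
    intro h0; rw [h0] at h2; simp at h2)
  have h3 : d ∈ maximalIdeal D ^ n := by
    by_contra h
    exact Nat.find_min h1 (m := n) (by omega) h
  rw [hn] at h2
  rw [hy, Ideal.span_singleton_pow, Ideal.mem_span_singleton'] at h3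
  obtain ⟨c, rfl⟩ := h3
  refine ⟨n, c, ?_, rfl⟩
  by_contra hc
  apply h2
  rw [pow_succ']
  exact Ideal.mul_mem_mul ((mem_maximalIdeal _).2 hc)
    (Ideal.pow_mem_pow (hy ▸ Ideal.mem_span_singleton_self y) n)

section

variable {S : Type*} [CommRing S] [IsLocalRing S] [IsNoetherianRing S]

theorem exists_sub_unit_mul_pow_mem {x y : S} (h : maximalIdeal S = Ideal.span {x, y}) {s : S}
    (hs : ¬ x ∣ s) : ∃ (n : ℕ) (u c : S), IsUnit u ∧ s = u * y ^ n + c * x := by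
  have hx : x ∈ maximalIdeal S := h ▸ Ideal.subset_span (by simp)
  have : Nontrivial (S ⧸ Ideal.span {x}) := Ideal.Quotient.nontrivial_iff.2 (by
    intro h; rw [Ideal.span_singleton_eq_top] at h; exact hx h)
  have := IsLocalRing.of_surjective' (Ideal.Quotient.mk (Ideal.span {x})) Ideal.Quotient.mk_surjective
  have hloc := IsLocalRing.surjective_units_map_of_local_ringHom (Ideal.Quotient.mk (Ideal.span {x}))
    Ideal.Quotient.mk_surjective (IsLocalHom.of_surjective _ Ideal.Quotient.mk_surjective)
  have hm : maximalIdeal (S ⧸ Ideal.span {x}) = Ideal.span {Ideal.Quotient.mk _ y} := by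
    rw [← IsLocalRing.map_maximalIdeal_of_surjective _
      (Ideal.Quotient.mk_surjective (I := Ideal.span {x})), h, Ideal.map_span, Set.image_pair,
      Ideal.Quotient.eq_zero_iff_mem.2 (Ideal.mem_span_singleton_self x), Ideal.span_insert]
    simp
  obtain ⟨n, u, hu, he⟩ := exists_eq_unit_mul_pow_of_maximalIdeal_eq_span hm
    (d := Ideal.Quotient.mk _ s) (by rwa [Ne, Ideal.Quotient.eq_zero_iff_dvd])
  obtain ⟨u', hu'⟩ := hloc hu.unit
  refine ⟨n, u', ?_⟩
  have h1 : Ideal.Quotient.mk (Ideal.span {x}) (u' : S) = u := by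
    have := congrArg Units.val hu'
    simpa using this
  rw [← h1, ← map_pow, ← map_mul, ← sub_eq_zero, ← map_sub, Ideal.Quotient.eq_zero_iff_dvd] at he
  obtain ⟨c, hc⟩ := he
  exact ⟨c, u'.isUnit, by linear_combination hc⟩

theorem not_dvd_pow_of_two_le_ringKrullDim (hdim : 2 ≤ ringKrullDim S) {x y : S}
    (h : maximalIdeal S = Ideal.span {x, y}) (n : ℕ) : ¬ x ∣ y ^ n := by
  intro hd
  have hx : x ∈ maximalIdeal S := h ▸ Ideal.subset_span (by simp)
  have hmin : maximalIdeal S ∈ (Ideal.span {x}).minimalPrimes := by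
    refine ⟨⟨inferInstance, by rwa [Ideal.span_singleton_le_iff_mem]⟩, ?_⟩
    rintro P ⟨hP, hxP⟩ -
    rw [Ideal.span_singleton_le_iff_mem] at hxP
    have hyP : y ∈ P := hP.mem_of_pow_mem n (P.mem_of_dvd hd hxP)
    rw [h, Ideal.span_le]
    rintro z (rfl | rfl) <;> assumption
  have h1 := Ideal.height_le_one_of_isPrincipal_of_mem_minimalPrimes _ _ hmin
  rw [← IsLocalRing.maximalIdeal_height_eq_ringKrullDim] at hdim
  have : (2 : ℕ∞) ≤ 1 := le_trans (WithBot.coe_le_coe.1 hdim) h1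
  exact absurd this (by decide)

theorem prime_of_two_le_ringKrullDim [IsDomain S] (hdim : 2 ≤ ringKrullDim S) {x y : S}
    (h : maximalIdeal S = Ideal.span {x, y}) : Prime x := by
  have hx : x ∈ maximalIdeal S := h ▸ Ideal.subset_span (by simp)
  refine ⟨?_, hx, ?_⟩
  · rintro rfl
    have h1 : maximalIdeal S = Ideal.span {y, 0} := by rw [h, Set.pair_comm]
    apply not_dvd_pow_of_two_le_ringKrullDim hdim h1 1
    simp
  · intro a b hab
    by_contra! hc
    obtain ⟨n, u, c, hu, ha⟩ := exists_sub_unit_mul_pow_mem h hc.1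
    obtain ⟨m, v, d, hv, hb⟩ := exists_sub_unit_mul_pow_mem h hc.2
    have : x ∣ (u * v) * y ^ (n + m) := by
      have e : (u * v) * y ^ (n + m) = a * b - x * (c * (v * y ^ m + d * x) + u * y ^ n * d) := by
        rw [ha, hb]; ring
      rw [e]
      exact dvd_sub hab (dvd_mul_right _ _)
    rw [(hu.mul hv).dvd_mul_left] at this
    exact not_dvd_pow_of_two_le_ringKrullDim hdim h _ this

theorem IsParamPair.of_span_eq [IsDomain S] (hdim : 2 ≤ ringKrullDim S) {x y : S}
    (h : maximalIdeal S = Ideal.span {x, y}) : IsParamPair x y := by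
  have h' : maximalIdeal S = Ideal.span {y, x} := by rw [h, Set.pair_comm]
  refine ⟨h, prime_of_two_le_ringKrullDim hdim h, prime_of_two_le_ringKrullDim hdim h', ?_, ?_⟩
  · simpa using not_dvd_pow_of_two_le_ringKrullDim hdim h 1
  · simpa using not_dvd_pow_of_two_le_ringKrullDim hdim h' 1

theorem IsRegularLocalRing.of_maximalIdeal_eq_span_pair (hdim : 2 ≤ ringKrullDim S) {x y : S}
    (h : maximalIdeal S = Ideal.span {x, y}) : IsRegularLocalRing S := by
  refine IsRegularLocalRing.of_spanFinrank_maximalIdeal_le _ (le_trans ?_ hdim)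
  have : (maximalIdeal S).spanFinrank ≤ 2 := by
    rw [h]
    exact (Submodule.spanFinrank_span_le_ncard_of_finite (Set.toFinite _)).trans
      ((Set.ncard_insert_le _ _).trans (by simp))
  exact_mod_cast this

end

namespace IsParamPair

variable {S : Type*} [CommRing S] [IsLocalRing S] {x y : S} (h : IsParamPair x y)

include h

theorem symm : IsParamPair y x :=
  ⟨by rw [h.span_eq, Set.pair_comm], h.prime_right, h.prime_left, h.not_dvd', h.not_dvd⟩

theorem left_mem : x ∈ maximalIdeal S := h.span_eq ▸ Ideal.subset_span (by simp)

theorem right_mem : y ∈ maximalIdeal S := h.span_eq ▸ Ideal.subset_span (by simp)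

theorem exists_eq {s : S} (hs : s ∈ maximalIdeal S) : ∃ a b, s = a * x + b * y := by
  rw [h.span_eq, Ideal.mem_span_pair] at hs
  obtain ⟨a, b, e⟩ := hs
  exact ⟨a, b, e.symm⟩

theorem isPrime_span_left : (Ideal.span {x}).IsPrime :=
  (Ideal.span_singleton_prime h.prime_left.ne_zero).2 h.prime_left

theorem isDomain_quotient : IsDomain (S ⧸ Ideal.span {x}) :=
  (Ideal.Quotient.isDomain_iff_prime _).2 h.isPrime_span_left

theorem isLocalRing_quotient : IsLocalRing (S ⧸ Ideal.span {x}) := by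
  have := h.isDomain_quotient
  exact IsLocalRing.of_surjective' (Ideal.Quotient.mk (Ideal.span {x})) Ideal.Quotient.mk_surjective

theorem isUnit_or_isUnit {a b c d e f : S} {X Y : S} 
    (hx : x = a * X + b * Y) (hX : X = c * x + d * y) (hY : Y = e * x + f * y) :
    IsUnit a ∨ IsUnit b := by
  by_contra! hn
  have ha : a ∈ maximalIdeal S := hn.1
  have hb : b ∈ maximalIdeal S := hn.2
  have hu : IsUnit (1 - a * c - b * e) := by
    by_contra hu
    have h1 : (1 : S) ∈ maximalIdeal S := by
      have : (1 : S) = (1 - a * c - b * e) + (c * a + e * b) := by ring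
      rw [this]
      exact Ideal.add_mem _ hu (Ideal.add_mem _ (Ideal.mul_mem_left _ _ ha)
        (Ideal.mul_mem_left _ _ hb))
    exact h1 isUnit_one
  apply h.not_dvd'
  have : (1 - a * c - b * e) * x = y * (a * d + b * f) := by
    linear_combination hx + a * hX + b * hY
  exact (hu.dvd_mul_left).1 ⟨_, this⟩

/-- A parameter is not in the square of the maximal ideal. -/
theorem isUnit_of_eq {X Y a b : S} (hXY : IsParamPair X Y) (hx : x = a * X + b * Y) :
    IsUnit a ∨ IsUnit b := by
  obtain ⟨c, d, h1⟩ := h.exists_eq hXY.left_mem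
  obtain ⟨e, f, h2⟩ := h.exists_eq hXY.right_mem
  exact h.isUnit_or_isUnit hx h1 h2

variable [IsNoetherianRing S]

theorem exists_eq_unit_mul_pow_add {s : S} (hs : ¬ x ∣ s) :
    ∃ (n : ℕ) (u c : S), IsUnit u ∧ s = u * y ^ n + c * x :=
  exists_sub_unit_mul_pow_mem h.span_eq hs

theorem isDiscreteValuationRing_quotient :
    have := h.isDomain_quotient
    IsDiscreteValuationRing (S ⧸ Ideal.span {x}) := by
  have := h.isDomain_quotient
  have := h.isLocalRing_quotient
  have hm : maximalIdeal (S ⧸ Ideal.span {x}) = Ideal.span {Ideal.Quotient.mk _ y} := by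
    rw [← IsLocalRing.map_maximalIdeal_of_surjective _
      (Ideal.Quotient.mk_surjective (I := Ideal.span {x})), h.span_eq, Ideal.map_span,
      Set.image_pair, Ideal.Quotient.eq_zero_iff_mem.2 (Ideal.mem_span_singleton_self x),
      Ideal.span_insert]
    simp
  have hf : ¬ IsField (S ⧸ Ideal.span {x}) := by
    rw [IsLocalRing.isField_iff_maximalIdeal_eq, hm, Ideal.span_singleton_eq_bot,
      Ideal.Quotient.eq_zero_iff_dvd]
    exact h.not_dvd
  exact ((IsDiscreteValuationRing.TFAE _ hf).out 0 4).2 (by rw [hm]; exact ⟨_, rfl⟩)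

theorem isRegularLocalRing_quotient : IsRegularLocalRing (S ⧸ Ideal.span {x}) := by
  have := h.isDomain_quotient
  have := h.isDiscreteValuationRing_quotient
  infer_instance

theorem uniqueFactorizationMonoid [IsDomain S] : UniqueFactorizationMonoid S := by
  refine UniqueFactorizationMonoid.iff_exists_prime_mem_of_isPrime.2 fun P hP0 hP ↦ ?_
  by_cases hxP : x ∈ P
  · exact ⟨x, hxP, h.prime_left⟩
  have := h.isDomain_quotient
  have := h.isDiscreteValuationRing_quotient
  obtain ⟨f', hf'⟩ := (IsPrincipalIdealRing.principal
    (P.map (Ideal.Quotient.mk (Ideal.span {x})))).principal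
  have hf'' : f' ∈ P.map (Ideal.Quotient.mk (Ideal.span {x})) := by
    rw [hf']; exact Submodule.mem_span_singleton_self f'
  obtain ⟨f, hfP, rfl⟩ := (Ideal.mem_map_iff_of_surjective _ Ideal.Quotient.mk_surjective).1 hf''
  have hle : P ≤ Ideal.span {f} := by
    refine Submodule.le_of_le_smul_of_le_jacobson_bot (I := maximalIdeal S) (N := Ideal.span {f})
      (N' := P) (IsNoetherian.noetherian _) (IsLocalRing.maximalIdeal_le_jacobson _) ?_
    intro p hp
    have h1 : Ideal.Quotient.mk (Ideal.span {x}) p ∈ Ideal.span {Ideal.Quotient.mk (Ideal.span {x}) f} := by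
      have := Ideal.mem_map_of_mem (Ideal.Quotient.mk (Ideal.span {x})) hp
      rw [hf'] at this
      exact this
    obtain ⟨c, hc⟩ := Ideal.mem_span_singleton'.1 h1
    obtain ⟨c, rfl⟩ := Ideal.Quotient.mk_surjective c
    rw [← map_mul, ← sub_eq_zero, ← map_sub, Ideal.Quotient.eq_zero_iff_dvd] at hc
    obtain ⟨d, hd⟩ := hc
    have hdP : d ∈ P := (hP.mem_or_mem (x := x) (y := d) (by
      rw [← hd]; exact P.sub_mem (P.mul_mem_left _ hfP) hp)).resolve_left hxP
    have e : p = c * f + x * (-d) := by linear_combination -hd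
    rw [e]
    exact Submodule.add_mem_sup (Ideal.mem_span_singleton'.2 ⟨c, rfl⟩)
      (Submodule.smul_mem_smul h.left_mem (P.neg_mem hdP))
  have hPf : P = Ideal.span {f} := le_antisymm hle (by rwa [Ideal.span_singleton_le_iff_mem])
  refine ⟨f, hfP, (Ideal.span_singleton_prime ?_).1 (hPf ▸ hP)⟩
  rintro rfl
  exact hP0 (by simpa using hPf)

end IsParamPair

theorem MvPowerSeries.exists_algHom_X_eq {R B σ : Type*} [Finite σ] [CommRing R] [CommRing B]
    [Algebra R B] (I : Ideal B) [IsAdicComplete I B] (v : σ → B) (hv : ∀ i, v i ∈ I) :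
    ∃ E : MvPowerSeries σ R →ₐ[R] B, ∀ i, E (MvPowerSeries.X i) = v i := by
  have hle : MvPolynomial.idealOfVars σ R ≤ I.comap (MvPolynomial.aeval v : _ →ₐ[R] B) := by
    rw [MvPolynomial.idealOfVars, Ideal.span_le]
    rintro _ ⟨i, rfl⟩
    simpa using hv i
  have hpow (n : ℕ) : MvPolynomial.idealOfVars σ R ^ n ≤
      (I ^ n).comap (MvPolynomial.aeval v : _ →ₐ[R] B) :=
    (Ideal.pow_right_mono hle n).trans (Ideal.le_comap_pow _ n)
  let f (n : ℕ) : MvPowerSeries σ R →ₐ[R] B ⧸ I ^ n :=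
    (Ideal.Quotient.liftₐ (MvPolynomial.idealOfVars σ R ^ n)
      ((Ideal.Quotient.mkₐ R (I ^ n)).comp (MvPolynomial.aeval v)) (fun a ha ↦ by
        exact Ideal.Quotient.eq_zero_iff_mem.2 (hpow n ha))).comp
      ((MvPowerSeries.truncTotalAlgHom σ R n).restrictScalars R)
  have hf (n : ℕ) (p : MvPowerSeries σ R) :
      f n p = Ideal.Quotient.mk (I ^ n) (MvPolynomial.aeval v (p.truncTotal n)) := rfl
  have hcompat {m n : ℕ} (h : m ≤ n) :
      (Ideal.Quotient.factorₐ R (Ideal.pow_le_pow_right h)).comp (f n) = f m := by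
    ext p
    rw [AlgHom.comp_apply, hf, hf]
    change Ideal.Quotient.mk (I ^ m) _ = _
    rw [← sub_eq_zero, ← map_sub, ← map_sub, Ideal.Quotient.eq_zero_iff_mem]
    exact hpow m (MvPowerSeries.truncTotal_sub_truncTotal_mem_pow_idealOfVars h le_rfl p)
  refine ⟨IsAdicComplete.liftAlgHom I f hcompat, fun i ↦ ?_⟩
  rw [← sub_eq_zero]
  refine IsHausdorff.haus' (I := I) _ fun n ↦ ?_
  rw [SModEq.zero, smul_eq_mul, Ideal.mul_top, ← Ideal.Quotient.eq_zero_iff_mem, map_sub,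
    IsAdicComplete.mk_liftAlgHom]
  have h1 : (f n) (MvPowerSeries.X i) = Ideal.Quotient.mk (I ^ n) (v i) := by
    have h2 := (MvPowerSeries.truncTotalAlgHom σ R n).commutes (MvPolynomial.X i)
    have h3 : algebraMap (MvPolynomial σ R) (MvPowerSeries σ R) (MvPolynomial.X i) =
      MvPowerSeries.X i := MvPolynomial.coe_X i
    rw [h3] at h2
    have h4 : (MvPowerSeries.X i : MvPowerSeries σ R).truncTotal n - MvPolynomial.X i ∈
        MvPolynomial.idealOfVars σ R ^ n := Ideal.Quotient.eq.1 h2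
    have h5 := Ideal.Quotient.eq_zero_iff_mem.2 (Ideal.mem_comap.1 (hpow n h4))
    rw [map_sub, map_sub, sub_eq_zero, MvPolynomial.aeval_X] at h5
    rw [hf, h5]
  rw [h1, sub_self]

theorem MvPowerSeries.mem_span_X_of_constantCoeff_eq_zero {R : Type*} [CommRing R]
    {f : MvPowerSeries (Fin 2) R} (hf : MvPowerSeries.constantCoeff f = 0) :
    f ∈ Ideal.span {MvPowerSeries.X 0, (MvPowerSeries.X 1 : MvPowerSeries (Fin 2) R)} := by
  classical
  let g : MvPowerSeries (Fin 2) R := fun m ↦ if m 0 = 0 then MvPowerSeries.coeff m f else 0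
  have hg (m : Fin 2 →₀ ℕ) : MvPowerSeries.coeff m g =
    if m 0 = 0 then MvPowerSeries.coeff m f else 0 := rfl
  have h0 : (MvPowerSeries.X 0 : MvPowerSeries (Fin 2) R) ∣ f - g := by
    rw [MvPowerSeries.X_dvd_iff]
    intro m hm
    rw [map_sub, hg, if_pos hm, sub_self]
  have h1 : (MvPowerSeries.X 1 : MvPowerSeries (Fin 2) R) ∣ g := by
    rw [MvPowerSeries.X_dvd_iff]
    intro m hm
    rw [hg]
    split_ifs with h
    · have : m = 0 := by
        ext i; fin_cases i
        · exact h
        · exact hm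
      rw [this, MvPowerSeries.coeff_zero_eq_constantCoeff_apply, hf]
    · rfl
  obtain ⟨a, ha⟩ := h0
  obtain ⟨b, hb⟩ := h1
  rw [Ideal.mem_span_pair]
  exact ⟨a, b, by linear_combination -ha - hb⟩

section

variable (R : Type*) [CommRing R] [IsDomain R] [IsDiscreteValuationRing R] {π : R}
  (hπ : Irreducible π)

include hπ in
theorem maximalIdeal_quotient_normalCrossings_eq {a b : ℕ} (hab : 0 < a + b)
    {u : MvPowerSeries (Fin 2) R} (hu : IsUnit u) {D : Type*} [CommRing D] [IsLocalRing D]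
    (q : MvPowerSeries (Fin 2) R →+* D) (hq : Function.Surjective q)
    (h0 : q (MvPowerSeries.X 0 ^ a * MvPowerSeries.X 1 ^ b - u * MvPowerSeries.C π) = 0) :
    maximalIdeal D = Ideal.span {q (MvPowerSeries.X 0), q (MvPowerSeries.X 1)} := by
  have hloc := IsLocalHom.of_surjective q hq
  have hX (i : Fin 2) : MvPowerSeries.X i ∈ maximalIdeal (MvPowerSeries (Fin 2) R) := by
    rw [mem_maximalIdeal, mem_nonunits_iff, MvPowerSeries.isUnit_iff_constantCoeff]
    simp
  have hqπ : q (MvPowerSeries.C π) ∈ Ideal.span {q (MvPowerSeries.X 0), q (MvPowerSeries.X 1)} := by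
    have h1 : q (MvPowerSeries.X 0) ^ a * q (MvPowerSeries.X 1) ^ b ∈
        Ideal.span {q (MvPowerSeries.X 0), q (MvPowerSeries.X 1)} := by
      rcases Nat.eq_zero_or_pos a with ha | ha
      · exact Ideal.mul_mem_left _ _ (Ideal.pow_mem_of_mem _ (Ideal.subset_span (by simp)) _
          (by omega))
      · exact Ideal.mul_mem_right _ _ (Ideal.pow_mem_of_mem _ (Ideal.subset_span (by simp)) _ ha)
    rw [map_sub, sub_eq_zero, map_mul, map_pow, map_pow, map_mul] at h0
    rw [h0] at h1
    exact (Ideal.unit_mul_mem_iff_mem _ (hu.map q)).1 h1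
  apply le_antisymm
  · rw [← IsLocalRing.map_maximalIdeal_of_surjective q hq, Ideal.map_le_iff_le_comap]
    intro f hf
    have hc : MvPowerSeries.constantCoeff f ∈ maximalIdeal R := by
      rw [mem_maximalIdeal, mem_nonunits_iff] at hf ⊢
      rwa [← MvPowerSeries.isUnit_iff_constantCoeff]
    rw [hπ.maximalIdeal_eq, Ideal.mem_span_singleton'] at hc
    obtain ⟨r, hr⟩ := hc
    have hf0 : f - MvPowerSeries.C r * MvPowerSeries.C π ∈
        Ideal.span {MvPowerSeries.X 0, (MvPowerSeries.X 1 : MvPowerSeries (Fin 2) R)} := by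
      apply MvPowerSeries.mem_span_X_of_constantCoeff_eq_zero
      simp [← hr]
    have h2 := Ideal.mem_map_of_mem q hf0
    rw [Ideal.map_span, Set.image_pair, map_sub, map_mul] at h2
    have := Ideal.add_mem _ h2 (Ideal.mul_mem_left _ (q (MvPowerSeries.C r)) hqπ)
    simpa using this
  · rw [Ideal.span_le]
    rintro z (rfl | rfl)
    · rw [SetLike.mem_coe, ← IsLocalRing.map_maximalIdeal_of_surjective q hq]
      exact Ideal.mem_map_of_mem q (hX 0)
    · rw [SetLike.mem_coe, ← IsLocalRing.map_maximalIdeal_of_surjective q hq]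
      exact Ideal.mem_map_of_mem q (hX 1)

include hπ in
theorem exists_algEquiv_normalCrossings {B : Type*} [CommRing B] [IsDomain B] [IsLocalRing B]
    [IsNoetherianRing B] [IsAdicComplete (maximalIdeal B) B] [Algebra R B]
    (hres : Function.Surjective ((Ideal.Quotient.mk (maximalIdeal B)).comp (algebraMap R B)))
    {x y w : B} (h : IsParamPair x y) (hw : IsUnit w) {a b : ℕ} (hab : 0 < a + b)
    (hπB : algebraMap R B π = w * (x ^ a * y ^ b)) :
    ∃ u : MvPowerSeries (Fin 2) R, IsUnit u ∧ Nonempty (B ≃ₐ[R] (MvPowerSeries (Fin 2) R ⧸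
      Ideal.span {MvPowerSeries.X 0 ^ a * MvPowerSeries.X 1 ^ b - u * MvPowerSeries.C π})) := by
  obtain ⟨E, hE⟩ := MvPowerSeries.exists_algHom_X_eq (R := R) (maximalIdeal B) ![x, y] (by
    intro i; fin_cases i
    · exact h.left_mem
    · exact h.right_mem)
  have hE0 : E (MvPowerSeries.X 0) = x := hE 0
  have hE1 : E (MvPowerSeries.X 1) = y := hE 1
  have hmap : (Ideal.span (Set.range MvPowerSeries.X) : Ideal (MvPowerSeries (Fin 2) R)).map
      (E : MvPowerSeries (Fin 2) R →+* B) = maximalIdeal B := by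
    rw [Ideal.map_span, h.span_eq, ← Set.range_comp]
    congr 1
    ext z
    simp [hE0, hE1, eq_comm]
  have hEC (r : R) : E (MvPowerSeries.C r) = algebraMap R B r := E.commutes r
  have hsurj : Function.Surjective (E : MvPowerSeries (Fin 2) R →+* B) := by
    have : IsHausdorff ((Ideal.span (Set.range MvPowerSeries.X) :
        Ideal (MvPowerSeries (Fin 2) R)).map (E : MvPowerSeries (Fin 2) R →+* B)) B := by
      rw [hmap]; infer_instance
    apply surjective_of_mk_map_comp_surjective (I := Ideal.span (Set.range MvPowerSeries.X))
    rw [hmap]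
    intro z
    obtain ⟨r, hr⟩ := hres z
    exact ⟨MvPowerSeries.C r, by simpa [hEC] using hr⟩
  have hloc := IsLocalHom.of_surjective _ hsurj
  obtain ⟨u, hu⟩ := hsurj ((hw.unit⁻¹ : Bˣ) : B)
  have huu : IsUnit u := hloc.map_nonunit u (by rw [hu]; exact Units.isUnit _)
  refine ⟨u, huu, ?_⟩
  set J : Ideal (MvPowerSeries (Fin 2) R) := Ideal.span {MvPowerSeries.X 0 ^ a * MvPowerSeries.X 1 ^ b -
    u * MvPowerSeries.C π} with hJ
  have hJE : ∀ f ∈ J, E f = 0 := by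
    have : J ≤ RingHom.ker (E : MvPowerSeries (Fin 2) R →+* B) := by
      rw [hJ, Ideal.span_singleton_le_iff_mem, RingHom.mem_ker, RingHom.coe_coe, map_sub, map_mul, map_mul, map_pow,
        map_pow, hE0, hE1, hEC, hπB]
      have hu' : E u = ((hw.unit⁻¹ : Bˣ) : B) := hu
      rw [hu', ← mul_assoc, IsUnit.val_inv_mul, one_mul, sub_self]
    exact this
  let Ebar := Ideal.Quotient.liftₐ J E hJE
  have hEbar (f : MvPowerSeries (Fin 2) R) : Ebar (Ideal.Quotient.mk J f) = E f := rfl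
  have hsurj' : Function.Surjective Ebar := fun z ↦ by
    obtain ⟨f, hf⟩ := hsurj z
    exact ⟨Ideal.Quotient.mk J f, hf⟩
  have hnt : Nontrivial (MvPowerSeries (Fin 2) R ⧸ J) := Ebar.toRingHom.domain_nontrivial
  have hDloc : IsLocalRing (MvPowerSeries (Fin 2) R ⧸ J) :=
    IsLocalRing.of_surjective' (Ideal.Quotient.mk J) Ideal.Quotient.mk_surjective
  have hmD := maximalIdeal_quotient_normalCrossings_eq R hπ hab huu (Ideal.Quotient.mk J)
    Ideal.Quotient.mk_surjective (Ideal.Quotient.eq_zero_iff_mem.2 (Ideal.mem_span_singleton_self _))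
  have hinj : Function.Injective Ebar := by
    rw [← RingHom.coe_coe, RingHom.injective_iff_ker_eq_bot]
    refine (Submodule.eq_bot_of_le_smul_of_le_jacobson_bot (maximalIdeal _) _
      (IsNoetherian.noetherian _) ?_ (IsLocalRing.maximalIdeal_le_jacobson _))
    intro f hf
    rw [RingHom.mem_ker, RingHom.coe_coe] at hf
    have hdvd : Ideal.Quotient.mk J (MvPowerSeries.X 0) ∣ f := by
      by_contra hd
      obtain ⟨n, v, c, hv, rfl⟩ := exists_sub_unit_mul_pow_mem hmD hd
      rw [map_add, map_mul, map_mul, map_pow, hEbar, hEbar, hE0, hE1] at hf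
      have : x ∣ Ebar v * y ^ n := ⟨-Ebar c, by linear_combination hf⟩
      rw [(hv.map Ebar).dvd_mul_left] at this
      exact h.not_dvd (h.prime_left.dvd_of_dvd_pow this)
    obtain ⟨g, rfl⟩ := hdvd
    rw [map_mul, hEbar, hE0, mul_eq_zero] at hf
    exact Submodule.smul_mem_smul (hmD ▸ Ideal.subset_span (by simp))
      (hf.resolve_left h.prime_left.ne_zero)
  exact ⟨(AlgEquiv.ofBijective Ebar ⟨hinj, hsurj'⟩).symm⟩

end

theorem HasNormalCrossings.of_isParamPair {R : Type u} [CommRing R] [IsDomain R]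
    [IsDiscreteValuationRing R] {π : R} (hπ : Irreducible π) {B : Type v} [CommRing B] [IsDomain B]
    [IsLocalRing B] [IsNoetherianRing B] [IsAdicComplete (maximalIdeal B) B] [Algebra R B]
    (hres : Function.Surjective ((Ideal.Quotient.mk (maximalIdeal B)).comp (algebraMap R B)))
    {x y w : B} (h : IsParamPair x y) (hw : IsUnit w) {a b : ℕ} (hab : 0 < a + b)
    (hπB : algebraMap R B π = w * (x ^ a * y ^ b)) : HasNormalCrossings R π B := by
  obtain ⟨u, hu, ⟨e⟩⟩ := exists_algEquiv_normalCrossings R hπ hres h hw hab hπB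
  refine ⟨B, inferInstance, inferInstance, inferInstance, inferInstance, inferInstance,
    inferInstance, inferInstance, fun M hM ↦ ⟨a, b, u, hab, hu, ?_⟩⟩
  obtain rfl := IsLocalRing.eq_maximalIdeal hM
  let e₁ : B ≃ₐ[B] Localization.AtPrime (maximalIdeal B) :=
    IsLocalization.atUnits B (maximalIdeal B).primeCompl (fun x hx ↦ by
      simpa [Ideal.primeCompl] using! hx)
  have hc : IsAdicComplete (maximalIdeal (Localization.AtPrime (maximalIdeal B)))
      (Localization.AtPrime (maximalIdeal B)) := by
    have h1 := (IsAdicComplete.congr_ringEquiv (maximalIdeal B) e₁.toRingEquiv).2 inferInstance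
    have h2 : (maximalIdeal B).map e₁.toRingEquiv =
        maximalIdeal (Localization.AtPrime (maximalIdeal B)) := map_ringEquiv_maximalIdeal _
    rwa [h2] at h1
  let e₂ := (AdicCompletion.ofAlgEquiv (maximalIdeal (Localization.AtPrime (maximalIdeal B)))).symm
  refine ⟨AlgEquiv.trans ?_ ((e₁.symm.restrictScalars R).trans e)⟩
  exact e₂.restrictScalars R

theorem WithBot.two_le_of_three_le_add_one {d : WithBot ℕ∞} (h : 3 ≤ d + 1) : 2 ≤ d := by
  induction d with
  | bot => simp at h
  | coe d =>
    have h' : ((3 : ℕ∞) : WithBot ℕ∞) ≤ ((d + 1 : ℕ∞) : WithBot ℕ∞) := h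
    rw [WithBot.coe_le_coe] at h'
    have : (2 : ℕ∞) ≤ d := by
      induction d with
      | top => simp
      | coe n =>
        have h3 : ((3 : ℕ) : ℕ∞) ≤ ((n + 1 : ℕ) : ℕ∞) := h'
        rw [Nat.cast_le] at h3
        exact_mod_cast (by omega : 2 ≤ n)
    exact WithBot.coe_le_coe.2 this

theorem three_le_ringKrullDim_mvPowerSeries (R : Type*) [CommRing R] [IsDomain R]
    [IsDiscreteValuationRing R] : 3 ≤ ringKrullDim (MvPowerSeries (Fin 2) R) := by
  rw [ringKrullDim_eq_of_ringEquiv (MvPowerSeries.finSuccEquiv R 1).toRingEquiv]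
  refine le_trans ?_ (ringKrullDim_succ_le_ringKrullDim_powerseries)
  rw [ringKrullDim_eq_of_ringEquiv (MvPowerSeries.finSuccEquiv R 0).toRingEquiv]
  refine le_trans ?_ (add_le_add_left (ringKrullDim_succ_le_ringKrullDim_powerseries) 1)
  rw [ringKrullDim_eq_of_ringEquiv (MvPowerSeries.isEmptyEquiv (σ := Fin 0) (R := R)).toRingEquiv,
    IsDiscreteValuationRing.ringKrullDim_eq_one]
  norm_num

theorem two_le_ringKrullDim_quotient_normalCrossings (R : Type*) [CommRing R] [IsDomain R]
    [IsDiscreteValuationRing R] {h : MvPowerSeries (Fin 2) R}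
    (hh : h ∈ maximalIdeal (MvPowerSeries (Fin 2) R)) :
    2 ≤ ringKrullDim (MvPowerSeries (Fin 2) R ⧸ Ideal.span {h}) := by
  apply WithBot.two_le_of_three_le_add_one
  refine (three_le_ringKrullDim_mvPowerSeries R).trans ?_
  rw [← IsLocalRing.maximalIdeal_height_eq_ringKrullDim]
  exact Ideal.height_le_ringKrullDim_quotient_add_one hh

theorem HasNormalCrossings.exists_bijective {R : Type u} [CommRing R] [IsDomain R]
    [IsDiscreteValuationRing R] {π : R} (hπ : Irreducible π) {A : Type v} [CommRing A]
    [IsLocalRing A] [IsNoetherianRing A] [IsAdicComplete (maximalIdeal A) A] [Algebra R A]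
    (h : HasNormalCrossings R π A) :
    ∃ (a b : ℕ) (u : MvPowerSeries (Fin 2) R), 0 < a + b ∧ IsUnit u ∧
      ∃ g : A →+* (MvPowerSeries (Fin 2) R ⧸ Ideal.span
          {MvPowerSeries.X 0 ^ a * MvPowerSeries.X 1 ^ b - u * MvPowerSeries.C π}),
        Function.Bijective g ∧ ∀ r, g (algebraMap R A r) = algebraMap R _ r := by
  obtain ⟨A', _, _, _, _, het, hfin, hnt, H⟩ := h
  obtain ⟨M, hM⟩ := Ideal.exists_maximal A'
  obtain ⟨a, b, u, hab, hu, ⟨e⟩⟩ := H M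
  refine ⟨a, b, u, hab, hu, ?_⟩
  set J : Ideal (MvPowerSeries (Fin 2) R) :=
    Ideal.span {MvPowerSeries.X 0 ^ a * MvPowerSeries.X 1 ^ b - u * MvPowerSeries.C π} with hJ
  have hnoeth : IsNoetherianRing A' := IsNoetherianRing.of_finite A A'
  let S := Localization.AtPrime M
  have hS : IsNoetherianRing S := IsLocalization.isNoetherianRing M.primeCompl S inferInstance
  let C := AdicCompletion (maximalIdeal S) S
  have hMA : M.under A = maximalIdeal A := by
    have : (M.under A).IsMaximal := Ideal.isMaximal_comap_of_isIntegral_of_isMaximal M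
    exact IsLocalRing.eq_maximalIdeal this
  have hlo : IsLocalHom (algebraMap A S) := by
    refine ((IsLocalRing.local_hom_TFAE (algebraMap A S)).out 0 4).2 ?_
    rw [IsScalarTower.algebraMap_eq A A' S, ← Ideal.comap_comap]
    have : (maximalIdeal S).comap (algebraMap A' S) = M := IsLocalization.AtPrime.under_maximalIdeal S M
    rw [this]
    exact hMA
  have hflat : Module.Flat A S := Module.Flat.trans A A' S
  have hff : Module.FaithfullyFlat A S := Module.FaithfullyFlat.of_flat_of_isLocalHom
  have hAS : Function.Injective (algebraMap A S) := FaithfulSMul.algebraMap_injective A S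
  have hSC : Function.Injective (algebraMap S C) := AdicCompletion.of_injective (maximalIdeal S) S
  have hmS : (maximalIdeal A).map (algebraMap A S) = maximalIdeal S := by
    have : Algebra.EssFiniteType A S := Algebra.EssFiniteType.comp A A' S
    exact Algebra.FormallyUnramified.map_maximalIdeal
  have hmC : (maximalIdeal A).map ((algebraMap S C).comp (algebraMap A S)) = maximalIdeal C := by
    rw [← Ideal.map_map, hmS, AdicCompletion.maximalIdeal_eq_map]
  have hRC (r : R) : algebraMap S C (algebraMap A S (algebraMap R A r)) = algebraMap R C r := by
    rw [← IsScalarTower.algebraMap_apply R A S]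
    exact (IsScalarTower.algebraMap_apply R S C r).symm
  have hDloc : IsLocalRing (MvPowerSeries (Fin 2) R ⧸ J) := e.toRingEquiv.isLocalRing
  have hmD := maximalIdeal_quotient_normalCrossings_eq R hπ hab hu (Ideal.Quotient.mk J)
    Ideal.Quotient.mk_surjective (Ideal.Quotient.eq_zero_iff_mem.2 (Ideal.mem_span_singleton_self _))
  have hresD (z : MvPowerSeries (Fin 2) R ⧸ J) : ∃ r : R, z - algebraMap R _ r ∈ maximalIdeal _ := by
    obtain ⟨f, rfl⟩ := Ideal.Quotient.mk_surjective z
    refine ⟨MvPowerSeries.constantCoeff f, ?_⟩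
    have h1 : f - MvPowerSeries.C (MvPowerSeries.constantCoeff f) ∈
        Ideal.span {MvPowerSeries.X 0, (MvPowerSeries.X 1 : MvPowerSeries (Fin 2) R)} :=
      MvPowerSeries.mem_span_X_of_constantCoeff_eq_zero (by simp)
    have h2 := Ideal.mem_map_of_mem (Ideal.Quotient.mk J) h1
    rw [Ideal.map_span, Set.image_pair, map_sub] at h2
    rw [hmD]
    exact h2
  have hsurj : Function.Surjective ((algebraMap S C).comp (algebraMap A S)) := by
    have : IsHausdorff ((maximalIdeal A).map ((algebraMap S C).comp (algebraMap A S))) C := by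
      rw [hmC]; infer_instance
    apply surjective_of_mk_map_comp_surjective (I := maximalIdeal A)
    rw [hmC]
    intro z
    obtain ⟨c, rfl⟩ := Ideal.Quotient.mk_surjective z
    obtain ⟨r, hr⟩ := hresD (e c)
    refine ⟨algebraMap R A r, ?_⟩
    rw [RingHom.comp_apply, RingHom.comp_apply, hRC, eq_comm, ← sub_eq_zero, ← map_sub,
      Ideal.Quotient.eq_zero_iff_mem, ← IsLocalRing.map_ringEquiv_maximalIdeal e.symm.toRingEquiv]
    have h3 := Ideal.mem_map_of_mem e.symm.toRingEquiv hr
    have h4 : e.symm.toRingEquiv (e c - algebraMap R _ r) = c - algebraMap R C r := by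
      change e.symm (e c - algebraMap R _ r) = _
      rw [map_sub, AlgEquiv.symm_apply_apply, AlgEquiv.commutes]
    rwa [h4] at h3
  refine ⟨(e : C →+* _).comp ((algebraMap S C).comp (algebraMap A S)), ?_, fun r ↦ ?_⟩
  · exact e.bijective.comp ⟨hSC.comp hAS, hsurj⟩
  · rw [RingHom.comp_apply, RingHom.comp_apply, hRC]
    exact e.commutes r

theorem HasNormalCrossings.exists_params {R : Type u} [CommRing R] [IsDomain R]
    [IsDiscreteValuationRing R] {π : R} (hπ : Irreducible π) {A : Type v} [CommRing A]
    [IsLocalRing A] [IsNoetherianRing A] [IsAdicComplete (maximalIdeal A) A] [Algebra R A]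
    (h : HasNormalCrossings R π A) :
    Function.Surjective ((Ideal.Quotient.mk (maximalIdeal A)).comp (algebraMap R A)) ∧
    2 ≤ ringKrullDim A ∧ ∃ (t₁ t₂ w : A) (a b : ℕ), IsUnit w ∧ 0 < a + b ∧
      maximalIdeal A = Ideal.span {t₁, t₂} ∧ algebraMap R A π = w * (t₁ ^ a * t₂ ^ b) := by
  obtain ⟨a, b, u, hab, hu, g, hg, hgR⟩ := h.exists_bijective hπ
  let J : Ideal (MvPowerSeries (Fin 2) R) :=
    Ideal.span {MvPowerSeries.X 0 ^ a * MvPowerSeries.X 1 ^ b - u * MvPowerSeries.C π}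
  let e := (RingEquiv.ofBijective g hg).symm
  have he (r : R) : e (Ideal.Quotient.mk J (MvPowerSeries.C r)) = algebraMap R A r := by
    rw [RingEquiv.symm_apply_eq]
    exact (hgR r).symm
  let q : MvPowerSeries (Fin 2) R →+* A := (e : _ →+* A).comp (Ideal.Quotient.mk J)
  have hq : Function.Surjective q := e.surjective.comp Ideal.Quotient.mk_surjective
  have hqC (r : R) : q (MvPowerSeries.C r) = algebraMap R A r := he r
  have h0 : q (MvPowerSeries.X 0 ^ a * MvPowerSeries.X 1 ^ b - u * MvPowerSeries.C π) = 0 := by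
    have : Ideal.Quotient.mk J (MvPowerSeries.X 0 ^ a * MvPowerSeries.X 1 ^ b -
      u * MvPowerSeries.C π) = 0 :=
      Ideal.Quotient.eq_zero_iff_mem.2 (Ideal.mem_span_singleton_self _)
    change e _ = 0
    rw [this, map_zero]
  have hm := maximalIdeal_quotient_normalCrossings_eq R hπ hab hu q hq h0
  refine ⟨?_, ?_, q (MvPowerSeries.X 0), q (MvPowerSeries.X 1), ((hu.map q).unit⁻¹ : Aˣ), a, b,
    Units.isUnit _, hab, hm, ?_⟩
  · intro z
    obtain ⟨s, rfl⟩ := Ideal.Quotient.mk_surjective z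
    obtain ⟨f, rfl⟩ := hq s
    refine ⟨MvPowerSeries.constantCoeff f, ?_⟩
    have h1 : f - MvPowerSeries.C (MvPowerSeries.constantCoeff f) ∈
        Ideal.span {MvPowerSeries.X 0, (MvPowerSeries.X 1 : MvPowerSeries (Fin 2) R)} :=
      MvPowerSeries.mem_span_X_of_constantCoeff_eq_zero (by simp)
    have h2 := Ideal.mem_map_of_mem q h1
    rw [Ideal.map_span, Set.image_pair, map_sub, ← hm, hqC] at h2
    rw [RingHom.comp_apply, eq_comm]
    exact Ideal.Quotient.eq.2 h2
  · rw [← ringKrullDim_eq_of_ringEquiv e]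
    apply two_le_ringKrullDim_quotient_normalCrossings
    rw [mem_maximalIdeal, mem_nonunits_iff]
    intro hun
    have := hun.map q
    rw [h0] at this
    exact not_isUnit_zero this
  · rw [map_sub, map_mul, map_mul, map_pow, map_pow, hqC, sub_eq_zero] at h0
    rw [h0, ← mul_assoc, IsUnit.val_inv_mul, one_mul]

section
attribute [local instance] MvPolynomial.gradedAlgebra

theorem locallyOfFiniteType_projSpaceStr (n : ℕ) (R : Type u) [CommRing R] :
    LocallyOfFiniteType (projSpaceStr n R) := by
  let 𝒜 := MvPolynomial.homogeneousSubmodule (Fin (n + 1)) R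
  have h0 : Function.Surjective (algebraMap R (𝒜 0)) := by
    rintro ⟨p, hp⟩
    have hp' : p.IsHomogeneous 0 := hp
    refine ⟨MvPolynomial.coeff 0 p, Subtype.ext ?_⟩
    have := (MvPolynomial.totalDegree_eq_zero_iff_eq_C (p := p)).1 
      (by simpa using hp'.totalDegree_le)
    exact this.symm
  have h1 : LocallyOfFiniteType (Spec.map (CommRingCat.ofHom (algebraMap R (𝒜 0)))) := by
    rw [HasRingHomProperty.Spec_iff (P := @LocallyOfFiniteType)]
    exact RingHom.FiniteType.of_surjective _ h0
  have h2 : Algebra.FiniteType (𝒜 0) (MvPolynomial (Fin (n + 1)) R) := by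
    have : IsScalarTower R (𝒜 0) (MvPolynomial (Fin (n + 1)) R) :=
      ⟨fun r a p ↦ by
        change (r • (a : MvPolynomial (Fin (n + 1)) R)) * p = r • ((a : MvPolynomial _ R) * p)
        rw [smul_mul_assoc]⟩
    exact Algebra.FiniteType.of_restrictScalars_finiteType R _ _
  have h3 : LocallyOfFiniteType (Proj.toSpecZero 𝒜) := inferInstance
  exact MorphismProperty.comp_mem _ _ _ h3 h1
end

theorem IsArithmeticSurface.isLocallyNoetherian {R : Type u} [CommRing R] [IsNoetherianRing R]
    {X : Scheme.{u}} {f : X ⟶ Spec (CommRingCat.of R)} (h : IsArithmeticSurface f) :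
    IsLocallyNoetherian X := by
  obtain ⟨n, i, hi, rfl⟩ := h.projective
  have := locallyOfFiniteType_projSpaceStr n R
  have : LocallyOfFiniteType (i ≫ projSpaceStr n R) := inferInstance
  exact LocallyOfFiniteType.isLocallyNoetherian (i ≫ projSpaceStr n R)

theorem IsLocalArithmeticSurface.exists_isAdicComplete {R : Type u} [CommRing R] [IsNoetherianRing R]
    {A : Type v} [CommRing A] [Algebra R A] (h : IsLocalArithmeticSurface R A) :
    ∃ _ : IsLocalRing A, IsAdicComplete (maximalIdeal A) A := by
  obtain ⟨X, f, x, hX, -, e, -⟩ := h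
  have := hX.isLocallyNoetherian
  have : IsNoetherianRing (X.presheaf.stalk x) := inferInstance
  have hloc : IsLocalRing A := e.isLocalRing
  refine ⟨hloc, ?_⟩
  rw [← map_ringEquiv_maximalIdeal e, IsAdicComplete.congr_ringEquiv]
  infer_instance

/-- `B` is a cyclic extension of `A` of degree `δ`, invertible in `A`, in the presence of the
`δ`-th roots of unity: `τ` generates the group, `A` is the ring of invariants and `τ` has an
eigenvector for a primitive `δ`-th root of unity `ζ`. -/
structure IsCyclicCover {A B : Type*} [CommRing A] [CommRing B] [Algebra A B] (τ : B ≃ₐ[A] B)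
    (ζ : A) (δ : ℕ) : Prop where
  isPrimitiveRoot : IsPrimitiveRoot ζ δ
  isUnit_natCast : IsUnit (δ : A)
  pow_apply : ∀ b, (τ ^ δ) b = b
  exists_algebraMap_eq : ∀ b, τ b = b → ∃ a, algebraMap A B a = b
  exists_eigenvector : ∃ α : B, α ≠ 0 ∧ τ α = ζ • α

/-- A root of unity of order invertible in a local ring is `1` if it is congruent to `1`. -/
theorem eq_one_of_pow_eq_one_of_sub_one_mem {A : Type*} [CommRing A] [IsLocalRing A] {n : ℕ}
    (hn : IsUnit (n : A)) {η : A} (hη : η ^ n = 1) (h1 : η - 1 ∈ maximalIdeal A) : η = 1 := by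
  have h2 : (∑ i ∈ Finset.range n, η ^ i) - n ∈ maximalIdeal A := by
    have : (∑ i ∈ Finset.range n, η ^ i) - n = ∑ i ∈ Finset.range n, (η ^ i - 1) := by simp
    rw [this]
    refine Ideal.sum_mem _ fun i _ ↦ ?_
    obtain ⟨c, hc⟩ := sub_one_dvd_pow_sub_one η i
    rw [hc]
    exact Ideal.mul_mem_right _ _ h1
  have h3 : IsUnit (∑ i ∈ Finset.range n, η ^ i) := by
    by_contra h
    have := Ideal.sub_mem _ ((mem_maximalIdeal _).2 h) h2
    rw [sub_sub_cancel] at this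
    exact this hn
  have h4 := geom_sum_mul η n
  rw [hη, sub_self, h3.mul_right_eq_zero] at h4
  exact sub_eq_zero.1 h4

namespace IsCyclicCover

variable {A B : Type*} [CommRing A] [CommRing B] [Algebra A B] {τ : B ≃ₐ[A] B} {ζ : A} {δ : ℕ}

theorem pow_apply_eq_of_eigen {η : A} {b : B} (hb : τ b = η • b) (j : ℕ) :
    (τ ^ j) b = η ^ j • b := by
  induction j with
  | zero => simp
  | succ j ih => rw [pow_succ', AlgEquiv.mul_apply, ih, map_smul, hb, smul_smul, pow_succ]

theorem eigen_mul {η θ : A} {b c : B} (hb : τ b = η • b) (hc : τ c = θ • c) :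
    τ (b * c) = (η * θ) • (b * c) := by
  rw [map_mul, hb, hc, smul_mul_smul_comm]

theorem eigen_pow {η : A} {b : B} (hb : τ b = η • b) (j : ℕ) :
    τ (b ^ j) = η ^ j • b ^ j := by
  rw [map_pow, hb, smul_pow]

theorem eigen_monomial {η θ : A} {b c : B} (hb : τ b = η • b) (hc : τ c = θ • c) (r s : ℕ) :
    τ (b ^ r * c ^ s) = (η ^ r * θ ^ s) • (b ^ r * c ^ s) :=
  eigen_mul (eigen_pow hb r) (eigen_pow hc s)

variable (h : IsCyclicCover τ ζ δ)
include h

theorem pos [Nontrivial A] : 0 < δ := by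
  rcases Nat.eq_zero_or_pos δ with h0 | h0
  · have := h.isUnit_natCast
    rw [h0, Nat.cast_zero] at this
    exact absurd this not_isUnit_zero
  · exact h0

theorem pow_mem_range {η : A} (hη : η ^ δ = 1) {b : B} (hb : τ b = η • b) :
    ∃ a, algebraMap A B a = b ^ δ := by
  apply h.exists_algebraMap_eq
  rw [eigen_pow hb, hη, one_smul]

/-- Every element is a sum of eigenvectors, which may be taken in any stable ideal. -/
theorem exists_eq_sum [IsDomain A] (b : B) (I : Ideal B) (hI : ∀ c ∈ I, τ c ∈ I) (hb : b ∈ I) :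
    ∃ c : ℕ → B, (∀ k, c k ∈ I ∧ ∃ η : A, η ^ δ = 1 ∧ τ (c k) = η • c k) ∧
      b = ∑ k ∈ Finset.range δ, c k := by
  obtain ⟨d, hd⟩ := h.isUnit_natCast.exists_left_inv
  have hδ := h.pos
  have hIj (j : ℕ) : (τ ^ j) b ∈ I := by
    induction j with
    | zero => simpa
    | succ j ih => rw [pow_succ', AlgEquiv.mul_apply]; exact hI _ ih
  refine ⟨fun k ↦ d • ∑ j ∈ Finset.range δ, (ζ ^ k) ^ j • (τ ^ j) b, fun k ↦ ⟨?_, ?_⟩, ?_⟩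
  · exact Submodule.smul_of_tower_mem _ _ (Submodule.sum_mem _ fun j _ ↦
      Submodule.smul_of_tower_mem _ _ (hIj j))
  · have h1 : (ζ ^ k) ^ δ = 1 := by rw [← pow_mul, mul_comm, pow_mul, h.isPrimitiveRoot.pow_eq_one,
      one_pow]
    have h2 : (ζ ^ k) ^ (δ - 1) * ζ ^ k = 1 := by rw [← pow_succ, Nat.sub_add_cancel hδ, h1]
    refine ⟨(ζ ^ k) ^ (δ - 1), by rw [← pow_mul, mul_comm, pow_mul, h1, one_pow], ?_⟩
    have h3 : ∑ j ∈ Finset.range δ, (ζ ^ k) ^ j • (τ ^ j) b =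
        ∑ j ∈ Finset.range δ, (ζ ^ k) ^ (j + 1) • (τ ^ (j + 1)) b := by
      have h4 := Finset.sum_range_succ (fun j ↦ (ζ ^ k) ^ j • (τ ^ j) b) δ
      rw [Finset.sum_range_succ', h1, h.pow_apply] at h4
      simpa using h4.symm
    have h5 : ∑ j ∈ Finset.range δ, (ζ ^ k) ^ j • (τ ^ j) b =
        ζ ^ k • τ (∑ j ∈ Finset.range δ, (ζ ^ k) ^ j • (τ ^ j) b) := by
      conv_lhs => rw [h3]
      rw [map_sum, Finset.smul_sum]
      refine Finset.sum_congr rfl fun j _ ↦ ?_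
      rw [map_smul, smul_smul, pow_succ' τ, AlgEquiv.mul_apply, pow_succ']
    rw [map_smul, smul_comm _ d]
    congr 1
    conv_rhs => rw [h5]
    rw [smul_smul, h2, one_smul]
  · rw [← Finset.smul_sum, Finset.sum_comm]
    have h6 : ∀ j ∈ Finset.range δ, j ≠ 0 →
        ∑ k ∈ Finset.range δ, (ζ ^ k) ^ j • (τ ^ j) b = 0 := by
      intro j hj hj0
      rw [← Finset.sum_smul]
      have h7 : ∑ k ∈ Finset.range δ, (ζ ^ k) ^ j = ∑ k ∈ Finset.range δ, (ζ ^ j) ^ k :=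
        Finset.sum_congr rfl fun k _ ↦ by rw [← pow_mul, ← pow_mul, mul_comm]
      have h8 : ζ ^ j - 1 ≠ 0 := by
        rw [sub_ne_zero]
        exact h.isPrimitiveRoot.pow_ne_one_of_pos_of_lt hj0 (Finset.mem_range.1 hj)
      have h9 := geom_sum_mul (ζ ^ j) δ
      rw [← pow_mul, mul_comm j, pow_mul, h.isPrimitiveRoot.pow_eq_one, one_pow, sub_self] at h9
      rw [h7, (mul_eq_zero.1 h9).resolve_right h8, zero_smul]
    rw [Finset.sum_eq_single_of_mem 0 (Finset.mem_range.2 hδ) h6]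
    simp only [pow_zero, Finset.sum_const, Finset.card_range, one_smul, AlgEquiv.one_apply]
    rw [← Nat.cast_smul_eq_nsmul A, smul_smul, hd, one_smul]

/-- The Reynolds operator. -/
theorem exists_reynolds [IsDomain A] [FaithfulSMul A B] : ∃ ρ : B →ₗ[A] A,
    (∀ a, ρ (algebraMap A B a) = a) ∧ ∀ (η : A) (b : B), η ^ δ = 1 → η ≠ 1 → τ b = η • b → ρ b = 0 := by
  obtain ⟨d, hd⟩ := h.isUnit_natCast.exists_left_inv
  let s : B →ₗ[A] B := d • ∑ j ∈ Finset.range δ, (τ ^ j).toLinearMap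
  have hs (b : B) : s b = d • ∑ j ∈ Finset.range δ, (τ ^ j) b := by simp [s]
  have hinj := FaithfulSMul.algebraMap_injective A B
  have hrange (b : B) : s b ∈ LinearMap.range (Algebra.linearMap A B) := by
    obtain ⟨a, ha⟩ := h.exists_algebraMap_eq (s b) (by
      rw [hs, map_smul, map_sum]
      congr 1
      have h4 := Finset.sum_range_succ (fun j ↦ (τ ^ j) b) δ
      rw [Finset.sum_range_succ', h.pow_apply] at h4
      simpa [pow_succ'] using h4)
    exact ⟨a, ha⟩
  let e := LinearEquiv.ofInjective (Algebra.linearMap A B) hinj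
  have he (b : B) : algebraMap A B (e.symm ⟨s b, hrange b⟩) = s b := by
    have := e.apply_symm_apply ⟨s b, hrange b⟩
    exact congrArg Subtype.val this
  refine ⟨e.symm.toLinearMap.comp (s.codRestrict _ hrange), fun a ↦ hinj ?_, fun η b h1 h2 hb ↦ hinj ?_⟩
  · change algebraMap A B (e.symm ⟨s _, hrange _⟩) = _
    rw [he, hs]
    simp only [AlgEquiv.commutes, Finset.sum_const, Finset.card_range]
    rw [← Nat.cast_smul_eq_nsmul A, smul_smul, hd, one_smul]
  · change algebraMap A B (e.symm ⟨s _, hrange _⟩) = _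
    rw [he, hs, map_zero]
    simp only [pow_apply_eq_of_eigen hb, ← Finset.sum_smul]
    have h9 := geom_sum_mul η δ
    rw [h1, sub_self] at h9
    rw [(mul_eq_zero.1 h9).resolve_right (sub_ne_zero.2 h2), zero_smul, smul_zero]

variable [IsLocalRing A] [IsLocalRing B] [IsLocalHom (algebraMap A B)]
  (hres : ∀ b : B, ∃ a : A, b - algebraMap A B a ∈ maximalIdeal B)

omit h [IsLocalRing A] [IsLocalHom (algebraMap A B)] in
theorem apply_mem_maximalIdeal {b : B} (hb : b ∈ maximalIdeal B) : τ b ∈ maximalIdeal B := by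
  rw [mem_maximalIdeal, mem_nonunits_iff] at hb ⊢
  intro hu
  apply hb
  have := hu.map τ.symm
  rwa [AlgEquiv.symm_apply_apply] at this

include hres

theorem eigenvalue_eq_one_of_isUnit {η : A} (hη : η ^ δ = 1) {c : B} (hc : IsUnit c)
    (hτ : η • τ c = c) : η = 1 := by
  apply eq_one_of_pow_eq_one_of_sub_one_mem h.isUnit_natCast hη
  obtain ⟨a, ha⟩ := hres c
  have h1 := apply_mem_maximalIdeal (τ := τ) ha
  rw [map_sub, AlgEquiv.commutes] at h1
  have h2 : τ c - c ∈ maximalIdeal B := by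
    have := Ideal.sub_mem _ h1 ha
    rwa [sub_sub_sub_cancel_right] at this
  have hτ' : algebraMap A B η * τ c = c := by rw [← Algebra.smul_def, hτ]
  have h3 : algebraMap A B (η - 1) * c ∈ maximalIdeal B := by
    have : algebraMap A B (η - 1) * c = -(algebraMap A B η * (τ c - c)) := by
      rw [map_sub, map_one]
      linear_combination hτ'
    rw [this]
    exact (maximalIdeal B).neg_mem (Ideal.mul_mem_left _ _ h2)
  rw [mem_maximalIdeal, mem_nonunits_iff] at h3 ⊢
  intro hu
  exact h3 ((hu.map (algebraMap A B)).mul hc)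

end IsCyclicCover

theorem Ideal.span_pair_eq_of_eq {S : Type*} [CommRing S] {x y t a b : S} (hb : IsUnit b)
    (ht : t = a * x + b * y) : Ideal.span {x, t} = Ideal.span {x, y} := by
  obtain ⟨c, hc⟩ := hb.exists_left_inv
  apply le_antisymm
  · rw [Ideal.span_le]
    rintro z (rfl | rfl)
    · exact Ideal.subset_span (by simp)
    · exact Ideal.mem_span_pair.2 ⟨a, b, ht.symm⟩
  · rw [Ideal.span_le]
    rintro z (rfl | rfl)
    · exact Ideal.subset_span (by simp)
    · exact Ideal.mem_span_pair.2 ⟨-(c * a), c, by rw [ht]; linear_combination z * hc⟩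

theorem IsParamPair.of_eq {S : Type*} [CommRing S] [IsLocalRing S] [IsNoetherianRing S] [IsDomain S]
    (hdim : 2 ≤ ringKrullDim S) {x y t a b : S} (h : IsParamPair x y) (hb : IsUnit b)
    (ht : t = a * x + b * y) : IsParamPair x t :=
  IsParamPair.of_span_eq hdim (by rw [Ideal.span_pair_eq_of_eq hb ht, h.span_eq])

theorem Finset.exists_isUnit_of_sum {S ι : Type*} [CommRing S] [IsLocalRing S] {s : Finset ι}
    {f : ι → S} (h : IsUnit (∑ i ∈ s, f i)) : ∃ i ∈ s, IsUnit (f i) := by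
  by_contra! hn
  exact (Ideal.sum_mem (maximalIdeal S) fun i hi ↦ (mem_maximalIdeal _).2 (hn i hi)) h

namespace IsCyclicCover

variable {A B : Type*} [CommRing A] [CommRing B] [Algebra A B] {τ : B ≃ₐ[A] B} {ζ : A} {δ : ℕ}
variable (h : IsCyclicCover τ ζ δ)

section

variable [IsDomain A] [IsDomain B] [IsLocalRing B] [IsNoetherianRing B]

include h in
theorem exists_isParamPair_eigen_aux (hdim : 2 ≤ ringKrullDim B) {t₁ t₂ : B}
    (ht : IsParamPair t₁ t₂) :
    ∃ (x y : B) (η : A), IsParamPair x y ∧ η ^ δ = 1 ∧ τ x = η • x := by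
  obtain ⟨c, hc, he⟩ := h.exists_eq_sum t₁ (maximalIdeal B) (fun _ ↦ apply_mem_maximalIdeal)
    ht.left_mem
  choose a b hab using fun k ↦ ht.exists_eq (hc k).1
  have he' : t₁ = (∑ k ∈ Finset.range δ, a k) * t₁ + (∑ k ∈ Finset.range δ, b k) * t₂ := by
    conv_lhs => rw [he]
    rw [Finset.sum_mul, Finset.sum_mul, ← Finset.sum_add_distrib]
    exact Finset.sum_congr rfl fun k _ ↦ hab k
  rcases ht.isUnit_of_eq ht he' with hu | hu
  · obtain ⟨k, -, hk⟩ := Finset.exists_isUnit_of_sum hu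
    obtain ⟨η, h1, h2⟩ := (hc k).2
    exact ⟨c k, t₂, η, (IsParamPair.of_eq hdim ht.symm hk ((hab k).trans (add_comm _ _))).symm, h1, h2⟩
  · obtain ⟨k, -, hk⟩ := Finset.exists_isUnit_of_sum hu
    obtain ⟨η, h1, h2⟩ := (hc k).2
    exact ⟨c k, t₁, η, (IsParamPair.of_eq hdim ht hk (hab k)).symm, h1, h2⟩

include h in
theorem exists_isParamPair_eigen (hdim : 2 ≤ ringKrullDim B) {t₁ t₂ : B}
    (ht : IsParamPair t₁ t₂) :
    ∃ (x y : B) (η θ : A), IsParamPair x y ∧ (η ^ δ = 1 ∧ τ x = η • x) ∧ (θ ^ δ = 1 ∧ τ y = θ • y) := by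
  obtain ⟨x, t, η, hxt, hη⟩ := h.exists_isParamPair_eigen_aux hdim ht
  obtain ⟨c, hc, he⟩ := h.exists_eq_sum t (maximalIdeal B) (fun _ ↦ apply_mem_maximalIdeal)
    hxt.right_mem
  choose a b hab using fun k ↦ hxt.exists_eq (hc k).1
  have he' : t = (∑ k ∈ Finset.range δ, a k) * x + (∑ k ∈ Finset.range δ, b k) * t := by
    conv_lhs => rw [he]
    rw [Finset.sum_mul, Finset.sum_mul, ← Finset.sum_add_distrib]
    exact Finset.sum_congr rfl fun k _ ↦ hab k
  have hu : IsUnit (∑ k ∈ Finset.range δ, b k) := by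
    by_contra hu
    have h1 : IsUnit (1 - ∑ k ∈ Finset.range δ, b k) := by
      rcases IsLocalRing.isUnit_or_isUnit_one_sub_self (∑ k ∈ Finset.range δ, b k) with h1 | h1
      · exact absurd h1 hu
      · exact h1
    apply hxt.not_dvd
    have : (1 - ∑ k ∈ Finset.range δ, b k) * t = x * (∑ k ∈ Finset.range δ, a k) := by
      linear_combination he'
    exact h1.dvd_mul_left.1 ⟨_, this⟩
  obtain ⟨k, -, hk⟩ := Finset.exists_isUnit_of_sum hu
  obtain ⟨θ, hθ⟩ := (hc k).2
  exact ⟨x, c k, η, θ, IsParamPair.of_eq hdim hxt hk (hab k), hη, hθ⟩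

end

/-- An eigenparameter `x` of `B` of order `n` under the group; `X = x ^ n` is the corresponding element of `A`. -/
structure IsEigenPower (τ : B ≃ₐ[A] B) (x : B) (η : A) (n : ℕ) (X : A) : Prop where
  isPrimitiveRoot : IsPrimitiveRoot η n
  eigen : τ x = η • x
  algebraMap_eq : algebraMap A B X = x ^ n

include h in
theorem exists_isEigenPower {x : B} {η : A} (hη : η ^ δ = 1) (hx : τ x = η • x) [Nontrivial A] :
    ∃ (n : ℕ) (X : A), 0 < n ∧ n ∣ δ ∧ IsEigenPower τ x η n X := by
  have hp := IsPrimitiveRoot.orderOf η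
  have hd : orderOf η ∣ δ := orderOf_dvd_of_pow_eq_one hη
  obtain ⟨X, hX⟩ := h.exists_algebraMap_eq (x ^ orderOf η) (by
    rw [eigen_pow hx, hp.pow_eq_one, one_smul])
  exact ⟨orderOf η, X, Nat.pos_of_dvd_of_pos hd h.pos, hd, hp, hx, hX⟩

variable [IsDomain A] [IsDomain B] [IsLocalRing A] [IsLocalRing B] [FaithfulSMul A B]
  [IsLocalHom (algebraMap A B)]
  (hres : ∀ b : B, ∃ a : A, b - algebraMap A B a ∈ maximalIdeal B)

include h hres

theorem prime_of_isEigenPower [UniqueFactorizationMonoid A] {x : B} {η X : A} {n : ℕ}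
    (hx : IsEigenPower τ x η n X) (hη : η ^ δ = 1) (hn : 0 < n) (hp : Prime x) : Prime X := by
  have hinj := FaithfulSMul.algebraMap_injective A B
  have hX0 : X ≠ 0 := by
    rintro rfl
    have := hx.algebraMap_eq
    rw [map_zero] at this
    exact pow_ne_zero n hp.ne_zero this.symm
  obtain ⟨f, hf, hfX⟩ := UniqueFactorizationMonoid.exists_prime_factors X hX0
  have hdvd : x ∣ (f.map (algebraMap A B)).prod := by
    rw [← map_multiset_prod]
    have h1 : algebraMap A B X ∣ algebraMap A B f.prod := map_dvd _ hfX.symm.dvd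
    rw [hx.algebraMap_eq] at h1
    exact (dvd_pow_self x hn.ne').trans h1
  obtain ⟨P, hPf, hxP⟩ := hp.exists_mem_multiset_map_dvd hdvd
  have hPX : P ∣ X := (Multiset.dvd_prod hPf).trans hfX.dvd
  have hP := hf P hPf
  obtain ⟨m, hm, hPm⟩ := (dvd_prime_pow hp n).1 (show algebraMap A B P ∣ x ^ n by
    rw [← hx.algebraMap_eq]; exact map_dvd _ hPX)
  obtain ⟨c, hc⟩ := hPm.symm
  have hτ : (η ^ m) • τ (c : B) = c := by
    have h1 := congrArg τ hc
    rw [AlgEquiv.commutes, map_mul, eigen_pow hx.eigen, ← hc, smul_mul_assoc, ← mul_smul_comm] at h1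
    exact mul_left_cancel₀ (pow_ne_zero m hp.ne_zero) h1
  have hηm := h.eigenvalue_eq_one_of_isUnit hres
    (by rw [← pow_mul, mul_comm, pow_mul, hη, one_pow]) c.isUnit hτ
  have hnm : n ∣ m := hx.isPrimitiveRoot.dvd_of_pow_eq_one m hηm
  have hm0 : m ≠ 0 := by
    rintro rfl
    rw [pow_zero, one_mul] at hc
    exact hP.not_isUnit (isUnit_of_map_unit (algebraMap A B) P (hc ▸ c.isUnit))
  have hmn : m = n := le_antisymm hm (Nat.le_of_dvd (Nat.pos_of_ne_zero hm0) hnm)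
  obtain ⟨d, hd⟩ := hPX
  have hdu : IsUnit d := by
    apply isUnit_of_map_unit (algebraMap A B)
    have h1 := congrArg (algebraMap A B) hd
    rw [map_mul, ← hc, hx.algebraMap_eq, hmn, mul_assoc] at h1
    have h2 : (1 : B) = c * algebraMap A B d :=
      mul_left_cancel₀ (pow_ne_zero n hp.ne_zero) (by rw [mul_one]; exact h1)
    exact IsUnit.of_mul_eq_one_right _ h2.symm
  rw [hd]
  exact (associated_mul_unit_right P d hdu).prime hP

theorem coprime_of_isParamPair [UniqueFactorizationMonoid A] {x y : B} {η θ X Y : A} {n m : ℕ}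
    (hxy : IsParamPair x y) (hx : IsEigenPower τ x η n X) (hη : η ^ δ = 1) (hn : 0 < n)
    (hy : IsEigenPower τ y θ m Y) (hm : 0 < m) : n.Coprime m := by
  have hinj := FaithfulSMul.algebraMap_injective A B
  have hX := h.prime_of_isEigenPower hres hx hη hn hxy.prime_left
  by_contra hco
  obtain ⟨l, hl, ⟨n', hn'⟩, ⟨m', hm'⟩⟩ := Nat.Prime.not_coprime_iff_dvd.1 hco
  have : NeZero l := ⟨hl.ne_zero⟩
  have h1 : IsPrimitiveRoot (η ^ n') l := hx.isPrimitiveRoot.pow hn (by rw [hn', mul_comm])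
  have h2 : IsPrimitiveRoot (θ ^ m') l := hy.isPrimitiveRoot.pow hm (by rw [hm', mul_comm])
  obtain ⟨s, -, hs⟩ := h2.eq_pow_of_pow_eq_one (ξ := (η ^ n') ^ (l - 1)) (by
    rw [← pow_mul, mul_comm, pow_mul, h1.pow_eq_one, one_pow])
  obtain ⟨M, hM⟩ := h.exists_algebraMap_eq (x ^ n' * y ^ (m' * s)) (by
    rw [eigen_monomial hx.eigen hy.eigen, pow_mul, hs, ← pow_succ', Nat.sub_add_cancel hl.one_le,
      h1.pow_eq_one, one_smul])
  have hMl : M ^ l = X * Y ^ s := by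
    apply hinj
    rw [map_pow, hM, map_mul, map_pow, hx.algebraMap_eq, hy.algebraMap_eq, hn', hm']
    ring
  have hXM : X ∣ M := hX.dvd_of_dvd_pow (hMl ▸ dvd_mul_right _ _)
  have hXX : X * X ∣ X * Y ^ s := by
    rw [← hMl, ← sq]
    exact (pow_dvd_pow_of_dvd hXM 2).trans (pow_dvd_pow _ hl.two_le)
  have hXY : X ∣ Y := hX.dvd_of_dvd_pow ((mul_dvd_mul_iff_left hX.ne_zero).1 hXX)
  have := map_dvd (algebraMap A B) hXY
  rw [hx.algebraMap_eq, hy.algebraMap_eq] at this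
  exact hxy.not_dvd (hxy.prime_left.dvd_of_dvd_pow ((dvd_pow_self x hn.ne').trans this))

omit h [IsDomain A] [IsDomain B] [FaithfulSMul A B] in
theorem span_monomials_eq_top [Module.Finite A B] {x y : B} {η θ X Y : A} {n m : ℕ}
    (hxy : IsParamPair x y) (hx : IsEigenPower τ x η n X) (hn : 0 < n)
    (hy : IsEigenPower τ y θ m Y) (hm : 0 < m) :
    Submodule.span A (Set.range fun p : ℕ × ℕ ↦ x ^ p.1 * y ^ p.2) = ⊤ := by
  set T := Submodule.span A (Set.range fun p : ℕ × ℕ ↦ x ^ p.1 * y ^ p.2) with hT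
  have hxT : ∀ c ∈ T, x * c ∈ T := by
    intro c hc
    induction hc using Submodule.span_induction with
    | mem c hc =>
      obtain ⟨p, rfl⟩ := hc
      exact Submodule.subset_span ⟨(p.1 + 1, p.2), by simp only; ring⟩
    | zero => rw [mul_zero]; exact T.zero_mem
    | add a b _ _ ha hb => rw [mul_add]; exact T.add_mem ha hb
    | smul a b _ hb => rw [mul_smul_comm]; exact T.smul_mem _ hb
  have hyT : ∀ c ∈ T, y * c ∈ T := by
    intro c hc
    induction hc using Submodule.span_induction with
    | mem c hc =>
      obtain ⟨p, rfl⟩ := hc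
      exact Submodule.subset_span ⟨(p.1, p.2 + 1), by simp only; ring⟩
    | zero => rw [mul_zero]; exact T.zero_mem
    | add a b _ _ ha hb => rw [mul_add]; exact T.add_mem ha hb
    | smul a b _ hb => rw [mul_smul_comm]; exact T.smul_mem _ hb
  have h1T (a : A) : algebraMap A B a ∈ T := by
    rw [Algebra.algebraMap_eq_smul_one]
    exact T.smul_mem _ (Submodule.subset_span ⟨(0, 0), by simp⟩)
  have happ (k : ℕ) : ∀ b : B, ∃ c ∈ T, b - c ∈ maximalIdeal B ^ k := by
    induction k with
    | zero => exact fun b ↦ ⟨0, T.zero_mem, by simp⟩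
    | succ k ih =>
      intro b
      obtain ⟨a, ha⟩ := hres b
      obtain ⟨b₁, b₂, e⟩ := hxy.exists_eq ha
      obtain ⟨c₁, hc₁, h₁⟩ := ih b₁
      obtain ⟨c₂, hc₂, h₂⟩ := ih b₂
      refine ⟨algebraMap A B a + (x * c₁ + y * c₂),
        T.add_mem (h1T a) (T.add_mem (hxT _ hc₁) (hyT _ hc₂)), ?_⟩
      have : b - (algebraMap A B a + (x * c₁ + y * c₂)) = (b₁ - c₁) * x + (b₂ - c₂) * y := by
        linear_combination e
      rw [this, pow_succ]
      exact Ideal.add_mem _ (Ideal.mul_mem_mul h₁ hxy.left_mem) (Ideal.mul_mem_mul h₂ hxy.right_mem)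
  have hpow : maximalIdeal B ^ (n + m) ≤ (maximalIdeal A).map (algebraMap A B) := by
    rw [hxy.span_eq, Ideal.span_insert]
    refine Ideal.sup_pow_add_le_pow_sup_pow.trans ?_
    rw [Ideal.span_singleton_pow, Ideal.span_singleton_pow, sup_le_iff,
      Ideal.span_singleton_le_iff_mem, Ideal.span_singleton_le_iff_mem, ← hx.algebraMap_eq,
      ← hy.algebraMap_eq]
    have hmem {z : A} (hz : algebraMap A B z ∈ maximalIdeal B) :
        algebraMap A B z ∈ (maximalIdeal A).map (algebraMap A B) := by
      apply Ideal.mem_map_of_mem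
      rw [mem_maximalIdeal, mem_nonunits_iff] at hz ⊢
      exact fun hu ↦ hz (hu.map _)
    exact ⟨hmem (hx.algebraMap_eq ▸ Ideal.pow_mem_of_mem _ hxy.left_mem _ hn),
      hmem (hy.algebraMap_eq ▸ Ideal.pow_mem_of_mem _ hxy.right_mem _ hm)⟩
  rw [eq_top_iff]
  refine Submodule.le_of_le_smul_of_le_jacobson_bot (I := maximalIdeal A) Module.Finite.fg_top
    (IsLocalRing.maximalIdeal_le_jacobson _) ?_
  intro b _
  obtain ⟨c, hc, hbc⟩ := happ (n + m) b
  rw [← sub_add_cancel b c, add_comm]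
  refine Submodule.add_mem_sup hc ?_
  rw [Ideal.smul_top_eq_map]
  exact hpow hbc

theorem mul_eq_degree [Module.Finite A B] {x y : B} {η θ X Y : A} {n m : ℕ}
    (hxy : IsParamPair x y) (hx : IsEigenPower τ x η n X) (hn : 0 < n) (hnδ : n ∣ δ)
    (hy : IsEigenPower τ y θ m Y) (hm : 0 < m) (hmδ : m ∣ δ) (hco : n.Coprime m) :
    n * m = δ := by
  apply Nat.dvd_antisymm (hco.mul_dvd_of_dvd_of_dvd hnδ hmδ)
  obtain ⟨α, hα0, hα⟩ := h.exists_eigenvector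
  have htop := span_monomials_eq_top hres hxy hx hn hy hm
  have hfix : ∀ b : B, (τ ^ (n * m)) b = b := by
    intro b
    have hb : b ∈ Submodule.span A (Set.range fun p : ℕ × ℕ ↦ x ^ p.1 * y ^ p.2) :=
      htop ▸ Submodule.mem_top
    induction hb using Submodule.span_induction with
    | mem c hc =>
      obtain ⟨p, rfl⟩ := hc
      simp only
      rw [pow_apply_eq_of_eigen (eigen_monomial hx.eigen hy.eigen _ _), mul_pow, ← pow_mul,
        ← pow_mul, mul_left_comm, pow_mul, hx.isPrimitiveRoot.pow_eq_one, one_pow, one_mul,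
        ← mul_assoc, mul_comm, pow_mul, hy.isPrimitiveRoot.pow_eq_one, one_pow, one_smul]
    | zero => simp
    | add a b _ _ ha hb => rw [map_add, ha, hb]
    | smul a b _ hb => rw [map_smul, hb]
  apply h.isPrimitiveRoot.dvd_of_pow_eq_one
  have h1 := hfix α
  rw [pow_apply_eq_of_eigen hα, Algebra.smul_def] at h1
  apply FaithfulSMul.algebraMap_injective A B
  rw [map_one]
  exact mul_right_cancel₀ hα0 (h1.trans (one_mul α).symm)

theorem maximalIdeal_eq_span [Module.Finite A B] {x y : B} {η θ X Y : A} {n m : ℕ}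
    (hxy : IsParamPair x y) (hx : IsEigenPower τ x η n X) (hη : η ^ δ = 1) (hn : 0 < n)
    (hy : IsEigenPower τ y θ m Y) (hθ : θ ^ δ = 1) (hm : 0 < m) (hco : n.Coprime m) :
    maximalIdeal A = Ideal.span {X, Y} := by
  have hinj := FaithfulSMul.algebraMap_injective A B
  have htop := span_monomials_eq_top hres hxy hx hn hy hm
  obtain ⟨ρ, hρ1, hρ2⟩ := h.exists_reynolds
  have hmono (r s : ℕ) (hrs : 0 < r + s) : ρ (x ^ r * y ^ s) ∈ Ideal.span {X, Y} := by
    by_cases he : η ^ r * θ ^ s = 1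
    · have hr : n ∣ r := by
        apply hco.dvd_of_dvd_mul_right
        apply hx.isPrimitiveRoot.dvd_of_pow_eq_one
        have := congrArg (· ^ m) he
        simpa only [mul_pow, ← pow_mul, mul_comm s m, pow_mul θ, hy.isPrimitiveRoot.pow_eq_one,
          one_pow, mul_one] using this
      have hs : m ∣ s := by
        apply hco.symm.dvd_of_dvd_mul_right
        apply hy.isPrimitiveRoot.dvd_of_pow_eq_one
        have := congrArg (· ^ n) he
        simpa only [mul_pow, ← pow_mul, mul_comm r n, pow_mul η, hx.isPrimitiveRoot.pow_eq_one,
          one_pow, one_mul] using this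
      obtain ⟨i, rfl⟩ := hr
      obtain ⟨j, rfl⟩ := hs
      rw [pow_mul, pow_mul, ← hx.algebraMap_eq, ← hy.algebraMap_eq, ← map_pow, ← map_pow, ← map_mul,
        hρ1]
      rcases Nat.eq_zero_or_pos i with hi | hi
      · have hj : 0 < j := Nat.pos_of_ne_zero (by rintro rfl; simp [hi] at hrs)
        exact Ideal.mul_mem_left _ _ (Ideal.pow_mem_of_mem _ (Ideal.subset_span (by simp)) _ hj)
      · exact Ideal.mul_mem_right _ _ (Ideal.pow_mem_of_mem _ (Ideal.subset_span (by simp)) _ hi)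
    · rw [hρ2 _ _ _ he (eigen_monomial hx.eigen hy.eigen r s)]
      · exact Ideal.zero_mem _
      · rw [mul_pow, ← pow_mul, ← pow_mul, mul_comm r, mul_comm s, pow_mul, pow_mul, hη, hθ,
          one_pow, one_pow, one_mul]
  have hall (r s : ℕ) (hrs : 0 < r + s) (b : B) : ρ (x ^ r * y ^ s * b) ∈ Ideal.span {X, Y} := by
    have hb : b ∈ Submodule.span A (Set.range fun p : ℕ × ℕ ↦ x ^ p.1 * y ^ p.2) :=
      htop ▸ Submodule.mem_top
    induction hb using Submodule.span_induction with
    | mem c hc =>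
      obtain ⟨p, rfl⟩ := hc
      have : x ^ r * y ^ s * (x ^ p.1 * y ^ p.2) = x ^ (r + p.1) * y ^ (s + p.2) := by ring
      simp only [this]
      exact hmono _ _ (by omega)
    | zero => simp
    | add a b _ _ ha hb => rw [mul_add, map_add]; exact Ideal.add_mem _ ha hb
    | smul a b _ hb => rw [mul_smul_comm, map_smul]; exact Ideal.mul_mem_left _ _ hb
  apply le_antisymm
  · intro f hf
    have hfB : algebraMap A B f ∈ maximalIdeal B := by
      rw [mem_maximalIdeal, mem_nonunits_iff] at hf ⊢
      exact fun hu ↦ hf (isUnit_of_map_unit _ _ hu)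
    obtain ⟨a, b, e⟩ := hxy.exists_eq hfB
    rw [← hρ1 f, e, map_add]
    have h1 := hall 1 0 (by simp) a
    have h2 := hall 0 1 (by simp) b
    rw [pow_one, pow_zero, mul_one, mul_comm] at h1
    rw [pow_one, pow_zero, one_mul, mul_comm] at h2
    exact Ideal.add_mem _ h1 h2
  · have hmem {z : A} (hz : algebraMap A B z ∈ maximalIdeal B) : z ∈ maximalIdeal A := by
      rw [mem_maximalIdeal, mem_nonunits_iff] at hz ⊢
      exact fun hu ↦ hz (hu.map _)
    rw [Ideal.span_le]
    rintro z (rfl | rfl)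
    · exact hmem (hx.algebraMap_eq ▸ Ideal.pow_mem_of_mem _ hxy.left_mem _ hn)
    · exact hmem (hy.algebraMap_eq ▸ Ideal.pow_mem_of_mem _ hxy.right_mem _ hm)

end IsCyclicCover

section Ramification

variable {A B : Type*} [CommRing A] [CommRing B] [Algebra A B]

theorem Algebra.IsUnramifiedAt.maximalIdeal_eq_span [Algebra.EssFiniteType A B] (Q : Ideal B)
    [Q.IsPrime] [Algebra.IsUnramifiedAt A Q] {q : A} (hq : Q.under A = Ideal.span {q}) :
    maximalIdeal (Localization.AtPrime Q) =
      Ideal.span {algebraMap A (Localization.AtPrime Q) q} := by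
  let : Algebra (Localization.AtPrime (Q.under A)) (Localization.AtPrime Q) :=
    Localization.AtPrime.algebraOfLiesOver (Q.under A) Q
  have : Algebra.EssFiniteType (Localization.AtPrime (Q.under A)) (Localization.AtPrime Q) :=
    Algebra.EssFiniteType.of_comp A _ _
  rw [← Algebra.FormallyUnramified.map_maximalIdeal (R := Localization.AtPrime (Q.under A)),
    ← Localization.AtPrime.map_eq_maximalIdeal, Ideal.map_map, ← IsScalarTower.algebraMap_eq,
    hq, Ideal.map_span, Set.image_singleton]

theorem Algebra.isUnramifiedAt_of_span_monomials_eq_top {x y : B} {X Y : A} {n m : ℕ}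
    (htop : Submodule.span A (Set.range fun p : ℕ × ℕ ↦ x ^ p.1 * y ^ p.2) = ⊤)
    (hX : algebraMap A B X = x ^ n) (hY : algebraMap A B Y = y ^ m)
    (hn : IsUnit (n : A)) (hm : IsUnit (m : A)) (Q : Ideal B) [Q.IsPrime]
    (hx : n = 1 ∨ x ∉ Q) (hy : m = 1 ∨ y ∉ Q) : Algebra.IsUnramifiedAt A Q := by
  let S := Localization.AtPrime Q
  let D := KaehlerDifferential.D A S
  have key {z : B} {Z : A} {k : ℕ} (hZ : algebraMap A B Z = z ^ k) (hk : IsUnit (k : A))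
      (hz : k = 1 ∨ z ∉ Q) : D (algebraMap B S z) = 0 := by
    rcases hz with rfl | hz
    · rw [pow_one] at hZ
      rw [← hZ, ← IsScalarTower.algebraMap_apply, Derivation.map_algebraMap]
    · have h1 := D.leibniz_pow (algebraMap B S z) k
      rw [← map_pow, ← hZ, ← IsScalarTower.algebraMap_apply, Derivation.map_algebraMap] at h1
      have hu : IsUnit (algebraMap B S z) := IsLocalization.map_units S (⟨z, hz⟩ : Q.primeCompl)
      rw [← Nat.cast_smul_eq_nsmul A, eq_comm, hk.smul_eq_zero, (hu.pow _).smul_eq_zero] at h1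
      exact h1
  have hDx := key hX hn hx
  have hDy := key hY hm hy
  have hB (b : B) : D (algebraMap B S b) = 0 := by
    have hb : b ∈ Submodule.span A (Set.range fun p : ℕ × ℕ ↦ x ^ p.1 * y ^ p.2) :=
      htop ▸ Submodule.mem_top
    induction hb using Submodule.span_induction with
    | mem c hc =>
      obtain ⟨p, rfl⟩ := hc
      simp [D.leibniz, D.leibniz_pow, hDx, hDy]
    | zero => simp
    | add a b _ _ ha hb => rw [map_add, map_add, ha, hb, add_zero]
    | smul a b _ hb =>
      rw [Algebra.smul_def, map_mul, D.leibniz, hb, ← IsScalarTower.algebraMap_apply,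
        Derivation.map_algebraMap, smul_zero, smul_zero, add_zero]
  have hS (s : S) : D s = 0 := by
    obtain ⟨⟨b, t⟩, e⟩ := IsLocalization.surj Q.primeCompl s
    have h1 := congrArg D e
    simp only [D.leibniz, hB, smul_zero, zero_add] at h1
    exact (IsLocalization.map_units S t).smul_eq_zero.1 h1
  have : Subsingleton (Ω[S⁄A]) := by
    rw [← Submodule.subsingleton_iff S, ← subsingleton_iff_bot_eq_top,
      ← KaehlerDifferential.span_range_derivation, eq_comm, Submodule.span_eq_bot]
    rintro _ ⟨s, rfl⟩
    exact hS s
  exact ⟨this⟩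

variable [IsDomain B] [IsNoetherianRing B] [FaithfulSMul A B] (Q : Ideal B) [Q.IsPrime]

theorem algebraMap_atPrime_injective : Function.Injective (algebraMap B (Localization.AtPrime Q)) :=
  IsLocalization.injective _ Q.primeCompl_le_nonZeroDivisors

theorem isUnit_algebraMap_atPrime {z : B} (hz : z ∉ Q) :
    IsUnit (algebraMap B (Localization.AtPrime Q) z) :=
  IsLocalization.map_units _ (⟨z, hz⟩ : Q.primeCompl)

theorem algebraMap_mem_maximalIdeal_atPrime {z : B} (hz : z ∈ Q) :
    algebraMap B (Localization.AtPrime Q) z ∈ maximalIdeal (Localization.AtPrime Q) := by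
  rw [← Localization.AtPrime.map_eq_maximalIdeal]
  exact Ideal.mem_map_of_mem _ hz

theorem mem_of_under_eq_span {q : A} (hq : Q.under A = Ideal.span {q}) : algebraMap A B q ∈ Q := by
  have : q ∈ Q.under A := hq ▸ Ideal.mem_span_singleton_self q
  exact this

theorem not_mem_of_under_eq_span {q g : A} (hq : Q.under A = Ideal.span {q}) (hg : ¬ q ∣ g) :
    algebraMap A B g ∉ Q := fun h ↦
  hg (Ideal.mem_span_singleton.1 (hq ▸ show g ∈ Q.under A from h))

/-- In an unramified extension orders of vanishing do not change; the order of a `δ`-th power is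
divisible by `δ`. -/
theorem dvd_of_isUnramifiedAt [Algebra.EssFiniteType A B] [Algebra.IsUnramifiedAt A Q] {q g : A}
    (hq0 : q ≠ 0) (hq : Q.under A = Ideal.span {q}) (hg : ¬ q ∣ g) {α : B} (hα : α ≠ 0) {δ m : ℕ}
    (he : α ^ δ = algebraMap A B (q ^ m * g)) : δ ∣ m := by
  set S := Localization.AtPrime Q
  have hinj := algebraMap_atPrime_injective Q
  have hmax := Algebra.IsUnramifiedAt.maximalIdeal_eq_span Q hq
  set t := algebraMap A S q with ht
  have ht0 : t ≠ 0 := by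
    rw [ht, IsScalarTower.algebraMap_apply A B S]
    exact (map_ne_zero_iff _ hinj).2 ((map_ne_zero_iff _ (FaithfulSMul.algebraMap_injective A B)).2 hq0)
  have htn : ¬ IsUnit t := by
    have : t ∈ maximalIdeal S := hmax ▸ Ideal.mem_span_singleton_self t
    exact this
  obtain ⟨j, u, hu, huj⟩ := exists_eq_unit_mul_pow_of_maximalIdeal_eq_span hmax
    ((map_ne_zero_iff _ hinj).2 hα)
  have hgu : IsUnit (algebraMap A S g) := by
    rw [IsScalarTower.algebraMap_apply A B S]
    exact isUnit_algebraMap_atPrime Q (not_mem_of_under_eq_span Q hq hg)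
  have h1 := congrArg (algebraMap B S) he
  rw [map_pow, huj, ← IsScalarTower.algebraMap_apply, map_mul, map_pow, mul_pow, ← pow_mul] at h1
  have h2 : Associated (t ^ (j * δ)) (t ^ m) :=
    (associated_unit_mul_left _ _ (hu.pow δ)).symm.trans (h1 ▸ associated_mul_unit_left _ _ hgu)
  have h3 : j * δ = m := le_antisymm ((pow_dvd_pow_iff ht0 htn).1 h2.dvd)
    ((pow_dvd_pow_iff ht0 htn).1 h2.symm.dvd)
  exact ⟨j, by rw [← h3, mul_comm]⟩

theorem not_isUnramifiedAt_of_pow_eq [Algebra.EssFiniteType A B] {x : B} {X : A} {n : ℕ}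
    (hX0 : X ≠ 0) (hX : algebraMap A B X = x ^ n) (hn : 1 < n) (hQ : Q.under A = Ideal.span {X}) :
    ¬ Algebra.IsUnramifiedAt A Q := by
  intro hu
  have hx0 : x ≠ 0 := by
    rintro rfl
    rw [zero_pow (by omega), map_eq_zero_iff _ (FaithfulSMul.algebraMap_injective A B)] at hX
    exact hX0 hX
  have hX1 : ¬ IsUnit X := by
    intro h
    have := Ideal.IsPrime.ne_top (inferInstance : (Q.under A).IsPrime)
    exact this (by rw [hQ, Ideal.span_singleton_eq_top.2 h])
  have := dvd_of_isUnramifiedAt Q hX0 hQ (g := 1) (fun h ↦ hX1 (isUnit_of_dvd_one h)) hx0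
    (δ := n) (m := 1) (by rw [pow_one, mul_one, hX])
  have := Nat.le_of_dvd one_pos this
  omega

theorem ramificationIdx_eq_toNat_ord {q : A} (hq : Q.under A = Ideal.span {q}) :
    Q.ramificationIdx A =
      (Ring.ord (Localization.AtPrime Q) (algebraMap A (Localization.AtPrime Q) q)).toNat := by
  rw [Ideal.ramificationIdx_def, Ring.ord, hq, Ideal.map_span, Set.image_singleton]

theorem dvd_ramificationIdx_of_pow_eq {q : A} (hq : Q.under A = Ideal.span {q})
    {β w : B} (hβ : β ≠ 0) (hw : w ∉ Q) {n : ℕ} (he : β ^ n = algebraMap A B q * w) :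
    n ∣ Q.ramificationIdx A := by
  set S := Localization.AtPrime Q
  have h1 := congrArg (algebraMap B S) he
  rw [map_mul, map_pow, ← IsScalarTower.algebraMap_apply] at h1
  rw [ramificationIdx_eq_toNat_ord Q hq, Ring.ord_eq_of_associated
    (h1 ▸ (associated_mul_unit_left _ _ (isUnit_algebraMap_atPrime Q hw)).symm :
      Associated (algebraMap A S q) (algebraMap B S β ^ n)), Ring.ord_pow]
  · rw [nsmul_eq_mul, ENat.toNat_mul, ENat.toNat_natCast]
    exact Dvd.intro _ rfl
  · exact mem_nonZeroDivisors_of_ne_zero ((map_ne_zero_iff _ (algebraMap_atPrime_injective Q)).2 hβ)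

theorem ramificationIdx_eq_of_pow_eq {X : A} {x : B} (hX : Q.under A = Ideal.span {X})
    (hQ : Q = Ideal.span {x}) (hx : x ≠ 0) {n : ℕ} (he : algebraMap A B X = x ^ n) :
    Q.ramificationIdx A = n := by
  set S := Localization.AtPrime Q
  rw [ramificationIdx_eq_toNat_ord Q hX, IsScalarTower.algebraMap_apply A B, he, map_pow,
    Ring.ord_pow (mem_nonZeroDivisors_of_ne_zero
      ((map_ne_zero_iff _ (algebraMap_atPrime_injective Q)).2 hx))]
  have h1 : Ring.ord S (algebraMap B S x) = 1 := by
    rw [Ring.ord, Module.length_eq_one_iff, isSimpleModule_iff_isCoatom, ← Ideal.isMaximal_def]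
    have := congrArg (Ideal.map (algebraMap B S)) hQ
    rw [Ideal.map_span, Set.image_singleton, Localization.AtPrime.map_eq_maximalIdeal] at this
    rw [← this]
    infer_instance
  rw [h1]
  simp

variable (A B) in
/-- Some prime of `B` above the prime element `q` of `A` is ramified. -/
def IsBranchedAt (q : A) : Prop :=
  ∃ Q : PrimeSpectrum B, Q.asIdeal.under A = Ideal.span {q} ∧ ¬ Algebra.IsUnramifiedAt A Q.asIdeal

end Ramification

section Branch

variable {A B : Type*} [CommRing A] [CommRing B] [Algebra A B]

/-- The prime ideal generated by a prime element. -/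
def Prime.toPrimeSpectrum {q : A} (hq : Prime q) : PrimeSpectrum A :=
  ⟨Ideal.span {q}, (Ideal.span_singleton_prime hq.ne_zero).2 hq⟩

theorem Prime.toPrimeSpectrum_eq_iff {q : A} (hq : Prime q) (p : PrimeSpectrum A) :
    p = hq.toPrimeSpectrum ↔ p.asIdeal = Ideal.span {q} := PrimeSpectrum.ext_iff

theorem Prime.associated_of_toPrimeSpectrum_eq [IsDomain A] {q r : A} (hq : Prime q) (hr : Prime r)
    (h : hq.toPrimeSpectrum = hr.toPrimeSpectrum) : Associated q r :=
  Ideal.span_singleton_eq_span_singleton.1 ((hr.toPrimeSpectrum_eq_iff _).1 h)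

theorem Prime.toPrimeSpectrum_eq_of_associated [IsDomain A] {q r : A} (hq : Prime q) (hr : Prime r)
    (h : Associated q r) : hq.toPrimeSpectrum = hr.toPrimeSpectrum :=
  (hr.toPrimeSpectrum_eq_iff _).2 (Ideal.span_singleton_eq_span_singleton.2 h)

theorem mem_branchDivisor_iff [IsDomain A] [IsNoetherianRing A] [UniqueFactorizationMonoid A]
    {p : PrimeSpectrum A} : p ∈ branchDivisor A B ↔
      ∃ (q : A) (hq : Prime q), p = hq.toPrimeSpectrum ∧ IsBranchedAt A B q := by
  constructor
  · rintro ⟨h1, h2⟩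
    have hne : p.asIdeal ≠ ⊥ := by
      intro h
      rw [h, Ideal.height_bot] at h1
      exact zero_ne_one h1
    obtain ⟨q, hqp, hq⟩ := p.isPrime.exists_mem_prime_of_ne_bot hne
    have he := Ideal.eq_span_singleton_of_height_eq_one h1 hqp hq
    exact ⟨q, hq, (hq.toPrimeSpectrum_eq_iff p).2 he, by rwa [IsBranchedAt, ← he]⟩
  · rintro ⟨q, hq, rfl, h⟩
    exact ⟨Ideal.height_span_singleton_eq_one_of_mem_nonZeroDivisors
      (mem_nonZeroDivisors_of_ne_zero hq.ne_zero) hq.not_isUnit, h⟩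

theorem Prime.mem_branchDivisor_iff [IsDomain A] [IsNoetherianRing A] [UniqueFactorizationMonoid A]
    {q : A} (hq : Prime q) : hq.toPrimeSpectrum ∈ branchDivisor A B ↔ IsBranchedAt A B q := by
  rw [_root_.mem_branchDivisor_iff]
  constructor
  · rintro ⟨r, hr, h1, h2⟩
    rwa [IsBranchedAt, ← (hr.toPrimeSpectrum_eq_iff _).1 h1] at h2
  · exact fun h ↦ ⟨q, hq, rfl, h⟩

theorem Prime.exists_liesOver [IsDomain B] [Algebra.IsIntegral A B] [FaithfulSMul A B]
    {q : A} (hq : Prime q) :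
    ∃ Q : PrimeSpectrum B, Q.asIdeal.under A = Ideal.span {q} := by
  have := (Ideal.span_singleton_prime hq.ne_zero).2 hq
  obtain ⟨Q, h1, h2⟩ := Ideal.exists_ideal_over_prime_of_isIntegral_of_isDomain (S := B)
    (Ideal.span {q}) (by
      rw [(RingHom.injective_iff_ker_eq_bot _).1 (FaithfulSMul.algebraMap_injective A B)]
      exact bot_le)
  exact ⟨⟨Q, h1⟩, h2⟩

theorem dvd_of_not_isBranchedAt [IsDomain B] [IsNoetherianRing B] [Module.Finite A B]
    [FaithfulSMul A B] {q g : A} (hq : Prime q) (hb : ¬ IsBranchedAt A B q) (hg : ¬ q ∣ g) {α : B}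
    (hα : α ≠ 0) {δ m : ℕ} (he : α ^ δ = algebraMap A B (q ^ m * g)) : δ ∣ m := by
  obtain ⟨Q, hQ⟩ := hq.exists_liesOver (B := B)
  have hu : Algebra.IsUnramifiedAt A Q.asIdeal := by
    by_contra h
    exact hb ⟨Q, hQ, h⟩
  exact dvd_of_isUnramifiedAt Q.asIdeal hq.ne_zero hQ hg hα he

end Branch

namespace IsCyclicCover

variable {A B : Type*} [CommRing A] [CommRing B] [Algebra A B] {τ : B ≃ₐ[A] B} {ζ : A} {δ : ℕ}
  [IsDomain A] [IsDomain B] [FaithfulSMul A B]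

theorem eigen_of_mul_eq {η θ : A} {b c d : B} (hb : b ≠ 0) (h : b * c = d)
    (hb' : τ b = θ • b) (hθ : IsUnit θ) (hd : τ d = (θ * η) • d) : τ c = η • c := by
  have h1 : (θ • b) * τ c = (θ • b) * (η • c) := by
    rw [← hb', ← map_mul, h, hd, ← h, hb', mul_smul, smul_mul_assoc, mul_smul_comm]
  have hθb : θ • b ≠ 0 := by rwa [Ne, hθ.smul_eq_zero]
  exact mul_left_cancel₀ hθb h1

theorem eigen_of_algebraMap_mul_eq {η a : A} {c d : B} (ha : a ≠ 0) (h : algebraMap A B a * c = d)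
    (hd : τ d = η • d) : τ c = η • c :=
  eigen_of_mul_eq (θ := 1) ((map_ne_zero_iff _ (FaithfulSMul.algebraMap_injective A B)).2 ha) h
    (by rw [AlgEquiv.commutes, one_smul]) isUnit_one (by rwa [one_mul])

variable (h : IsCyclicCover τ ζ δ)

section

variable [UniqueFactorizationMonoid A] [IsIntegrallyClosed B] {X Y : A} (hX : Prime X)
  (hY : Prime Y) (hXY : ¬ X ∣ Y) (hYX : ¬ Y ∣ X)

include h hX hY hXY hYX in
/-- A Kummer generator with no prime factors outside the branch locus. -/
theorem exists_kummer_generator [IsNoetherianRing B] [Module.Finite A B]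
    (hroot : ∀ u : A, IsUnit u → ∃ v, v ^ δ = u)
    (hbr : ∀ q : A, Prime q → IsBranchedAt A B q → q ∣ X * Y) :
    ∃ (α : B) (e e' : ℕ), α ≠ 0 ∧ τ α = ζ • α ∧ α ^ δ = algebraMap A B (X ^ e * Y ^ e') := by
  have hinj := FaithfulSMul.algebraMap_injective A B
  have hδ := h.pos
  let s : Set A := {a | ∃ α : B, α ≠ 0 ∧ τ α = ζ • α ∧ α ^ δ = algebraMap A B a}
  have hs : s.Nonempty := by
    obtain ⟨α, h0, h1⟩ := h.exists_eigenvector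
    obtain ⟨a, ha⟩ := h.pow_mem_range h.isPrimitiveRoot.pow_eq_one h1
    exact ⟨a, α, h0, h1, ha.symm⟩
  obtain ⟨g, ⟨α, hα0, hα, hαg⟩, hmin⟩ := (wellFounded_dvdNotUnit (α := A)).has_min s hs
  have hg0 : g ≠ 0 := by
    rintro rfl
    rw [map_zero] at hαg
    exact hα0 (eq_zero_of_pow_eq_zero hαg)
  have hg : ∀ q : A, Prime q → q ∣ g → q ∣ X * Y := by
    intro q hq hqg
    by_contra hn
    obtain ⟨m, g', hqg', hgm⟩ := WfDvdMonoid.max_power_factor hg0 hq.irreducible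
    have hm0 : m ≠ 0 := by
      rintro rfl
      rw [pow_zero, one_mul] at hgm
      exact hqg' (hgm ▸ hqg)
    have hδm := dvd_of_not_isBranchedAt hq (fun hb ↦ hn (hbr q hq hb)) hqg' hα0 (hgm ▸ hαg)
    obtain ⟨r, hr⟩ : q ^ δ ∣ g := by
      rw [hgm]
      exact (pow_dvd_pow q (Nat.le_of_dvd (Nat.pos_of_ne_zero hm0) hδm)).mul_right _
    obtain ⟨β, hβ⟩ : algebraMap A B q ∣ α := by
      rw [← IsIntegrallyClosed.pow_dvd_pow_iff hδ.ne', hαg, ← map_pow]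
      exact map_dvd _ ⟨r, hr⟩
    refine hmin r ⟨β, ?_, eigen_of_algebraMap_mul_eq hq.ne_zero hβ.symm hα, ?_⟩
      ⟨?_, q ^ δ, fun hu ↦ hq.not_isUnit ((isUnit_pow_iff hδ.ne').1 hu), by rw [hr, mul_comm]⟩
    · rintro rfl
      exact hα0 (by rw [hβ, mul_zero])
    · have h1 := hαg
      rw [hβ, hr, mul_pow, map_mul, map_pow] at h1
      exact mul_left_cancel₀ (pow_ne_zero _ ((map_ne_zero_iff _ hinj).2 hq.ne_zero)) h1
    · rintro rfl
      exact hg0 (by rw [hr, mul_zero])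
  obtain ⟨e, g₁, hXg, rfl⟩ := WfDvdMonoid.max_power_factor hg0 hX.irreducible
  have hg1 : g₁ ≠ 0 := fun h0 ↦ hg0 (by rw [h0, mul_zero])
  obtain ⟨e', g₂, hYg, rfl⟩ := WfDvdMonoid.max_power_factor hg1 hY.irreducible
  have hu : IsUnit g₂ := by
    by_contra hu
    obtain ⟨q, hq, hqg⟩ := WfDvdMonoid.exists_irreducible_factor hu
      (fun h0 ↦ hg1 (by rw [h0, mul_zero]))
    rcases hq.prime.dvd_or_dvd (hg q hq.prime ((hqg.mul_left _).mul_left _)) with h1 | h1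
    · exact hXg ((hq.prime.associated_of_dvd hX h1).symm.dvd.trans (hqg.mul_left _))
    · exact hYg ((hq.prime.associated_of_dvd hY h1).symm.dvd.trans hqg)
  obtain ⟨v, rfl⟩ := hroot g₂ hu
  have hv : IsUnit v := (isUnit_pow_iff hδ.ne').1 hu
  obtain ⟨β, hβ⟩ : algebraMap A B v ∣ α := (hv.map _).dvd
  have hβδ : β ^ δ = algebraMap A B (X ^ e * Y ^ e') := by
    have h1 := hαg
    rw [hβ, mul_pow, ← mul_assoc, map_mul, map_pow _ v, mul_comm (algebraMap A B _)] at h1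
    exact mul_left_cancel₀ (pow_ne_zero _ ((map_ne_zero_iff _ hinj).2 hv.ne_zero)) h1
  refine ⟨β, e, e', ?_, eigen_of_algebraMap_mul_eq hv.ne_zero hβ.symm hα, hβδ⟩
  rintro rfl
  exact hα0 (by rw [hβ, mul_zero])

omit [IsDomain A] [FaithfulSMul A B] [UniqueFactorizationMonoid A] in
theorem exists_root_of_kummer_generator {ζ : A} {δ : ℕ} (hζ : IsPrimitiveRoot ζ δ) [IsDomain A]
    [FaithfulSMul A B] {X Y : A} (hX0 : X ≠ 0) (hY0 : Y ≠ 0)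
    {α : B} {e e' n₁ n₂ : ℕ} (hα : τ α = ζ • α) (he : α ^ δ = algebraMap A B (X ^ e * Y ^ e'))
    (hδ : 0 < δ) (hn : n₁ * n₂ = δ) (hgcd : e.gcd δ = n₂) (hd : n₁ ∣ e') (hco : n₁.Coprime n₂) :
    ∃ (x : B) (η : A), IsEigenPower τ x η n₁ X := by
  have hinj := FaithfulSMul.algebraMap_injective A B
  rcases Nat.lt_or_ge 1 n₁ with h1 | h1
  swap
  · have : n₁ = 1 := by
      rcases Nat.eq_zero_or_pos n₁ with rfl | h0
      · omega
      · omega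
    subst this
    exact ⟨algebraMap A B X, 1, IsPrimitiveRoot.one, by rw [AlgEquiv.commutes, one_smul],
      by rw [pow_one]⟩
  have hn2 : 0 < n₂ := Nat.pos_of_ne_zero (by rintro rfl; omega)
  obtain ⟨e₁, rfl⟩ : n₂ ∣ e := hgcd ▸ Nat.gcd_dvd_left _ _
  obtain ⟨e₁', rfl⟩ := hd
  have hco1 : (n₂ * e₁).Coprime n₁ := by
    apply Nat.Coprime.mul_left hco.symm
    rw [← hn, mul_comm n₁, Nat.gcd_mul_left] at hgcd
    exact Nat.eq_of_mul_eq_mul_left hn2 (by rw [hgcd, mul_one])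
  have hα' : (α ^ n₂) ^ n₁ = algebraMap A B (X ^ (n₂ * e₁)) * algebraMap A B (Y ^ e₁') ^ n₁ := by
    rw [← pow_mul, mul_comm n₂, hn, he, map_mul, pow_mul' Y, map_pow _ (Y ^ e₁')]
  obtain ⟨z, hz⟩ : algebraMap A B (Y ^ e₁') ∣ α ^ n₂ := by
    rw [← IsIntegrallyClosed.pow_dvd_pow_iff (n := n₁) (by omega), hα']
    exact dvd_mul_left _ _
  have hzn : z ^ n₁ = algebraMap A B (X ^ (n₂ * e₁)) := by
    rw [hz, mul_pow, mul_comm] at hα'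
    exact mul_right_cancel₀ (pow_ne_zero _ ((map_ne_zero_iff _ hinj).2 (pow_ne_zero _ hY0))) hα'
  have hzτ : τ z = ζ ^ n₂ • z :=
    eigen_of_algebraMap_mul_eq (pow_ne_zero _ hY0) hz.symm (eigen_pow hα n₂)
  obtain ⟨m, -, hm⟩ := Nat.exists_mul_mod_eq_one_of_coprime hco1 h1
  obtain ⟨q, hq⟩ : ∃ q, n₂ * e₁ * m = q * n₁ + 1 :=
    ⟨n₂ * e₁ * m / n₁, by have := Nat.div_add_mod' (n₂ * e₁ * m) n₁; omega⟩
  have hzm : (z ^ m) ^ n₁ = algebraMap A B (X ^ q) ^ n₁ * algebraMap A B X := by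
    rw [← pow_mul, mul_comm, pow_mul, hzn, ← map_pow, ← pow_mul, hq, pow_succ, map_mul, pow_mul,
      map_pow _ (X ^ q)]
  obtain ⟨x, hx⟩ : algebraMap A B (X ^ q) ∣ z ^ m := by
    rw [← IsIntegrallyClosed.pow_dvd_pow_iff (n := n₁) (by omega), hzm]
    exact dvd_mul_right _ _
  refine ⟨x, (ζ ^ n₂) ^ m, ?_, ?_, ?_⟩
  · refine (hζ.pow hδ (by rw [← hn, mul_comm])).pow_of_coprime m ?_
    have : (n₂ * e₁ * m).Coprime n₁ := by rw [hq]; simp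
    exact this.coprime_mul_left
  · exact eigen_of_algebraMap_mul_eq (pow_ne_zero _ hX0) hx.symm (eigen_pow hzτ m)
  · rw [hx, mul_pow] at hzm
    exact (mul_left_cancel₀ (pow_ne_zero _ ((map_ne_zero_iff _ hinj).2 (pow_ne_zero _ hX0)))
      hzm).symm

omit [UniqueFactorizationMonoid A] in
theorem dvd_ramificationIdx_of_kummer_generator [IsNoetherianRing B] {X Y : A} (hX : Prime X)
    (hXY : ¬ X ∣ Y)
    {α : B} (hα0 : α ≠ 0) {e e' : ℕ} (hδ : 0 < δ)
    (he : α ^ δ = algebraMap A B (X ^ e * Y ^ e')) (Q : Ideal B) [Q.IsPrime]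
    (hQ : Q.under A = Ideal.span {X}) : δ / e.gcd δ ∣ Q.ramificationIdx A := by
  have hinj := FaithfulSMul.algebraMap_injective A B
  have hX0 : algebraMap A B X ≠ 0 := (map_ne_zero_iff _ hinj).2 hX.ne_zero
  have hle : e.gcd δ ≤ δ := Nat.gcd_le_right _ hδ
  have hd0 : 0 < e.gcd δ := Nat.gcd_pos_of_pos_right _ hδ
  rcases hle.eq_or_lt with hd | hd
  · rw [hd, Nat.div_self hδ]
    exact one_dvd _
  obtain ⟨m, -, hm⟩ := Nat.exists_mul_mod_eq_gcd hd
  obtain ⟨q, hq⟩ : ∃ q, e * m = q * δ + e.gcd δ :=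
    ⟨e * m / δ, by have := Nat.div_add_mod' (e * m) δ; omega⟩
  have hαm : (α ^ m) ^ δ = (algebraMap A B X ^ q) ^ δ *
      (algebraMap A B X ^ e.gcd δ * algebraMap A B Y ^ (e' * m)) := by
    rw [← pow_mul, mul_comm, pow_mul, he, map_mul, map_pow, map_pow, mul_pow, ← pow_mul, ← pow_mul,
      hq, pow_add, ← pow_mul, mul_assoc]
  obtain ⟨β, hβ⟩ : algebraMap A B X ^ q ∣ α ^ m := by
    rw [← IsIntegrallyClosed.pow_dvd_pow_iff hδ.ne', hαm]
    exact dvd_mul_right _ _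
  rw [hβ, mul_pow] at hαm
  have hβδ := mul_left_cancel₀ (pow_ne_zero _ (pow_ne_zero _ hX0)) hαm
  have hnd : δ / e.gcd δ * e.gcd δ = δ := Nat.div_mul_cancel (Nat.gcd_dvd_right _ _)
  rw [← congrArg (β ^ ·) hnd] at hβδ
  simp only [pow_mul] at hβδ
  obtain ⟨w, hw⟩ : algebraMap A B X ∣ β ^ (δ / e.gcd δ) := by
    rw [← IsIntegrallyClosed.pow_dvd_pow_iff hd0.ne', hβδ]
    exact dvd_mul_right _ _
  rw [hw, mul_pow] at hβδ
  have hwd := mul_left_cancel₀ (pow_ne_zero _ hX0) hβδ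
  refine dvd_ramificationIdx_of_pow_eq Q hQ ?_ ?_ hw
  · rintro rfl
    rw [mul_zero] at hβ
    exact pow_ne_zero m hα0 hβ
  · intro hwQ
    have : w ^ e.gcd δ ∈ Q := Ideal.pow_mem_of_mem _ hwQ _ hd0
    rw [hwd, ← pow_mul] at this
    exact not_mem_of_under_eq_span Q hQ hXY (Ideal.IsPrime.mem_of_pow_mem inferInstance _ this)

include h in
omit [UniqueFactorizationMonoid A] in
theorem degree_dvd_of_kummer_generator {X Y : A} {α : B} (hα0 : α ≠ 0) {e e' N : ℕ}
    (hα : τ α = ζ • α) (he : α ^ δ = algebraMap A B (X ^ e * Y ^ e'))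
    (h1 : δ ∣ e * N) (h2 : δ ∣ e' * N) : δ ∣ N := by
  have hinj := FaithfulSMul.algebraMap_injective A B
  have hδ := h.pos
  obtain ⟨a, ha⟩ := h1
  obtain ⟨b, hb⟩ := h2
  have : NeZero δ := ⟨hδ.ne'⟩
  have hp : (α ^ N) ^ δ = algebraMap A B (X ^ a * Y ^ b) ^ δ := by
    rw [← pow_mul, mul_comm, pow_mul, he, ← map_pow, ← map_pow, mul_pow, mul_pow, ← pow_mul,
      ← pow_mul, ← pow_mul, ← pow_mul, ha, hb, mul_comm a, mul_comm b]
  obtain ⟨c, hc⟩ := (IsIntegrallyClosed.pow_dvd_pow_iff hδ.ne').1 hp.symm.dvd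
  have hM0 : algebraMap A B (X ^ a * Y ^ b) ≠ 0 := by
    intro h0
    rw [h0, zero_mul] at hc
    exact pow_ne_zero N hα0 hc
  have hcδ : c ^ δ = 1 := by
    rw [hc, mul_pow] at hp
    exact mul_left_cancel₀ (pow_ne_zero δ hM0) (by rw [hp, mul_one])
  obtain ⟨i, -, rfl⟩ := (h.isPrimitiveRoot.map_of_injective hinj).eq_pow_of_pow_eq_one hcδ
  apply h.isPrimitiveRoot.dvd_of_pow_eq_one
  have h1 := eigen_pow hα N
  rw [hc, ← map_pow, ← map_mul, AlgEquiv.commutes, Algebra.smul_def, ← map_mul] at h1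
  apply hinj
  rw [map_one]
  refine mul_right_cancel₀ (b := algebraMap A B (X ^ a * Y ^ b * ζ ^ i)) ?_ ?_
  · rw [map_mul, map_pow _ ζ, ← hc]
    exact pow_ne_zero N hα0
  · rw [one_mul, ← map_mul, ← h1]

include h hX hY hXY hYX in
omit [IsDomain A] [UniqueFactorizationMonoid A] in
/-- With radicals of coprime exponents `n₁ * n₂ = δ` of `X` and `Y` in `B`, every eigenvector of
`B` is a multiple of a monomial in the radicals. -/
theorem exists_eq_smul_monomial [IsDomain A] {x y : B} {η θ : A} {n₁ n₂ : ℕ} (hx : IsEigenPower τ x η n₁ X)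
    (hy : IsEigenPower τ y θ n₂ Y) (hn : n₁ * n₂ = δ) (hco : n₁.Coprime n₂) {ε : A} (hε : ε ^ δ = 1)
    {c : B} (hc : τ c = ε • c) : ∃ (a : A) (r s : ℕ), c = a • (x ^ r * y ^ s) := by
  have hinj := FaithfulSMul.algebraMap_injective A B
  have hδ := h.pos
  have hn1 : 0 < n₁ := Nat.pos_of_ne_zero (by rintro rfl; omega)
  have hn2 : 0 < n₂ := Nat.pos_of_ne_zero (by rintro rfl; omega)
  have : NeZero δ := ⟨hδ.ne'⟩
  have hprim : IsPrimitiveRoot (η * θ) δ := by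
    rw [IsPrimitiveRoot.iff_orderOf, (Commute.all η θ).orderOf_mul_eq_mul_orderOf_of_coprime] <;>
      rw [← hx.isPrimitiveRoot.eq_orderOf, ← hy.isPrimitiveRoot.eq_orderOf]
    · exact hn
    · exact hco
  obtain ⟨k, -, hk⟩ := hprim.eq_pow_of_pow_eq_one hε
  have hηk : η ^ k = η ^ (k % n₁) := by
    rw [hx.isPrimitiveRoot.eq_orderOf, pow_mod_orderOf]
  have hθk : θ ^ k = θ ^ (k % n₂) := by
    rw [hy.isPrimitiveRoot.eq_orderOf, pow_mod_orderOf]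
  set r := k % n₁
  set s := k % n₂
  have hr : r < n₁ := Nat.mod_lt _ hn1
  have hs : s < n₂ := Nat.mod_lt _ hn2
  have hinv : τ (c * (x ^ (n₁ - r) * y ^ (n₂ - s))) = c * (x ^ (n₁ - r) * y ^ (n₂ - s)) := by
    rw [eigen_mul hc (eigen_monomial hx.eigen hy.eigen _ _), ← hk, mul_pow, hηk, hθk,
      mul_mul_mul_comm, ← pow_add, ← pow_add, Nat.add_sub_cancel' hr.le, Nat.add_sub_cancel' hs.le,
      hx.isPrimitiveRoot.pow_eq_one, hy.isPrimitiveRoot.pow_eq_one, one_mul, one_smul]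
  obtain ⟨a, ha⟩ := h.exists_algebraMap_eq _ hinv
  obtain ⟨γ, hγ⟩ := h.pow_mem_range hε hc
  have hpow : a ^ δ = γ * (X ^ ((n₁ - r) * n₂) * Y ^ ((n₂ - s) * n₁)) := by
    apply hinj
    rw [map_pow, ha, map_mul, hγ, map_mul, map_pow, map_pow, hx.algebraMap_eq, hy.algebraMap_eq,
      mul_pow, mul_pow, ← pow_mul, ← pow_mul, ← pow_mul, ← pow_mul, ← hn]
    congr 3 <;> ring
  have hXa : X ∣ a := by
    refine hX.dvd_of_dvd_pow (n := δ) (hpow ▸ Dvd.dvd.mul_left (Dvd.dvd.mul_right ?_ _) _)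
    exact dvd_pow_self X (Nat.mul_pos (by omega) hn2).ne'
  have hYa : Y ∣ a := by
    refine hY.dvd_of_dvd_pow (n := δ) (hpow ▸ Dvd.dvd.mul_left (Dvd.dvd.mul_left ?_ _) _)
    exact dvd_pow_self Y (Nat.mul_pos (by omega) hn1).ne'
  obtain ⟨a', rfl⟩ := hXa
  obtain ⟨a'', rfl⟩ := (hY.dvd_or_dvd hYa).resolve_left hYX
  refine ⟨a'', r, s, ?_⟩
  have hx0 : x ≠ 0 := by
    rintro rfl
    have := hx.algebraMap_eq
    rw [zero_pow hn1.ne', map_eq_zero_iff _ hinj] at this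
    exact hX.ne_zero this
  have hy0 : y ≠ 0 := by
    rintro rfl
    have := hy.algebraMap_eq
    rw [zero_pow hn2.ne', map_eq_zero_iff _ hinj] at this
    exact hY.ne_zero this
  refine mul_right_cancel₀ (mul_ne_zero (pow_ne_zero (n₁ - r) hx0) (pow_ne_zero (n₂ - s) hy0)) ?_
  rw [← ha, map_mul, map_mul, hx.algebraMap_eq, hy.algebraMap_eq, Algebra.smul_def]
  nth_rw 1 [← Nat.add_sub_cancel' hr.le, ← Nat.add_sub_cancel' hs.le, pow_add, pow_add]
  ring

include h hX hY hXY hYX in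
omit [IsDomain A] [UniqueFactorizationMonoid A] in
theorem maximalIdeal_eq_span_radicals [IsDomain A] [IsLocalRing A] [IsLocalRing B]
    [IsLocalHom (algebraMap A B)] (hm : maximalIdeal A = Ideal.span {X, Y})
    {x y : B} {η θ : A} {n₁ n₂ : ℕ} (hx : IsEigenPower τ x η n₁ X)
    (hy : IsEigenPower τ y θ n₂ Y) (hn : n₁ * n₂ = δ) (hco : n₁.Coprime n₂) :
    maximalIdeal B = Ideal.span {x, y} := by
  have hδ := h.pos
  have hn1 : 0 < n₁ := Nat.pos_of_ne_zero (by rintro rfl; omega)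
  have hn2 : 0 < n₂ := Nat.pos_of_ne_zero (by rintro rfl; omega)
  have hxI : x ∈ Ideal.span {x, y} := Ideal.subset_span (by simp)
  have hyI : y ∈ Ideal.span {x, y} := Ideal.subset_span (by simp)
  have hpow {z : B} {Z : A} {n : ℕ} (hZ : algebraMap A B Z = z ^ n) (hn : 0 < n)
      (hZm : Z ∈ maximalIdeal A) : z ∈ maximalIdeal B := by
    rw [mem_maximalIdeal, mem_nonunits_iff] at hZm ⊢
    exact fun hu ↦ hZm (isUnit_of_map_unit (algebraMap A B) _ (hZ ▸ hu.pow n))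
  have key (b : B) : ∃ a : A, b - algebraMap A B a ∈ Ideal.span {x, y} := by
    obtain ⟨c, hc, rfl⟩ := h.exists_eq_sum b ⊤ (fun _ _ ↦ trivial) trivial
    have (k : ℕ) : ∃ a : A, c k - algebraMap A B a ∈ Ideal.span {x, y} := by
      obtain ⟨-, ε, hε, hcε⟩ := hc k
      obtain ⟨a, r, s, e⟩ := h.exists_eq_smul_monomial hX hY hXY hYX hx hy hn hco hε hcε
      rw [e]
      rcases Nat.eq_zero_or_pos r with rfl | hr
      · rcases Nat.eq_zero_or_pos s with rfl | hs
        · exact ⟨a, by simp [Algebra.smul_def]⟩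
        · refine ⟨0, ?_⟩
          rw [map_zero, sub_zero, Algebra.smul_def]
          exact Ideal.mul_mem_left _ _ (Ideal.mul_mem_left _ _ (Ideal.pow_mem_of_mem _ hyI _ hs))
      · refine ⟨0, ?_⟩
        rw [map_zero, sub_zero, Algebra.smul_def]
        exact Ideal.mul_mem_left _ _ (Ideal.mul_mem_right _ _ (Ideal.pow_mem_of_mem _ hxI _ hr))
    choose a ha using this
    refine ⟨∑ k ∈ Finset.range δ, a k, ?_⟩
    rw [map_sum, ← Finset.sum_sub_distrib]
    exact Ideal.sum_mem _ fun k _ ↦ ha k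
  have hle : Ideal.span {x, y} ≤ maximalIdeal B := by
    rw [Ideal.span_le]
    rintro z (rfl | rfl)
    · exact hpow hx.algebraMap_eq hn1 (hm ▸ Ideal.subset_span (by simp))
    · exact hpow hy.algebraMap_eq hn2 (hm ▸ Ideal.subset_span (by simp))
  refine le_antisymm (fun b hb ↦ ?_) hle
  obtain ⟨a, ha⟩ := key b
  have haB : algebraMap A B a ∈ maximalIdeal B := by
    have := Ideal.sub_mem _ hb (hle ha)
    rwa [sub_sub_cancel] at this
  have haA : a ∈ maximalIdeal A := by
    rw [mem_maximalIdeal, mem_nonunits_iff] at haB ⊢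
    exact fun hu ↦ haB (hu.map _)
  rw [hm] at haA
  obtain ⟨p, q, rfl⟩ := Ideal.mem_span_pair.1 haA
  rw [← sub_add_cancel b (algebraMap A B _)]
  refine Ideal.add_mem _ ha ?_
  rw [map_add, map_mul, map_mul, hx.algebraMap_eq, hy.algebraMap_eq]
  exact Ideal.add_mem _ (Ideal.mul_mem_left _ _ (Ideal.pow_mem_of_mem _ hxI _ hn1))
    (Ideal.mul_mem_left _ _ (Ideal.pow_mem_of_mem _ hyI _ hn2))

end

/-- `B` is obtained from `A` by adjoining roots `x, y` of coprime orders `n₁, n₂` of the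
parameters `X, Y`; then `x, y` generate the maximal ideal of `B`. -/
structure IsRadicalPair (τ : B ≃ₐ[A] B) (δ : ℕ) [IsLocalRing A] [IsLocalRing B] (X Y : A) (x y : B)
    (n₁ n₂ : ℕ) : Prop where
  span_eq : maximalIdeal B = Ideal.span {x, y}
  left_eq : algebraMap A B X = x ^ n₁
  right_eq : algebraMap A B Y = y ^ n₂
  mul_eq : n₁ * n₂ = δ

variable [IsLocalRing A] [IsLocalRing B] [IsLocalHom (algebraMap A B)]
  [UniqueFactorizationMonoid A] [IsIntegrallyClosed B] [IsNoetherianRing B] [Module.Finite A B]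
  {X Y : A} (hXY : IsParamPair X Y)
  (hroot : ∀ u : A, IsUnit u → ∃ v, v ^ δ = u)
  (hbr : ∀ q : A, Prime q → IsBranchedAt A B q → q ∣ X * Y)

include h hXY in
theorem exists_isRadicalPair_of_kummer_generator {α : B} {e e' : ℕ} (hα0 : α ≠ 0)
    (hα : τ α = ζ • α) (he : α ^ δ = algebraMap A B (X ^ e * Y ^ e'))
    (hco : (δ / e.gcd δ).Coprime (δ / e'.gcd δ)) :
    ∃ x y, IsRadicalPair τ δ X Y x y (δ / e.gcd δ) (δ / e'.gcd δ) := by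
  have hδ := h.pos
  have hd := Nat.gcd_dvd_right e δ
  have hd' := Nat.gcd_dvd_right e' δ
  have hgd := Nat.gcd_dvd_left e δ
  have hgd' := Nat.gcd_dvd_left e' δ
  have h1 : δ / e.gcd δ * e.gcd δ = δ := Nat.div_mul_cancel hd
  have h2 : δ / e'.gcd δ * e'.gcd δ = δ := Nat.div_mul_cancel hd'
  set n₁ := δ / e.gcd δ
  set n₂ := δ / e'.gcd δ
  have hn : n₁ * n₂ = δ := by
    apply Nat.dvd_antisymm (hco.mul_dvd_of_dvd_of_dvd ⟨_, h1.symm⟩ ⟨_, h2.symm⟩)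
    refine h.degree_dvd_of_kummer_generator hα0 hα he ?_ ?_
    · calc δ ∣ δ * n₂ := dvd_mul_right _ _
        _ = e.gcd δ * (n₁ * n₂) := by rw [← mul_assoc, mul_comm _ n₁, h1]
        _ ∣ e * (n₁ * n₂) := mul_dvd_mul_right hgd _
    · calc δ ∣ n₁ * δ := dvd_mul_left _ _
        _ = e'.gcd δ * (n₁ * n₂) := by rw [mul_left_comm, mul_comm _ n₂, h2]
        _ ∣ e' * (n₁ * n₂) := mul_dvd_mul_right hgd' _
  have hn1 : 0 < n₁ := Nat.pos_of_ne_zero (by intro h0; rw [h0] at hn; omega)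
  have hn2 : 0 < n₂ := Nat.pos_of_ne_zero (by intro h0; rw [h0] at hn; omega)
  have hg : e.gcd δ = n₂ := Nat.eq_of_mul_eq_mul_left hn1 (h1.trans hn.symm)
  have hg' : e'.gcd δ = n₁ := Nat.eq_of_mul_eq_mul_right hn2 (by rw [mul_comm, h2, hn])
  obtain ⟨x, η, hx⟩ := exists_root_of_kummer_generator h.isPrimitiveRoot hXY.prime_left.ne_zero
    hXY.prime_right.ne_zero hα he hδ hn hg (hg' ▸ hgd') hco
  obtain ⟨y, θ, hy⟩ := exists_root_of_kummer_generator (X := Y) (Y := X) h.isPrimitiveRoot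
    hXY.prime_right.ne_zero hXY.prime_left.ne_zero hα (by rw [he, mul_comm]) hδ
    ((mul_comm _ _).trans hn) hg' (hg ▸ hgd) hco.symm
  exact ⟨x, y, h.maximalIdeal_eq_span_radicals hXY.prime_left hXY.prime_right hXY.not_dvd
    hXY.not_dvd' hXY.span_eq hx hy hn hco, hx.algebraMap_eq, hy.algebraMap_eq, hn⟩

include h hXY hroot hbr in
theorem exists_isRadicalPair_of_not_isBranchedAt (hY : ¬ IsBranchedAt A B Y) :
    ∃ x y, IsRadicalPair τ δ X Y x y δ 1 := by
  have hδ := h.pos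
  obtain ⟨α, e, e', hα0, hα, he⟩ := h.exists_kummer_generator hXY.prime_left hXY.prime_right
    hXY.not_dvd hXY.not_dvd' hroot hbr
  have hd : δ ∣ e' := dvd_of_not_isBranchedAt hXY.prime_right hY (g := X ^ e)
    (fun h1 ↦ hXY.not_dvd' (hXY.prime_right.dvd_of_dvd_pow h1)) hα0 (by rw [he, mul_comm])
  have h1 : δ / e'.gcd δ = 1 := by rw [Nat.gcd_eq_right hd, Nat.div_self hδ]
  obtain ⟨x, y, hp⟩ := h.exists_isRadicalPair_of_kummer_generator hXY hα0 hα he (by simp [h1])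
  have h2 := hp.mul_eq
  rw [h1, mul_one] at h2
  rw [h1, h2] at hp
  exact ⟨x, y, hp⟩

include h hXY hroot hbr in
theorem exists_isRadicalPair_of_coprime (hco : ∀ Q₁ Q₂ : PrimeSpectrum B,
      Q₁.asIdeal.under A = Ideal.span {X} → Q₂.asIdeal.under A = Ideal.span {Y} →
      (Q₁.asIdeal.ramificationIdx A).Coprime (Q₂.asIdeal.ramificationIdx A)) :
    ∃ x y n₁ n₂, IsRadicalPair τ δ X Y x y n₁ n₂ := by
  have hδ := h.pos
  obtain ⟨α, e, e', hα0, hα, he⟩ := h.exists_kummer_generator hXY.prime_left hXY.prime_right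
    hXY.not_dvd hXY.not_dvd' hroot hbr
  obtain ⟨Q₁, hQ₁⟩ := hXY.prime_left.exists_liesOver (B := B)
  obtain ⟨Q₂, hQ₂⟩ := hXY.prime_right.exists_liesOver (B := B)
  obtain ⟨x, y, hp⟩ := h.exists_isRadicalPair_of_kummer_generator hXY hα0 hα he
    (((hco Q₁ Q₂ hQ₁ hQ₂).coprime_dvd_left (dvd_ramificationIdx_of_kummer_generator hXY.prime_left
      hXY.not_dvd hα0 hδ he Q₁.asIdeal hQ₁)).coprime_dvd_right
      (dvd_ramificationIdx_of_kummer_generator hXY.prime_right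
      hXY.not_dvd' hα0 hδ (by rw [he, mul_comm]) Q₂.asIdeal hQ₂))
  exact ⟨x, y, _, _, hp⟩

end IsCyclicCover

section Residue

/-- The residue field of a local algebra over a discrete valuation ring `R`, if it is a quotient of
`R`, is the residue field of `R`. -/
theorem isAlgClosed_residueField_of_surjective {R A : Type*} [CommRing R] [IsDomain R]
    [IsDiscreteValuationRing R] [IsAlgClosed (ResidueField R)] [CommRing A] [IsLocalRing A]
    [Algebra R A]
    (h : Function.Surjective ((Ideal.Quotient.mk (maximalIdeal A)).comp (algebraMap R A))) :
    IsAlgClosed (ResidueField A) := by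
  let f : R →+* ResidueField A := (residue A).comp (algebraMap R A)
  have hf : Function.Surjective f := h
  have hker : RingHom.ker f = maximalIdeal R := by
    have hmax : (RingHom.ker f).IsMaximal := RingHom.ker_isMaximal_of_surjective f hf
    exact IsLocalRing.eq_maximalIdeal hmax
  let e : ResidueField R ≃+* ResidueField A :=
    (Ideal.quotEquivOfEq hker.symm).trans (RingHom.quotientKerEquivOfSurjective hf)
  refine IsAlgClosed.of_exists_root _ fun p _ hp ↦ ?_
  obtain ⟨x, hx⟩ := IsAlgClosed.exists_root (p.map (e.symm : ResidueField A →+* ResidueField R))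
    (by rw [Polynomial.degree_map]; exact hp.degree_pos.ne')
  refine ⟨e x, ?_⟩
  rw [Polynomial.IsRoot.def, Polynomial.eval_map] at hx
  have := congrArg e hx
  rw [map_zero, Polynomial.eval₂_eq_sum_range, map_sum] at this
  rw [Polynomial.eval_eq_sum_range, ← this]
  exact Finset.sum_congr rfl fun i _ ↦ by simp

theorem exists_sub_algebraMap_mem_maximalIdeal {A B : Type*} [CommRing A] [CommRing B]
    [Algebra A B] [Module.Finite A B] [IsLocalRing A] [IsLocalRing B] [IsLocalHom (algebraMap A B)]
    [IsAlgClosed (ResidueField A)] (b : B) : ∃ a : A, b - algebraMap A B a ∈ maximalIdeal B := by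
  obtain ⟨c, hc⟩ := (IsAlgClosed.algebraMap_bijective_of_isIntegral
    (k := ResidueField A) (K := ResidueField B)).2 (residue B b)
  obtain ⟨a, rfl⟩ := residue_surjective c
  refine ⟨a, ?_⟩
  rw [← residue_eq_zero_iff, map_sub, ← hc]
  simp

theorem surjective_mk_comp_algebraMap {R A B : Type*} [CommRing R] [CommRing A] [CommRing B]
    [Algebra R A] [Algebra R B] [Algebra A B] [IsScalarTower R A B] [IsLocalRing A] [IsLocalRing B]
    [IsLocalHom (algebraMap A B)]
    (h : Function.Surjective ((Ideal.Quotient.mk (maximalIdeal A)).comp (algebraMap R A)))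
    (hres : ∀ b : B, ∃ a : A, b - algebraMap A B a ∈ maximalIdeal B) :
    Function.Surjective ((Ideal.Quotient.mk (maximalIdeal B)).comp (algebraMap R B)) := by
  intro c
  obtain ⟨b, rfl⟩ := Ideal.Quotient.mk_surjective c
  obtain ⟨a, ha⟩ := hres b
  obtain ⟨r, hr⟩ := h (Ideal.Quotient.mk _ a)
  refine ⟨r, ?_⟩
  rw [RingHom.comp_apply, Ideal.Quotient.eq] at hr ⊢
  rw [IsScalarTower.algebraMap_apply R A B]
  have h1 : algebraMap A B (algebraMap R A r - a) ∈ maximalIdeal B := by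
    rw [mem_maximalIdeal, mem_nonunits_iff] at hr ⊢
    exact fun hu ↦ hr (isUnit_of_map_unit _ _ hu)
  have := Ideal.sub_mem _ h1 ha
  rwa [map_sub, sub_sub_sub_cancel_right] at this

theorem two_le_ringKrullDim_of_isParamPair {A B : Type*} [CommRing A] [CommRing B] [Algebra A B]
    [Algebra.IsIntegral A B] [IsLocalRing A] [IsDomain B] [IsNoetherianRing B] [IsLocalRing B] [FaithfulSMul A B]
    [IsLocalHom (algebraMap A B)] {x y : A} (h : IsParamPair x y) : 2 ≤ ringKrullDim B := by
  obtain ⟨Q, hQ⟩ := h.prime_left.exists_liesOver (B := B)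
  have h1 : (⊥ : PrimeSpectrum B) < Q := by
    refine lt_of_le_of_ne bot_le ?_
    rintro rfl
    have : algebraMap A B x ∈ (⊥ : Ideal B) := mem_of_under_eq_span _ hQ
    rw [Ideal.mem_bot, map_eq_zero_iff _ (FaithfulSMul.algebraMap_injective A B)] at this
    exact h.prime_left.ne_zero this
  have h2 : Q < ⟨maximalIdeal B, inferInstance⟩ := by
    refine lt_of_le_of_ne (IsLocalRing.le_maximalIdeal Q.isPrime.ne_top) ?_
    rintro rfl
    have h3 : y ∈ (maximalIdeal B).under A := by
      change algebraMap A B y ∈ maximalIdeal B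
      rw [mem_maximalIdeal, mem_nonunits_iff]
      exact fun hu ↦ h.prime_right.not_isUnit (isUnit_of_map_unit _ _ hu)
    exact h.not_dvd (Ideal.mem_span_singleton.1 (hQ ▸ h3))
  let l : LTSeries (PrimeSpectrum B) :=
    ⟨2, ![⊥, Q, ⟨maximalIdeal B, inferInstance⟩], fun i ↦ by fin_cases i; exacts [h1, h2]⟩
  exact Order.LTSeries.length_le_krullDim l

end Residue

section Hensel

variable {A : Type*} [CommRing A] [IsLocalRing A] [IsAdicComplete (maximalIdeal A) A]

theorem exists_pow_eq_of_residue {n : ℕ} (hn : IsUnit (n : A)) (hn0 : 0 < n) {u a : A}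
    (hu : IsUnit u) (ha : a ^ n - u ∈ maximalIdeal A) :
    ∃ b, b ^ n = u ∧ b - a ∈ maximalIdeal A := by
  have hau : IsUnit a := by
    by_contra h
    have h1 : a ^ n ∈ maximalIdeal A := Ideal.pow_mem_of_mem _ ((mem_maximalIdeal _).2 h) _ hn0
    have h2 := Ideal.sub_mem _ h1 ha
    rw [sub_sub_cancel] at h2
    exact h2 hu
  obtain ⟨b, hb, hba⟩ := HenselianRing.is_henselian (I := maximalIdeal A)
    (Polynomial.X ^ n - Polynomial.C u) (Polynomial.monic_X_pow_sub_C u hn0.ne') a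
    (by simpa using ha) (by
      simp only [Polynomial.derivative_sub, Polynomial.derivative_X_pow, Polynomial.derivative_C,
        sub_zero, Polynomial.eval_mul, Polynomial.eval_pow, Polynomial.eval_X, Polynomial.eval_C]
      exact (hn.mul (hau.pow _)).map _)
  refine ⟨b, ?_, hba⟩
  rw [Polynomial.IsRoot.def] at hb
  simpa [sub_eq_zero] using hb

variable [IsAlgClosed (ResidueField A)]

theorem exists_pow_eq_of_isUnit {n : ℕ} (hn : IsUnit (n : A)) {u : A} (hu : IsUnit u) :
    ∃ v, v ^ n = u := by
  have hn0 : 0 < n := Nat.pos_of_ne_zero (by rintro rfl; simp at hn)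
  obtain ⟨z, hz⟩ := IsAlgClosed.exists_pow_nat_eq (residue A u) hn0
  obtain ⟨a, rfl⟩ := residue_surjective z
  obtain ⟨b, hb, -⟩ := exists_pow_eq_of_residue (a := a) hn hn0 hu
    (by rw [← residue_eq_zero_iff, map_sub, map_pow, hz, sub_self])
  exact ⟨b, hb⟩

theorem exists_isPrimitiveRoot {n : ℕ} (hn : IsUnit (n : A)) : ∃ ζ : A, IsPrimitiveRoot ζ n := by
  have hn0 : 0 < n := Nat.pos_of_ne_zero (by rintro rfl; simp at hn)
  have : NeZero n := ⟨hn0.ne'⟩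
  have : NeZero (n : ResidueField A) := ⟨by
    have := hn.map (residue A)
    rw [map_natCast] at this
    exact this.ne_zero⟩
  obtain ⟨z, hz⟩ := HasEnoughRootsOfUnity.exists_primitiveRoot (ResidueField A) n
  obtain ⟨a, rfl⟩ := residue_surjective z
  obtain ⟨ζ, hζ, hζa⟩ := exists_pow_eq_of_residue (u := 1) (a := a) hn hn0 isUnit_one
    (by rw [← residue_eq_zero_iff, map_sub, map_pow, hz.pow_eq_one, map_one, sub_self])
  have h1 : residue A ζ = residue A a := by
    rw [← sub_eq_zero, ← map_sub, residue_eq_zero_iff]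
    exact hζa
  refine ⟨ζ, hζ, fun l hl ↦ hz.dvd_of_pow_eq_one l ?_⟩
  rw [← h1, ← map_pow, hl, map_one]

end Hensel

section Galois

theorem isIntegrallyClosed_of_isIntegralClosure (A B L : Type*) [CommRing A] [CommRing B]
    [Algebra A B] [Field L] [Algebra A L] [Algebra B L] [IsScalarTower A B L]
    [IsFractionRing B L] [IsIntegralClosure B A L] : IsIntegrallyClosed B := by
  have : Algebra.IsIntegral A B := IsIntegralClosure.isIntegral_algebra A L
  rw [isIntegrallyClosed_iff L]
  intro x hx
  exact IsIntegralClosure.isIntegral_iff.1 (isIntegral_trans (R := A) x hx)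

theorem exists_isCyclicCover {A B : Type*} (F L : Type*) [CommRing A] [IsDomain A] [CommRing B]
    [Algebra A B] [Field F] [Field L] [Algebra A F] [IsFractionRing A F]
    [Algebra B L] [IsFractionRing B L] [Algebra F L] [Algebra A L]
    [IsScalarTower A F L] [IsScalarTower A B L] [IsIntegralClosure B A L]
    [FiniteDimensional F L] [IsGalois F L] [IsCyclic (L ≃ₐ[F] L)] [IsIntegrallyClosed A]
    {ζ : A} (hζ : IsPrimitiveRoot ζ (Module.finrank F L))
    (hu : IsUnit ((Module.finrank F L : ℕ) : A)) :
    ∃ τ : B ≃ₐ[A] B, IsCyclicCover τ ζ (Module.finrank F L) := by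
  have hinj : Function.Injective (algebraMap B L) := IsFractionRing.injective B L
  have hinjF : Function.Injective (algebraMap A F) := IsFractionRing.injective A F
  obtain ⟨σ, hσ⟩ := (inferInstance : IsCyclic (L ≃ₐ[F] L))
  have hord : orderOf σ = Module.finrank F L := by
    rw [orderOf_eq_card_of_forall_mem_zpowers hσ, IsGalois.card_aut_eq_finrank]
  have happ (b : B) : algebraMap B L (galRestrict A F L B σ b) = σ (algebraMap B L b) :=
    algebraMap_galRestrict_apply A σ b
  refine ⟨galRestrict A F L B σ, hζ, hu, fun b ↦ ?_, fun b hb ↦ ?_, ?_⟩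
  · rw [← map_pow, ← hord, pow_orderOf_eq_one, map_one, AlgEquiv.one_apply]
  · have h1 : σ (algebraMap B L b) = algebraMap B L b := by rw [← happ, hb]
    have h2 : algebraMap B L b ∈ (⊥ : IntermediateField F L) := by
      rw [IsGalois.mem_bot_iff_fixed]
      intro f
      obtain ⟨n, rfl⟩ := mem_powers_iff_mem_zpowers.mpr (hσ f)
      simp only
      induction n with
      | zero => simp
      | succ n ih => rw [pow_succ, AlgEquiv.mul_apply, h1, ih]
    obtain ⟨f, hf⟩ := IntermediateField.mem_bot.1 h2
    have h3 : IsIntegral A f := by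
      rw [← isIntegral_algebraMap_iff (B := L) (algebraMap F L).injective, hf]
      exact (IsIntegralClosure.isIntegral A L b).algebraMap
    obtain ⟨a, rfl⟩ := IsIntegrallyClosed.isIntegral_iff.1 h3
    refine ⟨a, hinj ?_⟩
    rw [← hf, ← IsScalarTower.algebraMap_apply, ← IsScalarTower.algebraMap_apply]
  · have hroot : (minpoly F σ.toLinearMap).IsRoot (algebraMap A F ζ) := by
      rw [minpoly_algEquiv_toLinearMap σ (isOfFinOrder_of_finite σ), hord]
      simp [← map_pow, hζ.pow_eq_one]
    obtain ⟨v, hv⟩ := (Module.End.hasEigenvalue_of_isRoot hroot).exists_hasEigenvector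
    have hv1 : σ v = algebraMap A F ζ • v := hv.apply_eq_smul
    have hv0 : v ≠ 0 := hv.2
    have : Algebra.IsAlgebraic A L := IsFractionRing.comap_isAlgebraic_iff.2
      (inferInstance : Algebra.IsAlgebraic F L)
    obtain ⟨a, ha0, ha⟩ := (Algebra.IsAlgebraic.isAlgebraic (R := A) v).exists_integral_multiple
    obtain ⟨α, hα⟩ := (IsIntegralClosure.isIntegral_iff (A := B)).1 ha
    refine ⟨α, ?_, hinj ?_⟩
    · rintro rfl
      rw [map_zero, eq_comm, Algebra.smul_def, mul_eq_zero, IsScalarTower.algebraMap_apply A F L] at hα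
      rcases hα with h0 | h0
      · rw [map_eq_zero_iff _ (algebraMap F L).injective, map_eq_zero_iff _ hinjF] at h0
        exact ha0 h0
      · exact hv0 h0
    · rw [happ, hα, ← algebraMap_smul F a v, map_smul, hv1, Algebra.smul_def ζ α, map_mul, hα,
        ← IsScalarTower.algebraMap_apply, IsScalarTower.algebraMap_apply A F L, ← Algebra.smul_def,
        ← algebraMap_smul F a v, smul_comm]

end Galois

section RegularQuotient

theorem IsLocalRing.ringKrullDim_le_two {S : Type*} [CommRing S] [IsLocalRing S]
    [IsNoetherianRing S] {x y : S} (h : maximalIdeal S = Ideal.span {x, y}) :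
    ringKrullDim S ≤ 2 := by
  have h1 : (maximalIdeal S).spanFinrank ≤ 2 := by
    rw [h]
    exact (Submodule.spanFinrank_span_le_ncard_of_finite (Set.toFinite _)).trans
      ((Set.ncard_insert_le _ _).trans (by simp))
  exact (ringKrullDim_le_spanFinrank_maximalIdeal S).trans (by exact_mod_cast h1)

/-- If the principal divisor of `g` on a two-dimensional regular local ring is regular, then `g` is
part of a system of parameters. -/
theorem IsParamPair.exists_maximalIdeal_eq_span {S : Type*} [CommRing S] [IsLocalRing S]
    [IsDomain S] [IsNoetherianRing S] {x y g : S} (h : IsParamPair x y) (hg0 : g ≠ 0)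
    (hreg : IsRegularLocalRing (S ⧸ Ideal.span {g})) :
    ∃ z, maximalIdeal S = Ideal.span {g, z} := by
  have h1 := (ringKrullDim_quotient_succ_le_of_nonZeroDivisor
    (mem_nonZeroDivisors_of_ne_zero hg0)).trans (IsLocalRing.ringKrullDim_le_two h.span_eq)
  have h2 : (maximalIdeal (S ⧸ Ideal.span {g})).spanFinrank ≤ 1 := by
    rw [← hreg.spanFinrank_maximalIdeal] at h1
    have : (maximalIdeal (S ⧸ Ideal.span {g})).spanFinrank + 1 ≤ 2 := by exact_mod_cast h1
    omega
  obtain ⟨z, hz⟩ : ∃ z, maximalIdeal (S ⧸ Ideal.span {g}) = Ideal.span {z} := by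
    rcases Nat.le_one_iff_eq_zero_or_eq_one.1 h2 with h3 | h3
    · refine ⟨0, ?_⟩
      rw [(Submodule.spanFinrank_eq_zero_iff_eq_bot (IsNoetherian.noetherian _)).1 h3]
      simp
    · obtain ⟨⟨z, hz⟩⟩ := ((Submodule.spanFinrank_eq_one_iff _).1 h3).1
      exact ⟨z, hz⟩
  obtain ⟨z, rfl⟩ := Ideal.Quotient.mk_surjective z
  refine ⟨z, ?_⟩
  have : IsLocalHom (Ideal.Quotient.mk (Ideal.span {g})) :=
    IsLocalHom.of_surjective _ Ideal.Quotient.mk_surjective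
  have h4 : (Ideal.span {Ideal.Quotient.mk (Ideal.span {g}) z}).comap
      (Ideal.Quotient.mk (Ideal.span {g})) = maximalIdeal S := by
    rw [← hz]
    exact ((IsLocalRing.local_hom_TFAE (Ideal.Quotient.mk (Ideal.span {g}))).out 0 4).1 this
  rw [← h4, ← Set.image_singleton, ← Ideal.map_span, Ideal.comap_map_of_surjective _
    Ideal.Quotient.mk_surjective, ← RingHom.ker_eq_comap_bot, Ideal.mk_ker, Ideal.span_insert,
    sup_comm]

theorem IsParamPair.not_isRegularLocalRing_quotient_mul {S : Type*} [CommRing S] [IsLocalRing S]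
    [IsDomain S] [IsNoetherianRing S] {x y : S} (h : IsParamPair x y) :
    ¬ IsRegularLocalRing (S ⧸ Ideal.span {x * y}) := by
  intro hreg
  obtain ⟨z, hz⟩ := h.exists_maximalIdeal_eq_span (mul_ne_zero h.prime_left.ne_zero
    h.prime_right.ne_zero) hreg
  have key {t s : S} (ht : t ∈ maximalIdeal S) (hs : s ∈ maximalIdeal S) (hts : x * y = t * s) :
      z ∣ t := by
    rw [hz] at ht
    obtain ⟨c, d, e⟩ := Ideal.mem_span_pair.1 ht
    have hu : IsUnit (1 - c * s) := by
      by_contra hu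
      have h1 : c * s ∈ maximalIdeal S := Ideal.mul_mem_left _ _ hs
      have := Ideal.add_mem _ ((mem_maximalIdeal _).2 hu) h1
      rw [sub_add_cancel] at this
      exact this isUnit_one
    rw [← hu.dvd_mul_left]
    exact ⟨d, by linear_combination c * hts - e⟩
  have hx := key h.left_mem h.right_mem rfl
  have hy := key h.right_mem h.left_mem (mul_comm x y)
  have hzm : z ∈ maximalIdeal S := hz ▸ Ideal.subset_span (by simp)
  obtain ⟨c, hc⟩ := hx
  rcases h.prime_left.irreducible.isUnit_or_isUnit hc with hu | hu
  · exact hzm hu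
  · exact h.not_dvd (((associated_mul_unit_right z c hu).symm.dvd.trans hy |> fun h2 ↦ hc ▸ h2))

theorem Ideal.radical_span_unit_mul_pow {S : Type*} [CommRing S] {x w : S} (hx : Prime x)
    (hw : IsUnit w) {n : ℕ} (hn : n ≠ 0) :
    (Ideal.span {w * x ^ n}).radical = Ideal.span {x} := by
  rw [Ideal.span_singleton_mul_left_unit hw, ← Ideal.span_singleton_pow, Ideal.radical_pow _ hn]
  exact ((Ideal.span_singleton_prime hx.ne_zero).2 hx).radical

theorem Ideal.radical_span_unit_mul_pow_mul_pow {S : Type*} [CommRing S] [IsDomain S] {x y w : S}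
    (hx : Prime x) (hy : Prime y) (hyx : ¬ y ∣ x) (hw : IsUnit w) {a b : ℕ} (ha : a ≠ 0)
    (hb : b ≠ 0) : (Ideal.span {w * (x ^ a * y ^ b)}).radical = Ideal.span {x * y} := by
  apply le_antisymm
  · rintro z ⟨n, hz⟩
    rw [Ideal.mem_span_singleton] at hz ⊢
    obtain ⟨c, rfl⟩ : x ∣ z := hx.dvd_of_dvd_pow
      (((dvd_pow_self x ha).mul_right _).mul_left _ |>.trans hz)
    obtain ⟨d, rfl⟩ : y ∣ c := (hy.dvd_or_dvd (hy.dvd_of_dvd_pow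
      (((dvd_pow_self y hb).mul_left _).mul_left _ |>.trans hz))).resolve_left hyx
    exact ⟨d, by ring⟩
  · rw [Ideal.span_singleton_le_iff_mem]
    refine ⟨a + b, ?_⟩
    rw [Ideal.span_singleton_mul_left_unit hw, Ideal.mem_span_singleton, mul_pow, pow_add,
      pow_add y]
    exact mul_dvd_mul (dvd_mul_right _ _) (dvd_mul_left _ _)

end RegularQuotient

section SpecialFiber

variable {R : Type u} [CommRing R] [IsDomain R] [IsDiscreteValuationRing R] {π : R}
  (hπ : Irreducible π) {A : Type v} [CommRing A] [Algebra R A]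

include hπ

theorem specialFiberIdeal_eq_span : specialFiberIdeal R A = Ideal.span {algebraMap R A π} := by
  rw [specialFiberIdeal, hπ.maximalIdeal_eq, Ideal.map_span, Set.image_singleton]

theorem isVertical_iff {p : PrimeSpectrum A} : IsVertical R p ↔ algebraMap R A π ∈ p.asIdeal := by
  rw [IsVertical, specialFiberIdeal_eq_span hπ, Ideal.span_singleton_le_iff_mem]

variable [IsDomain A] [IsLocalRing A] [IsNoetherianRing A]

/-- In terms of parameters with `π = w * x ^ a * y ^ b`, the closed point is non-nodal if and only
if one of the exponents vanishes. -/
theorem isNonNodal_iff {x y w : A} (h : IsParamPair x y) (hw : IsUnit w) {a b : ℕ}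
    (hab : 0 < a + b) (hπA : algebraMap R A π = w * (x ^ a * y ^ b)) :
    IsNonNodal R A ↔ a = 0 ∨ b = 0 := by
  rw [IsNonNodal, specialFiberIdeal_eq_span hπ, hπA]
  rcases Nat.eq_zero_or_pos a with rfl | ha
  · rw [pow_zero, one_mul, Ideal.radical_span_unit_mul_pow h.prime_right hw (by omega)]
    exact ⟨fun _ ↦ Or.inl rfl, fun _ ↦ h.symm.isRegularLocalRing_quotient⟩
  rcases Nat.eq_zero_or_pos b with rfl | hb
  · rw [pow_zero, mul_one, Ideal.radical_span_unit_mul_pow h.prime_left hw (by omega)]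
    exact ⟨fun _ ↦ Or.inr rfl, fun _ ↦ h.isRegularLocalRing_quotient⟩
  rw [Ideal.radical_span_unit_mul_pow_mul_pow h.prime_left h.prime_right h.not_dvd' hw ha.ne' hb.ne']
  exact ⟨fun h1 ↦ absurd h1 h.not_isRegularLocalRing_quotient_mul, fun h1 ↦ by omega⟩

end SpecialFiber

namespace IsCyclicCover.IsRadicalPair

variable {R : Type u} [CommRing R] [IsDomain R] [IsDiscreteValuationRing R]
  [IsAdicComplete (maximalIdeal R) R] {π : R}
  (hπ : Irreducible π) {A B : Type v} [CommRing A] [CommRing B] [Algebra R A] [Algebra R B]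
  [Algebra A B] [IsScalarTower R A B] [IsDomain A] [IsDomain B] [IsLocalRing A] [IsLocalRing B]
  [IsNoetherianRing A] [IsNoetherianRing B] [IsAdicComplete (maximalIdeal B) B]
  {τ : B ≃ₐ[A] B} {δ : ℕ} {X Y : A} {x y : B} {n₁ n₂ : ℕ}
  (hp : IsRadicalPair τ δ X Y x y n₁ n₂) (hdim : 2 ≤ ringKrullDim B)

include hp hdim

theorem isParamPair : IsParamPair x y := .of_span_eq hdim hp.span_eq

theorem isRegularLocalRing : IsRegularLocalRing B := .of_maximalIdeal_eq_span_pair hdim hp.span_eq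

include hπ

theorem hasNormalCrossings
    (hres : Function.Surjective ((Ideal.Quotient.mk (maximalIdeal B)).comp (algebraMap R B)))
    (hδ : 0 < δ) {w : A} (hw : IsUnit w) {a b : ℕ} (hab : 0 < a + b)
    (hπA : algebraMap R A π = w * (X ^ a * Y ^ b)) : HasNormalCrossings R π B := by
  have hn1 : 0 < n₁ := Nat.pos_of_ne_zero (by rintro rfl; have := hp.mul_eq; omega)
  have hn2 : 0 < n₂ := Nat.pos_of_ne_zero (by rintro rfl; have := hp.mul_eq; omega)
  refine HasNormalCrossings.of_isParamPair (a := n₁ * a) (b := n₂ * b) hπ hres (hp.isParamPair hdim)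
    (hw.map (algebraMap A B)) ?_ ?_
  · rcases Nat.eq_zero_or_pos a with rfl | ha
    · have := Nat.mul_pos hn2 (show 0 < b by omega)
      omega
    · have := Nat.mul_pos hn1 ha
      omega
  · rw [IsScalarTower.algebraMap_apply R A B, hπA, map_mul, map_mul, map_pow, map_pow, hp.left_eq,
      hp.right_eq, pow_mul, pow_mul]

theorem isNonNodal (hXY : IsParamPair X Y) (hδ : 0 < δ) {w : A} (hw : IsUnit w) {a b : ℕ}
    (hab : 0 < a + b)
    (hπA : algebraMap R A π = w * (X ^ a * Y ^ b)) (h : IsNonNodal R A) : IsNonNodal R B := by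
  have hn1 : 0 < n₁ := Nat.pos_of_ne_zero (by rintro rfl; have := hp.mul_eq; omega)
  have hn2 : 0 < n₂ := Nat.pos_of_ne_zero (by rintro rfl; have := hp.mul_eq; omega)
  rw [isNonNodal_iff hπ hXY hw hab hπA] at h
  rw [isNonNodal_iff (a := n₁ * a) (b := n₂ * b) hπ (hp.isParamPair hdim)
    (hw.map (algebraMap A B))]
  · rcases h with rfl | rfl <;> simp
  · rcases Nat.eq_zero_or_pos a with rfl | ha
    · have := Nat.mul_pos hn2 (show 0 < b by omega)
      omega
    · have := Nat.mul_pos hn1 ha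
      omega
  · rw [IsScalarTower.algebraMap_apply R A B, hπA, map_mul, map_mul, map_pow, map_pow, hp.left_eq,
      hp.right_eq, pow_mul, pow_mul]

end IsCyclicCover.IsRadicalPair

section HorizontalDegree

variable {R : Type*} [CommRing R] [IsDomain R] [IsDiscreteValuationRing R] {π : R}
  (hπ : Irreducible π) (K : Type*) [Field K] [Algebra R K] [IsFractionRing R K]
  {D : Type*} [CommRing D] [IsDomain D] [Algebra R D]

theorem faithfulSMul_of_algebraMap_ne_zero (hπ : Irreducible π) (h0 : algebraMap R D π ≠ 0) :
    FaithfulSMul R D := by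
  rw [faithfulSMul_iff_algebraMap_injective, injective_iff_map_eq_zero]
  intro r hr
  by_contra hr0
  obtain ⟨n, hn⟩ := IsDiscreteValuationRing.associated_pow_irreducible hr0 hπ
  have h1 : algebraMap R D r ∣ algebraMap R D (π ^ n) := map_dvd _ hn.dvd
  rw [hr, zero_dvd_iff, map_pow] at h1
  exact pow_ne_zero n h0 h1

include hπ in
theorem surjective_algebraMap_of_finrank_eq_one (h0 : algebraMap R D π ≠ 0)
    (hu : ¬ IsUnit (algebraMap R D π)) (h : Module.finrank K (K ⊗[R] D) = 1) :
    Function.Surjective (algebraMap R D) := by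
  have := faithfulSMul_of_algebraMap_ne_zero hπ h0
  have hinj : Function.Injective (Algebra.TensorProduct.includeRight : D →ₐ[R] K ⊗[R] D) :=
    Algebra.TensorProduct.includeRight_injective (IsFractionRing.injective R K)
  have h1 : (1 : K ⊗[R] D) ≠ 0 := by
    rw [← map_one (Algebra.TensorProduct.includeRight : D →ₐ[R] K ⊗[R] D), Ne,
      map_eq_zero_iff _ hinj]
    exact one_ne_zero
  rw [finrank_eq_one_iff_of_nonzero' _ h1] at h
  intro d
  obtain ⟨c, hc⟩ := h (1 ⊗ₜ d)
  obtain ⟨r, s, hs, rfl⟩ := IsFractionRing.div_surjective (A := R) c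
  have hs0 : s ≠ 0 := nonZeroDivisors.ne_zero hs
  have hsK : algebraMap R K s ≠ 0 := (map_ne_zero_iff _ (IsFractionRing.injective R K)).2 hs0
  have h2 : algebraMap R D r = algebraMap R D s * d := by
    apply hinj
    rw [map_mul, AlgHom.commutes, AlgHom.commutes]
    change _ = _ * (1 ⊗ₜ d)
    rw [← hc, IsScalarTower.algebraMap_apply R K (K ⊗[R] D),
      IsScalarTower.algebraMap_apply R K (K ⊗[R] D), Algebra.smul_def, ← mul_assoc, ← map_mul,
      mul_div_cancel₀ _ hsK, mul_one]
  rcases ValuationRing.dvd_total s r with ⟨t, rfl⟩ | ⟨t, rfl⟩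
  · refine ⟨t, mul_left_cancel₀ (a := algebraMap R D s) ?_ (by rw [← map_mul, h2])⟩
    exact (map_ne_zero_iff _ (FaithfulSMul.algebraMap_injective R D)).2 hs0
  · have hr0 : algebraMap R D r ≠ 0 := (map_ne_zero_iff _
      (FaithfulSMul.algebraMap_injective R D)).2 (left_ne_zero_of_mul hs0)
    have h3 : algebraMap R D t * d = 1 := by
      refine mul_left_cancel₀ hr0 ?_
      rw [mul_one, ← mul_assoc, ← map_mul, h2]
    have ht : IsUnit t := by
      by_contra ht
      rw [← mem_nonunits_iff, ← mem_maximalIdeal, hπ.maximalIdeal_eq,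
        Ideal.mem_span_singleton] at ht
      exact hu (isUnit_of_dvd_unit (map_dvd _ ht) (IsUnit.of_mul_eq_one _ h3))
    obtain ⟨t', ht'⟩ := ht.exists_right_inv
    refine ⟨t', ?_⟩
    have h4 := congrArg (algebraMap R D) ht'
    rw [map_mul, map_one] at h4
    linear_combination d * h4 - algebraMap R D t' * h3

instance isPrecomplete_pi {R : Type*} [CommRing R] (I : Ideal R) [IsPrecomplete I R] (n : ℕ) :
    IsPrecomplete I (Fin n → R) := by
  have hmem (m : ℕ) (x : Fin n → R) :
      x ∈ (I ^ m • ⊤ : Submodule R (Fin n → R)) ↔ ∀ i, x i ∈ I ^ m := by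
    constructor
    · intro hx i
      induction hx using Submodule.smul_induction_on' with
      | smul r hr y hy => exact Ideal.mul_mem_right _ _ hr
      | add y _ z _ hy hz => exact Ideal.add_mem _ hy hz
    · intro hx
      rw [pi_eq_sum_univ x]
      exact Submodule.sum_mem _ fun i _ ↦ Submodule.smul_mem_smul (hx i) trivial
  refine ⟨fun f hf ↦ ?_⟩
  have hfi (i : Fin n) := IsPrecomplete.prec' (I := I) (fun m ↦ f m i) fun {a b} hab ↦ by
    have := hf hab
    rw [SModEq.sub_mem, hmem] at this
    rw [SModEq.sub_mem, smul_eq_mul, Ideal.mul_top]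
    exact this i
  choose L hL using hfi
  refine ⟨L, fun m ↦ ?_⟩
  rw [SModEq.sub_mem, hmem]
  intro i
  have := hL i m
  rwa [SModEq.sub_mem, smul_eq_mul, Ideal.mul_top] at this

include hπ in
/-- A totally ramified extension of a complete discrete valuation ring: if the uniformizer `π` of
`R` is a unit times the `v`-th power of the uniformizer `y` of `D`, then `D` has degree `v`. -/
theorem finrank_eq_of_algebraMap_eq_unit_mul_pow [IsAdicComplete (maximalIdeal R) R]
    [IsLocalRing D] [IsNoetherianRing D] {y u : D} (hy : maximalIdeal D = Ideal.span {y})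
    (hu : IsUnit u) {v : ℕ} (h0 : algebraMap R D π ≠ 0)
    (hv : algebraMap R D π = u * y ^ v) (hv0 : v ≠ 0)
    (hres : ∀ d : D, ∃ r : R, d - algebraMap R D r ∈ maximalIdeal D) :
    Module.finrank K (K ⊗[R] D) = v := by
  have := faithfulSMul_of_algebraMap_ne_zero hπ h0
  have hy0 : y ≠ 0 := by
    rintro rfl
    rw [zero_pow hv0, mul_zero] at hv
    exact h0 hv
  have hyu : ¬ IsUnit y := by
    have : y ∈ maximalIdeal D := hy ▸ Ideal.mem_span_singleton_self y
    exact this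
  have hπm : (maximalIdeal R).map (algebraMap R D) = Ideal.span {y ^ v} := by
    rw [hπ.maximalIdeal_eq, Ideal.map_span, Set.image_singleton, hv,
      Ideal.span_singleton_mul_left_unit hu]
  let f : (Fin v → R) →ₗ[R] D := Fintype.linearCombination R fun i : Fin v ↦ y ^ (i : ℕ)
  have hf (r : Fin v → R) : f r = ∑ i, algebraMap R D (r i) * y ^ (i : ℕ) := by
    simp [f, Fintype.linearCombination_apply, Algebra.smul_def]
  have hinj0 (r : Fin v → R) (hr : f r = 0) : ∀ i, r i ∈ maximalIdeal R := by
    rintro ⟨i, hi⟩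
    induction i using Nat.strong_induction_on with
    | _ i ih =>
    by_contra hn
    have hunit : IsUnit (r ⟨i, hi⟩) := by
      rwa [mem_maximalIdeal, mem_nonunits_iff, not_not] at hn
    have h1 : y ^ (i + 1) ∣ algebraMap R D (r ⟨i, hi⟩) * y ^ i := by
      rw [hf, ← Finset.add_sum_erase _ _ (Finset.mem_univ (⟨i, hi⟩ : Fin v))] at hr
      rw [eq_neg_of_add_eq_zero_left hr, dvd_neg]
      refine Finset.dvd_sum fun j hj ↦ ?_
      have hji : (j : ℕ) ≠ i := fun h ↦ by simp [Fin.ext_iff, h] at hj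
      rcases lt_or_gt_of_ne hji with hlt | hgt
      · have h2 := ih j hlt j.2
        rw [hπ.maximalIdeal_eq, Ideal.mem_span_singleton] at h2
        have h3 := map_dvd (algebraMap R D) h2
        rw [hv] at h3
        exact (((pow_dvd_pow y hi).mul_left u).trans h3).mul_right _
      · exact (pow_dvd_pow y hgt).mul_left _
    rw [(hunit.map (algebraMap R D)).dvd_mul_left, pow_dvd_pow_iff hy0 hyu] at h1
    omega
  have hinjn (n : ℕ) : ∀ r : Fin v → R, f r = 0 → ∀ i, r i ∈ maximalIdeal R ^ n := by
    induction n with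
    | zero => simp
    | succ n ih =>
      intro r hr
      have h1 := hinj0 r hr
      simp only [hπ.maximalIdeal_eq, Ideal.mem_span_singleton] at h1
      choose s hs using h1
      have h2 : f s = 0 := by
        have : f r = algebraMap R D π * f s := by
          rw [← Algebra.smul_def, ← map_smul]
          congr 1
          ext i
          exact hs i
        rw [hr] at this
        exact (mul_eq_zero.1 this.symm).resolve_left h0
      intro i
      rw [hs i, pow_succ']
      exact Ideal.mul_mem_mul (hπ.maximalIdeal_eq ▸ Ideal.mem_span_singleton_self π) (ih s h2 i)
  have hinj : Function.Injective f := by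
    rw [injective_iff_map_eq_zero]
    intro r hr
    ext i
    have := Ideal.iInf_pow_eq_bot_of_isLocalRing (maximalIdeal R) (Ideal.IsPrime.ne_top inferInstance)
    rw [Pi.zero_apply, ← Ideal.mem_bot, ← this]
    simpa using fun n ↦ hinjn n r hr i
  have happ (n : ℕ) : ∀ d : D, ∃ (r : ℕ → R) (e : D),
      d = (∑ i ∈ Finset.range n, algebraMap R D (r i) * y ^ i) + y ^ n * e := by
    intro d
    induction n with
    | zero => exact ⟨0, d, by simp⟩
    | succ n ih =>
      obtain ⟨r, e, he⟩ := ih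
      obtain ⟨s, hs⟩ := hres e
      rw [hy, Ideal.mem_span_singleton] at hs
      obtain ⟨e', he'⟩ := hs
      refine ⟨Function.update r n s, e', ?_⟩
      rw [Finset.sum_range_succ, Function.update_self, Finset.sum_congr rfl fun i hi ↦ by
        rw [Function.update_of_ne (Finset.mem_range.1 hi).ne], he]
      linear_combination y ^ n * he'
  have hsurj : Function.Surjective f := by
    have : IsHausdorff (maximalIdeal R) D := ⟨fun d hd ↦ by
      have := Ideal.iInf_pow_eq_bot_of_isLocalRing (maximalIdeal D)
        (Ideal.IsPrime.ne_top inferInstance)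
      rw [← Ideal.mem_bot, ← this, Ideal.mem_iInf]
      intro n
      have h1 := hd n
      rw [SModEq.zero, Ideal.smul_top_eq_map, Submodule.restrictScalars_mem, Ideal.map_pow] at h1
      refine Ideal.pow_right_mono ?_ n h1
      rw [hπm, hy, Ideal.span_singleton_le_iff_mem]
      exact Ideal.pow_mem_of_mem _ (Ideal.mem_span_singleton_self y) _ (Nat.pos_of_ne_zero hv0)⟩
    refine surjective_of_mkQ_comp_surjective (I := maximalIdeal R) fun c ↦ ?_
    obtain ⟨d, rfl⟩ := Submodule.mkQ_surjective _ c
    obtain ⟨r, e, he⟩ := happ v d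
    refine ⟨fun i ↦ r i, ?_⟩
    rw [LinearMap.comp_apply, ← sub_eq_zero, ← map_sub, Submodule.mkQ_apply,
      Submodule.Quotient.mk_eq_zero, Ideal.smul_top_eq_map, Submodule.restrictScalars_mem, hπm,
      Ideal.mem_span_singleton, hf, he, Finset.sum_range]
    exact ⟨-e, by ring⟩
  let b : Module.Basis (Fin v) R D := .ofEquivFun (LinearEquiv.ofBijective f ⟨hinj, hsurj⟩).symm
  rw [Module.finrank_eq_card_basis (b.baseChange K), Fintype.card_fin]

variable {A : Type*} [CommRing A] [IsDomain A] [IsLocalRing A] [Algebra R A]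
  {p : PrimeSpectrum A} {X : A} (hp : p.asIdeal = Ideal.span {X})
  (hπm : algebraMap R A π ∈ maximalIdeal A) (hXπ : ¬ X ∣ algebraMap R A π)

include hπ hp hπm hXπ

theorem maximalIdeal_eq_span_of_horizontalDegree_eq_one (h : horizontalDegree R K p = 1) :
    maximalIdeal A = Ideal.span {X, algebraMap R A π} := by
  have h0 : algebraMap R (A ⧸ p.asIdeal) π ≠ 0 := by
    rw [IsScalarTower.algebraMap_apply R A, Ideal.Quotient.algebraMap_eq, Ne,
      Ideal.Quotient.eq_zero_iff_mem, hp, Ideal.mem_span_singleton]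
    exact hXπ
  have hle : p.asIdeal ≤ maximalIdeal A := IsLocalRing.le_maximalIdeal p.isPrime.ne_top
  have hu : ¬ IsUnit (algebraMap R (A ⧸ p.asIdeal) π) := by
    intro hu
    obtain ⟨c, hc⟩ := hu.exists_right_inv
    obtain ⟨c, rfl⟩ := Ideal.Quotient.mk_surjective c
    rw [IsScalarTower.algebraMap_apply R A, Ideal.Quotient.algebraMap_eq, ← map_mul,
      ← map_one (Ideal.Quotient.mk p.asIdeal), Ideal.Quotient.eq] at hc
    have := Ideal.sub_mem _ (Ideal.mul_mem_right c _ hπm) (hle hc)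
    rw [sub_sub_cancel] at this
    exact this isUnit_one
  have hsurj := surjective_algebraMap_of_finrank_eq_one hπ K h0 hu h
  apply le_antisymm
  · intro a ha
    obtain ⟨r, hr⟩ := hsurj (Ideal.Quotient.mk _ a)
    rw [IsScalarTower.algebraMap_apply R A, Ideal.Quotient.algebraMap_eq, Ideal.Quotient.eq] at hr
    have h1 : algebraMap R A r ∈ maximalIdeal A := by
      have := Ideal.add_mem _ (hle hr) ha
      rwa [sub_add_cancel] at this
    have h2 : r ∈ maximalIdeal R := by
      rw [mem_maximalIdeal, mem_nonunits_iff] at h1 ⊢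
      exact fun hu ↦ h1 (hu.map _)
    rw [hπ.maximalIdeal_eq, Ideal.mem_span_singleton] at h2
    obtain ⟨s, rfl⟩ := h2
    rw [hp, Ideal.mem_span_singleton] at hr
    obtain ⟨c, hc⟩ := hr
    rw [Ideal.mem_span_pair]
    rw [map_mul] at hc
    exact ⟨-c, algebraMap R A s, by linear_combination hc⟩
  · rw [Ideal.span_le]
    rintro z (rfl | rfl)
    · exact hle (hp ▸ Ideal.mem_span_singleton_self z)
    · exact hπm

theorem horizontalDegree_eq_of_isParamPair [IsAdicComplete (maximalIdeal R) R] [IsNoetherianRing A]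
    (hres : Function.Surjective ((Ideal.Quotient.mk (maximalIdeal A)).comp (algebraMap R A)))
    {Y u c : A} (h : IsParamPair X Y) (hu : IsUnit u) {v : ℕ}
    (hv : algebraMap R A π = u * Y ^ v + c * X) : horizontalDegree R K p = v := by
  have h0 : algebraMap R (A ⧸ p.asIdeal) π ≠ 0 := by
    rw [IsScalarTower.algebraMap_apply R A, Ideal.Quotient.algebraMap_eq, Ne,
      Ideal.Quotient.eq_zero_iff_mem, hp, Ideal.mem_span_singleton]
    exact hXπ
  have hle : p.asIdeal ≤ maximalIdeal A := IsLocalRing.le_maximalIdeal p.isPrime.ne_top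
  have : IsLocalRing (A ⧸ p.asIdeal) :=
    IsLocalRing.of_surjective' (Ideal.Quotient.mk p.asIdeal) Ideal.Quotient.mk_surjective
  have : IsLocalHom (Ideal.Quotient.mk p.asIdeal) :=
    IsLocalHom.of_surjective _ Ideal.Quotient.mk_surjective
  have hX0 : Ideal.Quotient.mk p.asIdeal X = 0 := by
    rw [Ideal.Quotient.eq_zero_iff_mem, hp]
    exact Ideal.mem_span_singleton_self X
  have hmap : (maximalIdeal A).map (Ideal.Quotient.mk p.asIdeal) =
      maximalIdeal (A ⧸ p.asIdeal) := by
    have h1 : (maximalIdeal (A ⧸ p.asIdeal)).comap (Ideal.Quotient.mk p.asIdeal) =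
        maximalIdeal A :=
      ((IsLocalRing.local_hom_TFAE (Ideal.Quotient.mk p.asIdeal)).out 0 4).1 this
    rw [← h1, Ideal.map_comap_of_surjective _ Ideal.Quotient.mk_surjective]
  refine finrank_eq_of_algebraMap_eq_unit_mul_pow hπ K (y := Ideal.Quotient.mk _ Y)
    (u := Ideal.Quotient.mk _ u) ?_ (hu.map _) h0 ?_ ?_ ?_
  · rw [← hmap, h.span_eq, Ideal.map_span, Set.image_pair, hX0, Ideal.span_insert_zero]
  · rw [IsScalarTower.algebraMap_apply R A, Ideal.Quotient.algebraMap_eq, hv, map_add, map_mul,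
      map_mul, map_pow, hX0, mul_zero, add_zero]
  · rintro rfl
    rw [pow_zero, mul_one] at hv
    have := Ideal.sub_mem _ hπm (Ideal.mul_mem_left _ c h.left_mem)
    rw [hv, add_sub_cancel_right] at this
    exact this hu
  · intro d
    obtain ⟨a, rfl⟩ := Ideal.Quotient.mk_surjective d
    obtain ⟨r, hr⟩ := hres (Ideal.Quotient.mk _ a)
    refine ⟨r, ?_⟩
    rw [RingHom.comp_apply, eq_comm, Ideal.Quotient.eq] at hr
    rw [IsScalarTower.algebraMap_apply R A, Ideal.Quotient.algebraMap_eq, ← map_sub, ← hmap]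
    exact Ideal.mem_map_of_mem _ hr

end HorizontalDegree

namespace IsParamPair

variable {S : Type*} [CommRing S] [IsLocalRing S] {x y : S} (h : IsParamPair x y)

include h

theorem exists_eq_of_mem_sq {z : S} (hz : z ∈ maximalIdeal S ^ 2) :
    ∃ a ∈ maximalIdeal S, ∃ b ∈ maximalIdeal S, z = a * x + b * y := by
  rw [sq] at hz
  nth_rw 2 [h.span_eq] at hz
  rw [Ideal.span_insert, Ideal.mul_sup, Submodule.mem_sup] at hz
  obtain ⟨_, h1, _, h2, rfl⟩ := hz
  obtain ⟨a, ha, rfl⟩ := Ideal.mem_mul_span_singleton.1 h1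
  obtain ⟨b, hb, rfl⟩ := Ideal.mem_mul_span_singleton.1 h2
  exact ⟨a, ha, b, hb, rfl⟩

theorem left_notMem_sq : x ∉ maximalIdeal S ^ 2 := by
  intro hx
  obtain ⟨a, ha, b, hb, e⟩ := h.exists_eq_of_mem_sq hx
  exact (h.isUnit_of_eq h e).elim ha hb

theorem eq_or_maximalIdeal_le [IsNoetherianRing S] {I : Ideal S} [hI : I.IsPrime] (hx : x ∈ I) :
    I = Ideal.span {x} ∨ maximalIdeal S ≤ I := by
  by_cases hle : I ≤ Ideal.span {x}
  · exact Or.inl (le_antisymm hle ((Ideal.span_singleton_le_iff_mem I).2 hx))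
  · right
    obtain ⟨f, hf, hfx⟩ := Set.not_subset.1 hle
    rw [SetLike.mem_coe, Ideal.mem_span_singleton] at hfx
    obtain ⟨k, u, c, hu, rfl⟩ := h.exists_eq_unit_mul_pow_add hfx
    have h1 : u * y ^ k ∈ I := by
      have := Ideal.sub_mem _ hf (Ideal.mul_mem_left _ c hx)
      rwa [add_sub_cancel_right] at this
    have h2 : y ∈ I := hI.mem_of_pow_mem k ((hI.mul_mem_left_iff (fun hu' ↦
      hI.ne_top (Ideal.eq_top_of_isUnit_mem _ hu' hu))).1 h1)
    rw [h.span_eq, Ideal.span_le]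
    rintro z (rfl | rfl)
    exacts [hx, h2]

/-- If `ε₁ * x ^ N + ε₂ * y ^ M` with `N < M` is divisible by the parameter `t`, then `x` is
congruent to a multiple of `t` modulo the square of the maximal ideal. -/
theorem exists_eq_of_dvd_add [IsNoetherianRing S] {t s ε₁ ε₂ : S} (ht : IsParamPair t s)
    (hε₁ : IsUnit ε₁) {N M : ℕ} (hNM : N < M) (hd : t ∣ ε₁ * x ^ N + ε₂ * y ^ M) :
    ∃ r c, x = r * s ^ 2 + c * t := by
  by_cases hx : t ∣ x
  · obtain ⟨c, rfl⟩ := hx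
    exact ⟨0, c, by ring⟩
  obtain ⟨k, u, c, hu, hxe⟩ := ht.exists_eq_unit_mul_pow_add hx
  rcases Nat.lt_or_ge 1 k with hk | hk
  · obtain ⟨j, rfl⟩ := Nat.exists_eq_add_of_lt hk
    exact ⟨u * s ^ j, c, by rw [hxe]; ring⟩
  exfalso
  obtain rfl : k = 1 := by
    rcases Nat.eq_zero_or_pos k with rfl | h0
    · rw [pow_zero, mul_one] at hxe
      have := Ideal.sub_mem _ h.left_mem (Ideal.mul_mem_left _ c ht.left_mem)
      rw [hxe, add_sub_cancel_right] at this
      exact absurd hu this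
    · omega
  obtain ⟨c', a, hye⟩ := ht.exists_eq h.right_mem
  have h1 : t ∣ x ^ N - (u * s) ^ N :=
    (Dvd.intro_left c (by rw [hxe]; ring)).trans (sub_dvd_pow_sub_pow x (u * s) N)
  have h2 : t ∣ y ^ M - (a * s) ^ M :=
    (Dvd.intro_left c' (by rw [hye]; ring)).trans (sub_dvd_pow_sub_pow y (a * s) M)
  obtain ⟨j, rfl⟩ := Nat.exists_eq_add_of_lt hNM
  have h3 : t ∣ s ^ N * (ε₁ * u ^ N + ε₂ * a ^ (N + j + 1) * s ^ (j + 1)) := by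
    obtain ⟨d₁, hd₁⟩ := h1
    obtain ⟨d₂, hd₂⟩ := h2
    obtain ⟨d, hd⟩ := hd
    refine ⟨d - ε₁ * d₁ - ε₂ * d₂, ?_⟩
    rw [mul_pow] at hd₁ hd₂
    rw [show N + j + 1 = N + (j + 1) by ring, pow_add s] at hd₂
    rw [show N + j + 1 = N + (j + 1) by ring] at hd ⊢
    linear_combination hd - ε₁ * hd₁ - ε₂ * hd₂
  rcases ht.prime_left.dvd_or_dvd h3 with h4 | h4
  · exact ht.not_dvd (ht.prime_left.dvd_of_dvd_pow h4)
  · have h5 : ε₁ * u ^ N + ε₂ * a ^ (N + j + 1) * s ^ (j + 1) ∈ maximalIdeal S :=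
      Ideal.mem_of_dvd _ h4 ht.left_mem
    have h6 := Ideal.sub_mem _ h5 (Ideal.mul_mem_left _ (ε₂ * a ^ (N + j + 1))
      (Ideal.pow_mem_of_mem _ ht.right_mem _ j.succ_pos))
    rw [add_sub_cancel_right] at h6
    exact h6 (hε₁.mul (hu.pow N))

theorem not_lt_of_mul_eq_add [IsNoetherianRing S] {t s w ε₁ ε₂ : S} (ht : IsParamPair t s)
    (hε₁ : IsUnit ε₁) {N M : ℕ}
    (he : w * (t * s) = ε₁ * x ^ N + ε₂ * y ^ M) : ¬ N < M := by
  intro hNM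
  obtain ⟨r, c, h1⟩ := h.exists_eq_of_dvd_add ht hε₁ hNM ⟨w * s, by rw [← he]; ring⟩
  obtain ⟨r', c', h2⟩ := h.exists_eq_of_dvd_add ht.symm hε₁ hNM ⟨w * t, by rw [← he]; ring⟩
  have hc : c ∈ maximalIdeal S := by
    have h3 : s ∣ t * (c - r' * t) := ⟨c' - r * s, by linear_combination h2 - h1⟩
    have h4 := (ht.prime_right.dvd_or_dvd h3).resolve_left ht.not_dvd'
    have := Ideal.add_mem _ (Ideal.mem_of_dvd _ h4 ht.right_mem)
      (Ideal.mul_mem_left _ r' ht.left_mem)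
    rwa [sub_add_cancel] at this
  apply h.left_notMem_sq
  rw [h1, sq (maximalIdeal S)]
  refine Ideal.add_mem _ (Ideal.mul_mem_left _ _ ?_) (Ideal.mul_mem_mul hc ht.left_mem)
  rw [sq]
  exact Ideal.mul_mem_mul ht.right_mem ht.right_mem

theorem unit_mul_mul_notMem_cube [IsDomain S] {w : S} (hw : IsUnit w) :
    w * (x * y) ∉ maximalIdeal S ^ 3 := by
  intro hm
  rw [pow_succ] at hm
  nth_rw 2 [h.span_eq] at hm
  rw [Ideal.span_insert, Ideal.mul_sup, Submodule.mem_sup] at hm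
  obtain ⟨_, h1, _, h2, e⟩ := hm
  obtain ⟨p, hp, rfl⟩ := Ideal.mem_mul_span_singleton.1 h1
  obtain ⟨q, hq, rfl⟩ := Ideal.mem_mul_span_singleton.1 h2
  obtain ⟨q', rfl⟩ : x ∣ q := (h.prime_left.dvd_or_dvd (b := y)
    ⟨w * y - p, by linear_combination e⟩).resolve_right h.not_dvd
  have hq' : q' ∈ maximalIdeal S := by
    obtain ⟨a, ha, b, hb, e'⟩ := h.exists_eq_of_mem_sq hq
    obtain ⟨r, rfl⟩ : x ∣ b := (h.prime_left.dvd_or_dvd (b := y)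
      ⟨q' - a, by linear_combination -e'⟩).resolve_right h.not_dvd
    have : q' = a + r * y := mul_left_cancel₀ h.prime_left.ne_zero (by linear_combination e')
    rw [this]
    exact Ideal.add_mem _ ha (Ideal.mul_mem_left _ _ h.right_mem)
  have h3 : (w - q') * y = p := mul_left_cancel₀ h.prime_left.ne_zero (by linear_combination -e)
  have hu : IsUnit (w - q') := by
    by_contra hu
    have := Ideal.add_mem _ ((mem_maximalIdeal _).2 hu) hq'
    rw [sub_add_cancel] at this
    exact this hw
  apply h.symm.left_notMem_sq
  rw [← Ideal.unit_mul_mem_iff_mem _ hu, h3]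
  exact hp

/-- The curve `ε₁ * x ^ N + ε₂ * y ^ M = 0` on a regular surface has normal crossings only if
it is smooth or a node. -/
theorem eq_one_or_of_normalCrossings [IsDomain S] [IsNoetherianRing S] {t s w ε₁ ε₂ : S} (ht : IsParamPair t s) (hw : IsUnit w) (hε₁ : IsUnit ε₁) (hε₂ : IsUnit ε₂)
    {N M a b : ℕ} (hN : 0 < N) (hM : 0 < M) (hab : 0 < a + b) (ha : a ≤ 1) (hb : b ≤ 1)
    (he : w * (t ^ a * s ^ b) = ε₁ * x ^ N + ε₂ * y ^ M) :
    N = 1 ∨ M = 1 ∨ (N = 2 ∧ M = 2) := by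
  by_contra! hn
  have hN2 : 2 ≤ N := by omega
  have hM2 : 2 ≤ M := by omega
  have hsq : w * (t ^ a * s ^ b) ∈ maximalIdeal S ^ 2 := by
    rw [he]
    exact Ideal.add_mem _
      (Ideal.mul_mem_left _ _ (Ideal.pow_le_pow_right hN2 (Ideal.pow_mem_pow h.left_mem _)))
      (Ideal.mul_mem_left _ _ (Ideal.pow_le_pow_right hM2 (Ideal.pow_mem_pow h.right_mem _)))
  rw [Ideal.unit_mul_mem_iff_mem _ hw] at hsq
  obtain ⟨rfl, rfl⟩ | ⟨rfl, rfl⟩ | ⟨rfl, rfl⟩ : (a = 1 ∧ b = 0) ∨ (a = 0 ∧ b = 1) ∨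
    (a = 1 ∧ b = 1) := by omega
  · rw [pow_one, pow_zero, mul_one] at hsq
    exact ht.left_notMem_sq hsq
  · rw [pow_one, pow_zero, one_mul] at hsq
    exact ht.symm.left_notMem_sq hsq
  rw [pow_one, pow_one] at he
  have h1 := h.not_lt_of_mul_eq_add ht hε₁ he
  have h2 := h.symm.not_lt_of_mul_eq_add ht hε₂ (he.trans (add_comm _ _))
  obtain rfl : N = M := by omega
  apply ht.unit_mul_mul_notMem_cube hw
  have hN3 : 3 ≤ N := by omega
  rw [he]
  exact Ideal.add_mem _
    (Ideal.mul_mem_left _ _ (Ideal.pow_le_pow_right hN3 (Ideal.pow_mem_pow h.left_mem _)))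
    (Ideal.mul_mem_left _ _ (Ideal.pow_le_pow_right hN3 (Ideal.pow_mem_pow h.right_mem _)))

end IsParamPair

/-- Two-dimensional regular local rings `A → B` where `B` is spanned over `A` by monomials in
parameters `x, y` whose powers `X = x ^ n`, `Y = y ^ m` are parameters of `A`. -/
structure IsTameRadicalExtension {A B : Type*} [CommRing A] [CommRing B] [Algebra A B]
    [IsLocalRing A] [IsLocalRing B] (X Y : A) (x y : B) (n m : ℕ) : Prop where
  isParamPair_base : IsParamPair X Y
  isParamPair : IsParamPair x y
  left_eq : algebraMap A B X = x ^ n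
  right_eq : algebraMap A B Y = y ^ m
  span_eq_top : Submodule.span A (Set.range fun p : ℕ × ℕ ↦ x ^ p.1 * y ^ p.2) = ⊤
  isUnit_left : IsUnit (n : A)
  isUnit_right : IsUnit (m : A)

namespace IsTameRadicalExtension

variable {A B : Type*} [CommRing A] [CommRing B] [Algebra A B]
    [IsLocalRing A] [IsLocalRing B] {X Y : A} {x y : B} {n m : ℕ}
    (h : IsTameRadicalExtension X Y x y n m)

include h

theorem symm : IsTameRadicalExtension Y X y x m n := by
  refine ⟨h.isParamPair_base.symm, h.isParamPair.symm, h.right_eq, h.left_eq, ?_, h.isUnit_right,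
    h.isUnit_left⟩
  rw [eq_top_iff, ← h.span_eq_top, Submodule.span_le]
  rintro _ ⟨p, rfl⟩
  exact Submodule.subset_span ⟨p.swap, mul_comm _ _⟩

theorem left_pos : 0 < n := Nat.pos_of_ne_zero (by
  rintro rfl
  have := h.isUnit_left
  rw [Nat.cast_zero] at this
  exact not_isUnit_zero this)

theorem right_pos : 0 < m := h.symm.left_pos

variable [IsDomain A] [IsDomain B] [IsNoetherianRing A] [IsNoetherianRing B] [Module.Finite A B]
  [FaithfulSMul A B]

theorem isBranchedAt_left (hn : 1 < n) : IsBranchedAt A B X := by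
  obtain ⟨Q, hQ⟩ := h.isParamPair_base.prime_left.exists_liesOver (B := B)
  exact ⟨Q, hQ, not_isUnramifiedAt_of_pow_eq Q.asIdeal h.isParamPair_base.prime_left.ne_zero
    h.left_eq hn hQ⟩

theorem isBranchedAt_iff {q : A} (hq : Prime q) :
    IsBranchedAt A B q ↔ (Associated q X ∧ 1 < n) ∨ (Associated q Y ∧ 1 < m) := by
  have key {Z : A} {z : B} {k : ℕ} (hZ : algebraMap A B Z = z ^ k) (hk : 0 < k) (hZp : Prime Z)
      {Q : Ideal B} (hQ : Q.under A = Ideal.span {q}) (hz : z ∈ Q) : Associated q Z := by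
    apply hq.associated_of_dvd hZp
    rw [← Ideal.mem_span_singleton, ← hQ]
    change algebraMap A B Z ∈ Q
    rw [hZ]
    exact Ideal.pow_mem_of_mem _ hz _ hk
  constructor
  · rintro ⟨Q, hQ, hur⟩
    by_contra! hn
    apply hur
    refine Algebra.isUnramifiedAt_of_span_monomials_eq_top h.span_eq_top h.left_eq h.right_eq
      h.isUnit_left h.isUnit_right Q.asIdeal ?_ ?_
    · by_contra! h1
      have h2 := hn.1 (key h.left_eq h.left_pos h.isParamPair_base.prime_left hQ h1.2)
      have := h.left_pos
      omega
    · by_contra! h1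
      have h2 := hn.2 (key h.right_eq h.right_pos h.isParamPair_base.prime_right hQ h1.2)
      have := h.right_pos
      omega
  · rintro (⟨h1, h2⟩ | ⟨h1, h2⟩)
    · rw [IsBranchedAt, Ideal.span_singleton_eq_span_singleton.2 h1]
      exact h.isBranchedAt_left h2
    · rw [IsBranchedAt, Ideal.span_singleton_eq_span_singleton.2 h1]
      exact h.symm.isBranchedAt_left h2

theorem not_maximalIdeal_le_under {Q : Ideal B} [hQ : Q.IsPrime] {t s : B} (ht : IsParamPair t s)
    (hQt : Q = Ideal.span {t}) : ¬ maximalIdeal A ≤ Q.under A := by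
  intro hle
  have h1 : x ∈ Q := hQ.mem_of_pow_mem n (h.left_eq ▸ hle h.isParamPair_base.left_mem)
  have h2 : y ∈ Q := hQ.mem_of_pow_mem m (h.right_eq ▸ hle h.isParamPair_base.right_mem)
  have h3 : maximalIdeal B ≤ Q := by
    rw [h.isParamPair.span_eq, Ideal.span_le]
    rintro z (rfl | rfl)
    exacts [h1, h2]
  have h4 := h3 ht.right_mem
  rw [hQt, Ideal.mem_span_singleton] at h4
  exact ht.not_dvd h4

theorem ramificationIdx_left {Q : Ideal B} [hQ : Q.IsPrime] (hQX : Q.under A = Ideal.span {X}) :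
    Q.ramificationIdx A = n := by
  have h1 : x ∈ Q := by
    have := mem_of_under_eq_span Q hQX
    rw [h.left_eq] at this
    exact hQ.mem_of_pow_mem n this
  refine ramificationIdx_eq_of_pow_eq Q hQX ?_ h.isParamPair.prime_left.ne_zero h.left_eq
  refine (h.isParamPair.eq_or_maximalIdeal_le h1).resolve_right fun h2 ↦ ?_
  have h3 : Y ∈ Q.under A := by
    change algebraMap A B Y ∈ Q
    rw [h.right_eq]
    exact Ideal.pow_mem_of_mem _ (h2 h.isParamPair.right_mem) _ h.right_pos
  rw [hQX, Ideal.mem_span_singleton] at h3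
  exact h.isParamPair_base.not_dvd h3

/-- The pullback of an unbranched regular divisor is reduced. -/
theorem not_sq_dvd_of_not_isBranchedAt {P S : A} (hPS : IsParamPair P S)
    (hP : ¬ IsBranchedAt A B P) {t s : B} (ht : IsParamPair t s) :
    ¬ t ^ 2 ∣ algebraMap A B P := by
  rintro ⟨c, hc⟩
  have htp : (Ideal.span {t}).IsPrime := ht.isPrime_span_left
  have hPQ : P ∈ (Ideal.span {t}).under A := by
    change algebraMap A B P ∈ Ideal.span {t}
    rw [Ideal.mem_span_singleton, hc, sq, mul_assoc]
    exact dvd_mul_right _ _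
  have hunder := (hPS.eq_or_maximalIdeal_le hPQ).resolve_right (h.not_maximalIdeal_le_under ht rfl)
  have hur : Algebra.IsUnramifiedAt A (Ideal.span {t}) := by
    by_contra hur
    exact hP ⟨⟨_, htp⟩, hunder, hur⟩
  let L := Localization.AtPrime (Ideal.span {t})
  have h1 := Algebra.IsUnramifiedAt.maximalIdeal_eq_span (Ideal.span {t}) hunder
  have h2 : algebraMap B L t ∈ maximalIdeal L :=
    algebraMap_mem_maximalIdeal_atPrime _ (Ideal.mem_span_singleton_self t)
  have h3 := h2
  rw [h1, Ideal.mem_span_singleton, IsScalarTower.algebraMap_apply A B L, hc] at h2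
  obtain ⟨d, hd⟩ := h2
  have h4 : algebraMap B L t ≠ 0 :=
    (map_ne_zero_iff _ (algebraMap_atPrime_injective _)).2 ht.prime_left.ne_zero
  have h5 : algebraMap B L t * (algebraMap B L c * d) = 1 := by
    refine mul_left_cancel₀ h4 ?_
    conv_rhs => rw [mul_one, hd]
    rw [map_mul, map_pow]
    ring
  exact h3 (IsUnit.of_mul_eq_one _ h5)

variable [UniqueFactorizationMonoid A]

theorem branchDivisor_eq_singleton (hn : 1 < n) (hm : m = 1) :
    branchDivisor A B = {h.isParamPair_base.prime_left.toPrimeSpectrum} := by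
  ext p
  rw [mem_branchDivisor_iff, Set.mem_singleton_iff]
  constructor
  · rintro ⟨q, hq, rfl, hb⟩
    rw [h.isBranchedAt_iff hq] at hb
    exact hq.toPrimeSpectrum_eq_of_associated _ (hb.resolve_right (by omega)).1
  · rintro rfl
    exact ⟨X, h.isParamPair_base.prime_left, rfl, h.isBranchedAt_left hn⟩

theorem branchDivisor_eq_pair (hn : 1 < n) (hm : 1 < m) :
    branchDivisor A B = {h.isParamPair_base.prime_left.toPrimeSpectrum,
      h.isParamPair_base.prime_right.toPrimeSpectrum} := by
  ext p
  rw [mem_branchDivisor_iff, Set.mem_insert_iff, Set.mem_singleton_iff]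
  constructor
  · rintro ⟨q, hq, rfl, hb⟩
    rw [h.isBranchedAt_iff hq] at hb
    rcases hb with hb | hb
    · exact Or.inl (hq.toPrimeSpectrum_eq_of_associated _ hb.1)
    · exact Or.inr (hq.toPrimeSpectrum_eq_of_associated _ hb.1)
  · rintro (rfl | rfl)
    · exact ⟨X, h.isParamPair_base.prime_left, rfl, h.isBranchedAt_left hn⟩
    · exact ⟨Y, h.isParamPair_base.prime_right, rfl, h.symm.isBranchedAt_left hm⟩

end IsTameRadicalExtension

namespace IsCyclicCover

/-- If `B` is regular, it is obtained from `A` by adjoining roots of parameters. -/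
theorem exists_isTameRadicalExtension {A B : Type*} [CommRing A] [CommRing B] [Algebra A B]
    {τ : B ≃ₐ[A] B} {ζ : A} {δ : ℕ} (h : IsCyclicCover τ ζ δ) [IsDomain A] [IsDomain B]
    [IsLocalRing A] [IsLocalRing B] [IsNoetherianRing A] [IsNoetherianRing B] [FaithfulSMul A B]
    [IsLocalHom (algebraMap A B)] [Module.Finite A B] [UniqueFactorizationMonoid A]
    (hres : ∀ b : B, ∃ a : A, b - algebraMap A B a ∈ maximalIdeal B)
    (hdimA : 2 ≤ ringKrullDim A) (hdim : 2 ≤ ringKrullDim B) {t₁ t₂ : B}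
    (ht : maximalIdeal B = Ideal.span {t₁, t₂}) :
    ∃ (X Y : A) (x y : B) (n m : ℕ), IsTameRadicalExtension X Y x y n m ∧ n.Coprime m ∧
      n * m = δ := by
  obtain ⟨x, y, η, θ, hxy, ⟨hη, hx⟩, hθ, hy⟩ :=
    h.exists_isParamPair_eigen hdim (IsParamPair.of_span_eq hdim ht)
  obtain ⟨n, X, hn, hnδ, hX⟩ := h.exists_isEigenPower hη hx
  obtain ⟨m, Y, hm, hmδ, hY⟩ := h.exists_isEigenPower hθ hy
  have hco := h.coprime_of_isParamPair hres hxy hX hη hn hY hm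
  have hunit {k : ℕ} (hk : k ∣ δ) : IsUnit (k : A) :=
    isUnit_of_dvd_unit (Nat.cast_dvd_cast hk) h.isUnit_natCast
  exact ⟨X, Y, x, y, n, m, ⟨.of_span_eq hdimA (h.maximalIdeal_eq_span hres hxy hX hη hn hY hθ hm hco),
    hxy, hX.algebraMap_eq, hY.algebraMap_eq, span_monomials_eq_top hres hxy hX hn hY hm,
    hunit hnδ, hunit hmδ⟩, hco, h.mul_eq_degree hres hxy hX hn hnδ hY hm hmδ hco⟩

end IsCyclicCover

theorem IsParamPair.exists_eq_unit_mul_pow_add_unit_mul_pow {S : Type*} [CommRing S] [IsDomain S]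
    [IsLocalRing S] [IsNoetherianRing S] {X Y P T : S} (h : IsParamPair X Y) (hP : IsParamPair P T)
    (hX : ¬ X ∣ P) (hY : ¬ Y ∣ P) :
    ∃ (ε₁ ε₂ : S) (c d : ℕ), IsUnit ε₁ ∧ IsUnit ε₂ ∧ 0 < c ∧ 0 < d ∧ P = ε₁ * X ^ c + ε₂ * Y ^ d := by
  obtain ⟨d, ε₂, α, hε₂, h1⟩ := h.exists_eq_unit_mul_pow_add hX
  obtain ⟨c, ε₁, β, hε₁, h2⟩ := h.symm.exists_eq_unit_mul_pow_add hY
  have hpos {X Y u r : S} {k : ℕ} (h : IsParamPair X Y) (hu : IsUnit u)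
      (e : P = u * Y ^ k + r * X) : 0 < k := by
    refine Nat.pos_of_ne_zero ?_
    rintro rfl
    rw [pow_zero, mul_one] at e
    have := Ideal.sub_mem _ hP.left_mem (Ideal.mul_mem_left _ r h.left_mem)
    rw [e, add_sub_cancel_right] at this
    exact this hu
  have hc := hpos h.symm hε₁ h2
  have hd := hpos h hε₂ h1
  by_cases hα : IsUnit α
  · exact ⟨α, ε₂, 1, d, hα, hε₂, one_pos, hd, by rw [h1]; ring⟩
  by_cases hβ : IsUnit β
  · exact ⟨ε₁, β, c, 1, hε₁, hβ, hc, one_pos, by rw [h2]; ring⟩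
  exfalso
  have hone {X Y u r : S} {k : ℕ} (h : IsParamPair X Y) (hr : ¬ IsUnit r) (hk : 0 < k)
      (e : P = u * Y ^ k + r * X) : k = 1 := by
    obtain ⟨j, rfl⟩ := Nat.exists_eq_succ_of_ne_zero hk.ne'
    have h3 := (hP.isUnit_of_eq h (a := r) (b := u * Y ^ j) (by rw [e, Nat.succ_eq_add_one]; ring)).resolve_left hr
    rcases Nat.eq_zero_or_pos j with rfl | hj
    · rfl
    · exact absurd (isUnit_of_mul_isUnit_right h3)
        (Ideal.pow_mem_of_mem (maximalIdeal S) h.right_mem j hj)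
  obtain rfl := hone h.symm hβ hc h2
  obtain rfl := hone h hα hd h1
  have h3 : Y ∣ (ε₁ - α) * X := ⟨ε₂ - β, by linear_combination h1 - h2⟩
  have h4 := (h.prime_right.dvd_or_dvd h3).resolve_right h.not_dvd'
  have h5 := Ideal.add_mem _ (Ideal.mem_of_dvd _ h4 h.right_mem) ((mem_maximalIdeal _).2 hα)
  rw [sub_add_cancel] at h5
  exact h5 hε₁

section Classification

variable {R : Type u} [CommRing R] [IsDomain R] [IsDiscreteValuationRing R]
  [IsAdicComplete (maximalIdeal R) R] (K : Type*) [Field K] [Algebra R K] [IsFractionRing R K]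
  {π : R} (hπ : Irreducible π) {A B : Type v} [CommRing A] [CommRing B] [Algebra R A] [Algebra R B]
  [Algebra A B] [IsScalarTower R A B] [Module.Finite A B] [IsDomain A] [IsDomain B]
  [IsLocalRing A] [IsLocalRing B] [IsNoetherianRing A] [IsNoetherianRing B] [FaithfulSMul A B]
  [UniqueFactorizationMonoid A]

include hπ in
/-- The branch divisors for which a regular cover of a smooth base has normal crossings. -/
theorem IsTameRadicalExtension.branchDivisor_of_normalCrossings
    (hresA : Function.Surjective ((Ideal.Quotient.mk (maximalIdeal A)).comp (algebraMap R A)))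
    {X Y T : A} {x y : B} {n m δ : ℕ} (h : IsTameRadicalExtension X Y x y n m) (hco : n.Coprime m)
    (hδ : n * m = δ) (hn : 1 < n) (hP : IsParamPair (algebraMap R A π) T)
    (hXP : ¬ X ∣ algebraMap R A π)
    {t₁ t₂ w : B} (ht : IsParamPair t₁ t₂) (hw : IsUnit w) {a b : ℕ} (hab : 0 < a + b)
    (hπB : algebraMap R B π = w * (t₁ ^ a * t₂ ^ b))
    {p : PrimeSpectrum A} (hp : p = h.isParamPair_base.prime_left.toPrimeSpectrum) :
    (branchDivisor A B = {p} ∧ IsRegularLocalRing (A ⧸ p.asIdeal) ∧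
      (horizontalDegree R K p = 1 ∨ (δ = 2 ∧ horizontalDegree R K p = 2))) ∨
    (∃ p', IsVertical R p' ∧ branchDivisor A B = {p, p'} ∧
      CoprimeRamification B p p' ∧ horizontalDegree R K p = 1) := by
  subst hp
  have hdeg {u c : A} {v : ℕ} (hu : IsUnit u) (hv : algebraMap R A π = u * Y ^ v + c * X) :
      horizontalDegree R K h.isParamPair_base.prime_left.toPrimeSpectrum = v :=
    horizontalDegree_eq_of_isParamPair hπ K rfl hP.left_mem hXP hresA h.isParamPair_base hu hv
  have hreg : IsRegularLocalRing (A ⧸ h.isParamPair_base.prime_left.toPrimeSpectrum.asIdeal) :=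
    h.isParamPair_base.isRegularLocalRing_quotient
  have hm := h.right_pos
  by_cases hYP : Y ∣ algebraMap R A π
  · have hdeg1 : horizontalDegree R K h.isParamPair_base.prime_left.toPrimeSpectrum = 1 := by
      obtain ⟨u, hu⟩ := h.isParamPair_base.prime_right.associated_of_dvd hP.prime_left hYP
      exact hdeg (c := 0) u.isUnit (by rw [← hu]; ring)
    rcases Nat.lt_or_ge 1 m with hm1 | hm1
    · refine Or.inr ⟨h.isParamPair_base.prime_right.toPrimeSpectrum, ?_,
        h.branchDivisor_eq_pair hn hm1, ?_, hdeg1⟩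
      · rw [isVertical_iff hπ]
        exact Ideal.mem_span_singleton.2 hYP
      · intro Q₁ Q₂ h1 h2
        rw [h.ramificationIdx_left h1, h.symm.ramificationIdx_left h2]
        exact hco
    · exact Or.inl ⟨h.branchDivisor_eq_singleton hn (by omega), hreg, Or.inl hdeg1⟩
  obtain ⟨ε₁, ε₂, c, d, hε₁, hε₂, hc, hd, he⟩ :=
    h.isParamPair_base.exists_eq_unit_mul_pow_add_unit_mul_pow hP hXP hYP
  have hdegd : horizontalDegree R K h.isParamPair_base.prime_left.toPrimeSpectrum = d := by
    obtain ⟨j, rfl⟩ := Nat.exists_eq_succ_of_ne_zero hc.ne'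
    exact hdeg (c := ε₁ * X ^ j) hε₂ (by rw [he, Nat.succ_eq_add_one]; ring)
  have hunbr : ¬ IsBranchedAt A B (algebraMap R A π) := by
    rw [h.isBranchedAt_iff hP.prime_left]
    rintro (h1 | h1)
    · exact hXP h1.1.symm.dvd
    · exact hYP h1.1.symm.dvd
  have hPB : algebraMap A B (algebraMap R A π) = w * (t₁ ^ a * t₂ ^ b) := by
    rw [← IsScalarTower.algebraMap_apply, hπB]
  have ha : a ≤ 1 := by
    by_contra! ha
    refine h.not_sq_dvd_of_not_isBranchedAt hP hunbr ht ?_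
    rw [hPB]
    exact ((pow_dvd_pow t₁ ha).mul_right _).mul_left _
  have hb : b ≤ 1 := by
    by_contra! hb
    refine h.not_sq_dvd_of_not_isBranchedAt hP hunbr ht.symm ?_
    rw [hPB]
    exact ((pow_dvd_pow t₂ hb).mul_left _).mul_left _
  have heB : w * (t₁ ^ a * t₂ ^ b) =
      algebraMap A B ε₁ * x ^ (n * c) + algebraMap A B ε₂ * y ^ (m * d) := by
    rw [← hPB, he, map_add, map_mul, map_mul, map_pow, map_pow, h.left_eq, h.right_eq, pow_mul,
      pow_mul]
  left
  rcases h.isParamPair.eq_one_or_of_normalCrossings ht hw (hε₁.map _) (hε₂.map _)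
    (Nat.mul_pos h.left_pos hc) (Nat.mul_pos hm hd) hab ha hb heB with h1 | h1 | ⟨h1, h2⟩
  · have := Nat.eq_one_of_mul_eq_one_right h1
    omega
  · have hm1 : m = 1 := Nat.eq_one_of_mul_eq_one_right h1
    have hd1 : d = 1 := Nat.eq_one_of_mul_eq_one_left h1
    exact ⟨h.branchDivisor_eq_singleton hn hm1, hreg, Or.inl (hdegd.trans hd1)⟩
  · have hn2 : n = 2 := by
      have := Nat.le_of_dvd two_pos (Dvd.intro _ h1)
      omega
    have hm1 : m = 1 := by
      rcases (Nat.dvd_prime Nat.prime_two).1 (Dvd.intro _ h2) with h3 | h3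
      · exact h3
      · rw [hn2, h3] at hco
        simp at hco
    have hd2 : d = 2 := by rwa [hm1, one_mul] at h2
    exact ⟨h.branchDivisor_eq_singleton hn hm1, hreg,
      Or.inr ⟨by rw [← hδ, hn2, hm1], hdegd.trans hd2⟩⟩

include hπ in
/-- A double cover of a smooth base, branched along a regular divisor of degree two, is a node. -/
theorem hasNormalCrossings_of_double_cover [IsAdicComplete (maximalIdeal B) B]
    (hdim : 2 ≤ ringKrullDim B)
    (hresB : Function.Surjective ((Ideal.Quotient.mk (maximalIdeal B)).comp (algebraMap R B)))
    (hroot : ∀ u : A, IsUnit u → ∃ v, v ^ 2 = u) (h2 : IsUnit (2 : A)) {X Y T u c : A} {x : B}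
    (hXY : IsParamPair X Y) (hP : IsParamPair (algebraMap R A π) T)
    (hX : algebraMap A B X = x ^ 2) (hxY : maximalIdeal B = Ideal.span {x, algebraMap A B Y})
    (hu : IsUnit u) (he : algebraMap R A π = u * Y ^ 2 + c * X) : HasNormalCrossings R π B := by
  have hc : IsUnit c := by
    refine (hP.isUnit_of_eq hXY (a := c) (b := u * Y) (by rw [he]; ring)).resolve_right fun h1 ↦ ?_
    exact hXY.right_mem (isUnit_of_mul_isUnit_right h1)
  obtain ⟨r, hr⟩ := hroot u hu
  obtain ⟨s, hs⟩ := hroot (-c) hc.neg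
  have hrU : IsUnit r := (isUnit_pow_iff two_ne_zero).1 (hr ▸ hu)
  have hsU : IsUnit s := (isUnit_pow_iff two_ne_zero).1 (hs ▸ hc.neg)
  set y := algebraMap A B Y with hy
  have hspan : maximalIdeal B = Ideal.span {algebraMap A B r * y - algebraMap A B s * x,
      algebraMap A B r * y + algebraMap A B s * x} := by
    obtain ⟨d, hd⟩ := h2.exists_left_inv
    obtain ⟨r', hr'⟩ := hrU.exists_left_inv
    obtain ⟨s', hs'⟩ := hsU.exists_left_inv
    have hd := congrArg (algebraMap A B) hd
    have hr' := congrArg (algebraMap A B) hr'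
    have hs' := congrArg (algebraMap A B) hs'
    rw [map_mul, map_one] at hd hr' hs'
    rw [map_ofNat] at hd
    rw [hxY]
    apply le_antisymm
    · rw [Ideal.span_le]
      rintro z (rfl | rfl)
      · refine Ideal.mem_span_pair.2 ⟨-(algebraMap A B d * algebraMap A B s'),
          algebraMap A B d * algebraMap A B s', ?_⟩
        linear_combination algebraMap A B s' * algebraMap A B s * z * hd + z * hs'
      · refine Ideal.mem_span_pair.2 ⟨algebraMap A B d * algebraMap A B r',
          algebraMap A B d * algebraMap A B r', ?_⟩
        linear_combination algebraMap A B r' * algebraMap A B r * y * hd + y * hr'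
    · rw [Ideal.span_le]
      rintro z (rfl | rfl)
      · exact Ideal.mem_span_pair.2 ⟨-algebraMap A B s, algebraMap A B r, by ring⟩
      · exact Ideal.mem_span_pair.2 ⟨algebraMap A B s, algebraMap A B r, by ring⟩
  refine HasNormalCrossings.of_isParamPair (a := 1) (b := 1) hπ hresB (.of_span_eq hdim hspan)
    isUnit_one (by omega) ?_
  have h3 := congrArg (algebraMap A B) hr
  have h4 := congrArg (algebraMap A B) hs
  rw [map_pow] at h3 h4
  rw [map_neg] at h4
  rw [IsScalarTower.algebraMap_apply R A B, he, map_add, map_mul, map_mul, map_pow, hX, ← hy]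
  linear_combination (-y ^ 2) * h3 + x ^ 2 * h4

end Classification

namespace IsCyclicCover

variable {R : Type u} [CommRing R] [IsDomain R] [IsDiscreteValuationRing R]
  [IsAdicComplete (maximalIdeal R) R]
  {π : R} (hπ : Irreducible π) {A B : Type v} [CommRing A] [CommRing B] [Algebra R A] [Algebra R B]
  [Algebra A B] [IsScalarTower R A B] [Module.Finite A B] [IsDomain A] [IsDomain B]
  [IsLocalRing A] [IsLocalRing B] [IsNoetherianRing A] [IsNoetherianRing B] [FaithfulSMul A B]
  [IsLocalHom (algebraMap A B)] [UniqueFactorizationMonoid A] [IsIntegrallyClosed B]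
  [IsAdicComplete (maximalIdeal B) B]
  {τ : B ≃ₐ[A] B} {ζ : A} {δ : ℕ} (h : IsCyclicCover τ ζ δ)
  (hroot : ∀ n : ℕ, IsUnit (n : A) → ∀ u : A, IsUnit u → ∃ v, v ^ n = u)
  (hresB : Function.Surjective ((Ideal.Quotient.mk (maximalIdeal B)).comp (algebraMap R B)))
  (hdimB : 2 ≤ ringKrullDim B)

include hπ h hroot hresB hdimB

theorem normalCrossings_of_vertical_branchDivisor {t₁ t₂ w : A} (ht : IsParamPair t₁ t₂)
    (hw : IsUnit w) {a b : ℕ} (hab : 0 < a + b) (hπA : algebraMap R A π = w * (t₁ ^ a * t₂ ^ b))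
    (hbr : branchDivisor A B = ∅ ∨ ∃ p, branchDivisor A B = {p} ∧ IsVertical R p) :
    (IsRegularLocalRing B ∧ HasNormalCrossings R π B) ∧ (IsNonNodal R A → IsNonNodal R B) := by
  have hvert : ∀ q : A, Prime q → IsBranchedAt A B q → q ∣ t₁ * t₂ := by
    intro q hq hb
    have hmem := hq.mem_branchDivisor_iff.2 hb
    rcases hbr with he | ⟨p, he, hp⟩
    · rw [he] at hmem
      exact absurd hmem (Set.notMem_empty _)
    · rw [he, Set.mem_singleton_iff] at hmem
      rw [← hmem, isVertical_iff hπ, hπA] at hp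
      have h1 : q ∣ w * (t₁ ^ a * t₂ ^ b) := Ideal.mem_span_singleton.1 hp
      rcases hq.dvd_or_dvd (hw.dvd_mul_left.1 h1) with h2 | h2
      · exact (hq.dvd_of_dvd_pow h2).mul_right _
      · exact (hq.dvd_of_dvd_pow h2).mul_left _
  have main {X Y : A} (hXY : IsParamPair X Y) {a b : ℕ} (hab : 0 < a + b)
      (hπA : algebraMap R A π = w * (X ^ a * Y ^ b))
      (hv : ∀ q : A, Prime q → IsBranchedAt A B q → q ∣ X * Y) (hY : ¬ IsBranchedAt A B Y) :
      (IsRegularLocalRing B ∧ HasNormalCrossings R π B) ∧ (IsNonNodal R A → IsNonNodal R B) := by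
    obtain ⟨x, y, hp⟩ := h.exists_isRadicalPair_of_not_isBranchedAt hXY
      (hroot δ h.isUnit_natCast) hv hY
    exact ⟨⟨hp.isRegularLocalRing hdimB, hp.hasNormalCrossings hπ hdimB hresB h.pos hw hab hπA⟩,
      hp.isNonNodal hπ hdimB hXY h.pos hw hab hπA⟩
  by_cases hb2 : IsBranchedAt A B t₂
  · refine main (a := b) (b := a) ht.symm (by omega) (by rw [hπA, mul_comm (t₁ ^ a)])
      (fun q hq hb ↦ mul_comm t₁ t₂ ▸ hvert q hq hb) fun hb1 ↦ ?_
    have h1 := ht.prime_left.mem_branchDivisor_iff.2 hb1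
    have h2 := ht.prime_right.mem_branchDivisor_iff.2 hb2
    rcases hbr with he | ⟨p, he, hp⟩
    · rw [he] at h1
      exact absurd h1 (Set.notMem_empty _)
    · rw [he, Set.mem_singleton_iff] at h1 h2
      exact ht.not_dvd
        (ht.prime_left.associated_of_toPrimeSpectrum_eq ht.prime_right (h1.trans h2.symm)).dvd
  · exact main ht hab hπA hvert hb2

variable (K : Type*) [Field K] [Algebra R K] [IsFractionRing R K]
  (hresA : Function.Surjective ((Ideal.Quotient.mk (maximalIdeal A)).comp (algebraMap R A)))
  (hdimA : 2 ≤ ringKrullDim A)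

include hresA hdimA

theorem normalCrossings_iff_of_smooth [IsAdicComplete (maximalIdeal A) A]
    (hres : ∀ b : B, ∃ a : A, b - algebraMap A B a ∈ maximalIdeal B)
    {T : A} (hP : IsParamPair (algebraMap R A π) T)
    {p : PrimeSpectrum A} (hp : p ∈ branchDivisor A B) (hpv : ¬ IsVertical R p) :
    (IsRegularLocalRing B ∧ HasNormalCrossings R π B) ↔
      ((branchDivisor A B = {p} ∧ IsRegularLocalRing (A ⧸ p.asIdeal) ∧
          (horizontalDegree R K p = 1 ∨ (δ = 2 ∧ horizontalDegree R K p = 2))) ∨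
        (∃ p', IsVertical R p' ∧ branchDivisor A B = {p, p'} ∧
          CoprimeRamification B p p' ∧ horizontalDegree R K p = 1)) := by
  obtain ⟨X, hX, rfl, hXb⟩ := mem_branchDivisor_iff.1 hp
  rw [isVertical_iff hπ] at hpv
  replace hpv : ¬ X ∣ algebraMap R A π := fun h1 ↦ hpv (Ideal.mem_span_singleton.2 h1)
  constructor
  · rintro ⟨-, hnc⟩
    obtain ⟨-, -, t₁, t₂, w, a, b, hw, hab, hspan, hπB⟩ := hnc.exists_params hπ
    obtain ⟨X', Y', x, y, n, m, ht, hco, hnm⟩ :=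
      h.exists_isTameRadicalExtension hres hdimA hdimB hspan
    have htB : IsParamPair t₁ t₂ := .of_span_eq hdimB hspan
    rcases (ht.isBranchedAt_iff hX).1 hXb with ⟨h1, h2⟩ | ⟨h1, h2⟩
    · exact ht.branchDivisor_of_normalCrossings K hπ hresA hco hnm h2 hP
        (fun h3 ↦ hpv (h1.dvd.trans h3)) htB hw hab hπB (hX.toPrimeSpectrum_eq_of_associated _ h1)
    · exact ht.symm.branchDivisor_of_normalCrossings K hπ hresA hco.symm ((mul_comm _ _).trans hnm)
        h2 hP (fun h3 ↦ hpv (h1.dvd.trans h3)) htB hw hab hπB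
        (hX.toPrimeSpectrum_eq_of_associated _ h1)
  · have hone {x y : B} {n₁ n₂ : ℕ}
        (hr : IsRadicalPair τ δ X (algebraMap R A π) x y n₁ n₂) :
        IsRegularLocalRing B ∧ HasNormalCrossings R π B :=
      ⟨hr.isRegularLocalRing hdimB, hr.hasNormalCrossings (a := 0) (b := 1) hπ hdimB hresB h.pos
        isUnit_one (by omega) (by ring)⟩
    have hpair (hd : horizontalDegree R K hX.toPrimeSpectrum = 1) :
        IsParamPair X (algebraMap R A π) :=
      .of_span_eq hdimA
        (maximalIdeal_eq_span_of_horizontalDegree_eq_one hπ K rfl hP.left_mem hpv hd)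
    rintro (⟨hbr, hreg, hd⟩ | ⟨p', hp', hbr, hco, hd⟩)
    · have hass {q : A} (hq : Prime q) (hb : IsBranchedAt A B q) : Associated q X := by
        have := hq.mem_branchDivisor_iff.2 hb
        rw [hbr, Set.mem_singleton_iff] at this
        exact hq.associated_of_toPrimeSpectrum_eq hX this
      have hunbr {Y : A} (hXY : IsParamPair X Y) : ¬ IsBranchedAt A B Y := fun hb ↦
        hXY.not_dvd (hass hXY.prime_right hb).symm.dvd
      rcases hd with hd | ⟨hδ, hd⟩
      · obtain ⟨x, y, hr⟩ := h.exists_isRadicalPair_of_not_isBranchedAt (hpair hd)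
          (hroot δ h.isUnit_natCast) (fun q hq hb ↦ (hass hq hb).dvd.mul_right _)
          (hunbr (hpair hd))
        exact hone hr
      · subst hδ
        obtain ⟨Y, hY⟩ := hP.exists_maximalIdeal_eq_span hX.ne_zero hreg
        have hXY : IsParamPair X Y := .of_span_eq hdimA hY
        obtain ⟨x, y, hr⟩ := h.exists_isRadicalPair_of_not_isBranchedAt hXY
          (hroot 2 h.isUnit_natCast) (fun q hq hb ↦ (hass hq hb).dvd.mul_right _) (hunbr hXY)
        obtain ⟨v, u, c, hu, he⟩ := hXY.exists_eq_unit_mul_pow_add hpv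
        have hv := horizontalDegree_eq_of_isParamPair (p := hX.toPrimeSpectrum) hπ K rfl hP.left_mem
          hpv hresA hXY hu he
        obtain rfl : v = 2 := hv.symm.trans hd
        refine ⟨hr.isRegularLocalRing hdimB, hasNormalCrossings_of_double_cover hπ hdimB hresB
          (hroot 2 h.isUnit_natCast) (by simpa using h.isUnit_natCast) hXY hP hr.left_eq ?_ hu he⟩
        rw [hr.right_eq, pow_one]
        exact hr.span_eq
    · have hXP := hpair hd
      have hp'm : p' ∈ branchDivisor A B := by rw [hbr]; simp
      obtain ⟨q, hq, rfl, -⟩ := mem_branchDivisor_iff.1 hp'm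
      rw [isVertical_iff hπ] at hp'
      have hqP : Associated q (algebraMap R A π) :=
        hq.associated_of_dvd hP.prime_left (Ideal.mem_span_singleton.1 hp')
      have hbr' (r : A) (hr : Prime r) (hb : IsBranchedAt A B r) : r ∣ X * algebraMap R A π := by
        have := hr.mem_branchDivisor_iff.2 hb
        rw [hbr, Set.mem_insert_iff, Set.mem_singleton_iff] at this
        rcases this with h1 | h1
        · exact (hr.associated_of_toPrimeSpectrum_eq hX h1).dvd.mul_right _
        · exact ((hr.associated_of_toPrimeSpectrum_eq hq h1).trans hqP).dvd.mul_left _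
      obtain ⟨x, y, n₁, n₂, hr⟩ := h.exists_isRadicalPair_of_coprime hXP
        (hroot δ h.isUnit_natCast) hbr' fun Q₁ Q₂ h1 h2 ↦ hco Q₁ Q₂ h1
          (h2.trans (Ideal.span_singleton_eq_span_singleton.2 hqP.symm))
      exact hone hr

end IsCyclicCover

theorem mainTheorem11
    -- the complete discrete valuation ring `R = 𝒪_K`, with algebraically closed residue field
    (R : Type u) [CommRing R] [IsDomain R] [IsDiscreteValuationRing R]
    [IsAdicComplete (maximalIdeal R) R] [IsAlgClosed (ResidueField R)]
    (K : Type*) [Field K] [Algebra R K] [IsFractionRing R K]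
    (π : R) (hπ : Irreducible π)
    -- the rings `A` of `𝒵` and `B` of `𝒲`, with function fields `F` and `L`
    (A B : Type v) [CommRing A] [CommRing B] [Algebra R A] [Algebra R B] [Algebra A B]
    [IsScalarTower R A B] [Module.Finite A B]
    (hA : IsLocalArithmeticSurface R A) (hB : IsLocalArithmeticSurface R B)
    (F L : Type*) [Field F] [Field L] [Algebra A F] [IsFractionRing A F]
    [Algebra B L] [IsFractionRing B L] [Algebra F L] [Algebra A L]
    [IsScalarTower A F L] [IsScalarTower A B L]
    -- `𝒲` is the normalization of `𝒵` in `L`, and `L / F` is cyclic of degree `δ`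
    [IsIntegralClosure B A L]
    [FiniteDimensional F L] [IsGalois F L] [IsCyclic (L ≃ₐ[F] L)]
    (δ : ℕ) (hδ : Module.finrank F L = δ)
    (hchar : ¬ ringChar (ResidueField R) ∣ δ)
    (hreg : IsRegularLocalRing A) (hnc : HasNormalCrossings R π A) :
    ((branchDivisor A B = ∅ ∨ ∃ p, branchDivisor A B = {p} ∧ IsVertical R p) →
      (IsRegularLocalRing B ∧ HasNormalCrossings R π B) ∧
      (IsNonNodal R A → IsNonNodal R B)) ∧
    (IsSmoothAtClosedPoint R A →
      ∀ p ∈ branchDivisor A B, ¬ IsVertical R p →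
        ((IsRegularLocalRing B ∧ HasNormalCrossings R π B) ↔
          ((branchDivisor A B = {p} ∧ IsRegularLocalRing (A ⧸ p.asIdeal) ∧
              (horizontalDegree R K p = 1 ∨ (δ = 2 ∧ horizontalDegree R K p = 2))) ∨
            (∃ p', IsVertical R p' ∧ branchDivisor A B = {p, p'} ∧
              CoprimeRamification B p p' ∧ horizontalDegree R K p = 1)))) := by
  subst hδ
  obtain ⟨hAl, hAc⟩ := hA.exists_isAdicComplete
  obtain ⟨hBl, hBc⟩ := hB.exists_isAdicComplete
  have hAn : IsNoetherianRing A := hreg.toIsNoetherian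
  have hBn : IsNoetherianRing B := IsNoetherianRing.of_finite A B
  have hAd : IsDomain A := (IsFractionRing.injective A F).isDomain (algebraMap A F)
  have hBd : IsDomain B := (IsFractionRing.injective B L).isDomain (algebraMap B L)
  have hf : FaithfulSMul A B := by
    rw [faithfulSMul_iff_algebraMap_injective]
    have h1 : Function.Injective (algebraMap A L) := by
      rw [IsScalarTower.algebraMap_eq A F L]
      exact (algebraMap F L).injective.comp (IsFractionRing.injective A F)
    rw [IsScalarTower.algebraMap_eq A B L] at h1
    exact Function.Injective.of_comp (f := algebraMap B L) h1
  obtain ⟨hresA, hdimA, t₁, t₂, w, a, b, hw, hab, hspan, hπA⟩ := hnc.exists_params hπ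
  have ht : IsParamPair t₁ t₂ := .of_span_eq hdimA hspan
  have hUFD : UniqueFactorizationMonoid A := ht.uniqueFactorizationMonoid
  have hBic : IsIntegrallyClosed B := isIntegrallyClosed_of_isIntegralClosure A B L
  have hk : IsAlgClosed (ResidueField A) := isAlgClosed_residueField_of_surjective hresA
  have hres : ∀ b : B, ∃ a : A, b - algebraMap A B a ∈ maximalIdeal B :=
    exists_sub_algebraMap_mem_maximalIdeal
  have hresB := surjective_mk_comp_algebraMap hresA hres
  have hdimB : 2 ≤ ringKrullDim B := two_le_ringKrullDim_of_isParamPair ht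
  have hunit : IsUnit ((Module.finrank F L : ℕ) : A) := by
    have h1 : IsUnit ((Module.finrank F L : ℕ) : R) := by
      by_contra h1
      rw [← mem_nonunits_iff, ← mem_maximalIdeal, ← residue_eq_zero_iff, map_natCast,
        ringChar.spec] at h1
      exact hchar h1
    have := h1.map (algebraMap R A)
    rwa [map_natCast] at this
  obtain ⟨ζ, hζ⟩ := exists_isPrimitiveRoot hunit
  obtain ⟨τ, hτ⟩ := exists_isCyclicCover (B := B) F L hζ hunit
  have hroot : ∀ n : ℕ, IsUnit (n : A) → ∀ u : A, IsUnit u → ∃ v, v ^ n = u :=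
    fun _ hn _ hu ↦ exists_pow_eq_of_isUnit hn hu
  refine ⟨hτ.normalCrossings_of_vertical_branchDivisor hπ hroot hresB hdimB ht hw hab hπA, ?_⟩
  intro hsm p hp hpv
  have hP0 : algebraMap R A π ≠ 0 := by
    rw [hπA]
    exact mul_ne_zero hw.ne_zero (mul_ne_zero (pow_ne_zero _ ht.prime_left.ne_zero)
      (pow_ne_zero _ ht.prime_right.ne_zero))
  have hsr := hsm.2
  rw [specialFiberIdeal_eq_span hπ] at hsr
  obtain ⟨T, hT⟩ := ht.exists_maximalIdeal_eq_span hP0 hsr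
  exact hτ.normalCrossings_iff_of_smooth hπ hroot hresB hdimB K hresA hdimA hres
    (.of_span_eq hdimA hT) hp hpv
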